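/- **Setup.** Let $G_{SM}=U(1)\times SU(2)\times SU(3)$, and let $\mathbb C_Y$ be the one-dimensional representation of $U(1)$ on which $\alpha$ acts as $\alpha^{3Y}$. Let $$F=(\mathbb C_{-1}\otimes\mathbb C^2\otimes\mathbb C)\oplus(\mathbb C_{1/3}\otimes\mathbb C^2\otimes\mathbb C^3)\oplus(\mathbb C_0\otimes\mathbb C\otimes\mathbb C)\oplus(\mathbb C_{-2}\otimes\mathbb C\otimes\mathbb C)\oplus(\mathbb C_{4/3}\otimes\mathbb C\otimes\mathbb C^3)\oplus(\mathbb C_{-2/3}\otimes\mathbb C\otimes\mathbb C^3)$$ be the fermion representation of $G_{SM}$, with orthonormal basis $\nu_L,e^-_L$; $u^c_L,d^c_L$; $\nu_R$; $e^-_R$; $u^c_R$; $d^c_R$ ($c=r,g,b$) in the six summands respectively, and let $G_{SM}\to U(F\oplus F^*)$ be the Standard Model representation ($F^*$ is the dual, with the dual basis $p^*$ orthonormal). Name the antifermions $\bar\nu_R=-\nu_L^*$, $\bar u_R^{\bar c}=-(u_L^c)^*$, $e^+_R=(e^-_L)^*$, $\bar d_R^{\bar c}=(d_L^c)^*$, $\bar\nu_L=\nu_R^*$,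 $e^+_L=(e_R^-)^*$, $\bar u_L^{\bar c}=(u_R^c)^*$, $\bar d_L^{\bar c}=(d_R^c)^*$. *Spinors.* Give $\Lambda\mathbb C^n$ the inner product in which the products $e_{i_1}\wedge\dots\wedge e_{i_p}$ ($i_1<\dots<i_p$) are orthonormal. Let $a_j^*\psi=e_j\wedge\psi$ and let $a_j$ be the adjoint of $a_j^*$. Regard $\mathbb C^n$ as the Euclidean space $\mathbb R^{2n}$; in its Clifford algebra $v^2=-|v|^2$, and $\mathrm{Spin}(2n)$ consists of the products of an even number of unit vectors; it covers $SO(2n)$ by $v\mapsto xvx^{-1}$. The Dirac spinor representation $\mathrm{Spin}(2n)\to U(\Lambda\mathbb C^n)$ is the restriction of the representation of the Clifford algebra with $e_j\mapsto\phi_j=i(a_j+a_j^*)$ and $ie_j\mapsto\pi_j=a_j-a_j^*$. Let $\mathrm{Spin}(4)\times\mathrm{Spin}(6)$ act on $\Lambda\mathbb C^2\otimes\Lambda\mathbb C^3$ by the tensor product of the Dirac spinor representations, and let $SU(5)$ act on $\Lambda\mathbb C^5$ by the algebra automorphisms extending the fundamental representation. The bases are $u,d$ of $\mathbb C^2$,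 $r,g,b$ of $\mathbb C^3$ and $u,d,r,g,b$ of $\mathbb C^5=\mathbb C^2\oplus\mathbb C^3$. *Homomorphisms.* $\phi:G_{SM}\to SU(5)$ is $\phi(\alpha,g,h)=\mathrm{diag}(\alpha^3g,\alpha^{-2}h)$, and $\beta:G_{SM}\to SU(2)\times SU(2)\times SU(4)$ is $\beta(\alpha,g,h)=(g,\mathrm{diag}(\alpha^3,\alpha^{-3}),\mathrm{diag}(\alpha h,\alpha^{-3}))$. *Unitary operators.* $g:\Lambda\mathbb C^2\otimes\Lambda\mathbb C^3\to\Lambda\mathbb C^5$ is $v\otimes w\mapsto v\wedge w$. The operators $h:F\oplus F^*\to\Lambda\mathbb C^2\otimes\Lambda\mathbb C^3$ and $f:F\oplus F^*\to\Lambda\mathbb C^5$ are given on the basis by the binary codes below, where $w=r\wedge g\wedge b$, $\bar r=g\wedge b$, $\bar g=b\wedge r$, $\bar b=r\wedge g$; the table gives $h$, and $f$ is given by the same table with $\otimes$ replaced by $\wedge$: $$\begin{array}{llll} \nu_L\mapsto u\otimes w & e_L^-\mapsto d\otimes w & u_L^c\mapsto u\otimes c & d_L^c\mapsto d\otimes c\\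 \nu_R\mapsto (u\wedge d)\otimes w & e_R^-\mapsto 1\otimes w & u_R^c\mapsto (u\wedge d)\otimes c & d_R^c\mapsto 1\otimes c\\ \bar\nu_R\mapsto d\otimes 1 & e_R^+\mapsto u\otimes 1 & \bar u_R^{\bar c}\mapsto d\otimes\bar c & \bar d_R^{\bar c}\mapsto u\otimes\bar c\\ \bar\nu_L\mapsto 1\otimes 1 & e_L^+\mapsto (u\wedge d)\otimes 1 & \bar u_L^{\bar c}\mapsto 1\otimes\bar c & \bar d_L^{\bar c}\mapsto (u\wedge d)\otimes\bar c \end{array}$$ For a unitary operator $T:V\to W$ let $U(T):U(V)\to U(W)$ be conjugation by $T$. **Theorem.** (i) The Dirac spinor representation of $\mathrm{Spin}(10)$ is faithful. (ii) $g\circ h=f$. (iii) There are * a continuous homomorphism $\psi:SU(5)\to\mathrm{Spin}(10)$ that lifts the inclusion $SU(5)\subset SO(10)$; * a continuous homomorphism $\eta:\mathrm{Spin}(4)\times\mathrm{Spin}(6)\to\mathrm{Spin}(10)$ that lifts the block diagonal inclusion $SO(4)\times SO(6)\subset SO(10)$; * an isomorphism of topological groups $\alpha:SU(2)\times SU(2)\times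 SU(4)\to\mathrm{Spin}(4)\times\mathrm{Spin}(6)$ under which the two factors $SU(2)$ act by their defining representation on $\Lambda^{\mathrm{odd}}\mathbb C^2$ in the basis $u,d$ and on $\Lambda^{\mathrm{ev}}\mathbb C^2$ in the basis $u\wedge d,1$ respectively, and $SU(4)$ acts by its defining representation on $\Lambda^{\mathrm{odd}}\mathbb C^3$ in the basis $r,g,b,w$; such that, with $\theta=\alpha\circ\beta$, the following cube commutes. Its top face is $\psi\circ\phi=\eta\circ\theta$, from $G_{SM}$ to $\mathrm{Spin}(10)$; its bottom face is $U(1)\circ U(f)=U(g)\circ U(h)$, from $U(F\oplus F^*)$ to $U(\Lambda\mathbb C^5)$; its vertical edges are the four representations of $G_{SM}$, $SU(5)$, $\mathrm{Spin}(4)\times\mathrm{Spin}(6)$ and $\mathrm{Spin}(10)$ above, and each of its four vertical faces, over $\phi$, $\psi$, $\theta$ and $\eta$ and with bottom edges $U(f)$, $U(1)$, $U(h)$ and $U(g)$ respectively, commutes. -/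

import Mathlib

open scoped TensorProduct ComplexConjugate

noncomputable section

namespace GUT

/-! ## The Hilbert space `Λ ℂⁿ` -/

/-- The exterior algebra of `ℂⁿ`; the product `*` is the wedge product. -/
abbrev Fock (n : ℕ) : Type := ExteriorAlgebra ℂ (Fin n → ℂ)

namespace Fock

/-- The `j`-th standard basis vector of `ℂⁿ`, as an element of `Λ¹ ℂⁿ`. -/
def e {n : ℕ} (j : Fin n) : Fock n := ExteriorAlgebra.ι ℂ (Pi.single j 1)

/-- The basis of `Λ ℂⁿ` consisting of the products `e_{i₁} ∧ ⋯ ∧ e_{iₚ}` with `i₁ < ⋯ < iₚ`. -/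
def basis (n : ℕ) : Module.Basis (Finset (Fin n)) ℂ (Fock n) :=
  (Pi.basisFun ℂ (Fin n)).ExteriorAlgebra

theorem basis_eq_prod {n : ℕ} (S : Finset (Fin n)) :
    basis n S = ((S.sort (· ≤ ·)).map e).prod := by
  rw [basis, ExteriorAlgebra.basis_apply]
  simp only [ExteriorAlgebra.ιMulti_family, ExteriorAlgebra.ιMulti_apply]
  congr 1
  apply List.ext_getElem
  · simp [Set.powersetCard.prodEquiv]
  · intro i h1 h2
    simp only [List.getElem_ofFn, List.getElem_map, Function.comp_apply, Pi.basisFun_apply, e]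
    congr 2

theorem basis_empty (n : ℕ) : basis n ∅ = 1 := by simp [basis_eq_prod]

theorem basis_insert {n : ℕ} (a : Fin n) (S : Finset (Fin n)) (h : ∀ x ∈ S, a < x) :
    basis n (insert a S) = e a * basis n S := by
  rw [basis_eq_prod, basis_eq_prod, Finset.sort_insert]
  · simp
  · exact fun b hb => (h b hb).le
  · exact fun ha => lt_irrefl _ (h a ha)

theorem e_mul_self {n : ℕ} (j : Fin n) : e j * e j = 0 := ExteriorAlgebra.ι_sq_zero _

theorem e_mul_e {n : ℕ} (j k : Fin n) : e j * e k = - (e k * e j) :=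
  eq_neg_of_add_eq_zero_left (ExteriorAlgebra.ι_add_mul_swap _ _)

/-- The Hermitian inner product on `Λ ℂⁿ` for which `basis n` is orthonormal. -/
abbrev core (n : ℕ) : InnerProductSpace.Core ℂ (Fock n) where
  inner x y := ∑ S, conj ((basis n).repr x S) * (basis n).repr y S
  conj_inner_symm x y := by simp [mul_comm]
  re_inner_nonneg x := by
    simp only [← Complex.normSq_eq_conj_mul_self]
    rw [← Complex.ofReal_sum, RCLike.re_eq_complex_re, Complex.ofReal_re]
    exact Finset.sum_nonneg fun S _ => Complex.normSq_nonneg _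
  add_left x y z := by simp [add_mul, Finset.sum_add_distrib]
  smul_left x y r := by simp [mul_assoc, Finset.mul_sum]
  definite x hx := by
    have hx' : ∑ S, conj ((basis n).repr x S) * (basis n).repr x S = 0 := hx
    simp only [← Complex.normSq_eq_conj_mul_self] at hx'
    rw [← Complex.ofReal_sum, Complex.ofReal_eq_zero,
      Finset.sum_eq_zero_iff_of_nonneg fun S _ => Complex.normSq_nonneg _] at hx'
    apply (basis n).repr.map_eq_zero_iff.1
    ext S
    simpa using hx' S (Finset.mem_univ S)

instance (n : ℕ) : NormedAddCommGroup (Fock n) := (core n).toNormedAddCommGroup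

instance (n : ℕ) : InnerProductSpace ℂ (Fock n) := .ofCore (core n).toCore

theorem inner_def {n : ℕ} (x y : Fock n) :
    inner ℂ x y = ∑ S, conj ((basis n).repr x S) * (basis n).repr y S := rfl

instance (n : ℕ) : FiniteDimensional ℂ (Fock n) := (basis n).finiteDimensional_of_finite

theorem orthonormal_basis (n : ℕ) : Orthonormal ℂ (basis n) := by
  classical
  rw [orthonormal_iff_ite]
  intro S T
  simp [inner_def, Finsupp.single_apply]

/-! ### Creation and annihilation operators -/

/-- The creation operator `aⱼ* : ψ ↦ eⱼ ∧ ψ`. -/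
def creation {n : ℕ} (j : Fin n) : Fock n →ₗ[ℂ] Fock n := LinearMap.mulLeft ℂ (e j)

/-- The annihilation operator `aⱼ`: the antiderivation (left contraction) with `aⱼ eₖ = δⱼₖ`. -/
def annihilation {n : ℕ} (j : Fin n) : Fock n →ₗ[ℂ] Fock n :=
  CliffordAlgebra.contractLeft (LinearMap.proj j : (Fin n → ℂ) →ₗ[ℂ] ℂ)

theorem creation_apply {n : ℕ} (j : Fin n) (x : Fock n) : creation j x = e j * x := rfl

theorem annihilation_one {n : ℕ} (j : Fin n) : annihilation j (1 : Fock n) = 0 :=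
  CliffordAlgebra.contractLeft_one (Q := 0) _

theorem annihilation_ι_mul {n : ℕ} (j : Fin n) (v : Fin n → ℂ) (x : Fock n) :
    annihilation j (ExteriorAlgebra.ι ℂ v * x)
      = v j • x - ExteriorAlgebra.ι ℂ v * annihilation j x :=
  CliffordAlgebra.contractLeft_ι_mul (Q := 0) _ v x

theorem annihilation_e_mul {n : ℕ} (j k : Fin n) (x : Fock n) :
    annihilation j (e k * x) = (if j = k then x else 0) - e k * annihilation j x := by
  rw [e, annihilation_ι_mul]
  by_cases h : j = k <;> simp [h]

theorem creation_basis {n : ℕ} (j : Fin n) (S : Finset (Fin n)) :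
    e j * basis n S
      = if j ∈ S then 0 else (-1 : ℂ) ^ (S.filter (· < j)).card • basis n (insert j S) := by
  induction S using Finset.induction_on_min with
  | empty => simpa using (basis_insert j ∅ (by simp)).symm
  | insert a S ha ih =>
    have haS : a ∉ S := fun h => lt_irrefl _ (ha a h)
    rcases lt_trichotomy j a with h | h | h
    · have h1 : ∀ x ∈ insert a S, j < x := by
        intro x hx
        rcases Finset.mem_insert.1 hx with rfl | hx
        · exact h
        · exact h.trans (ha x hx)
      have h2 : j ∉ insert a S := fun hj => lt_irrefl _ (h1 j hj)
      have h3 : (insert a S).filter (· < j) = ∅ := by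
        apply Finset.filter_eq_empty_iff.2
        exact fun x hx => not_lt.2 (h1 x hx).le
      rw [if_neg h2, h3, basis_insert _ _ h1]
      simp
    · subst h
      rw [basis_insert _ _ ha, ← mul_assoc, e_mul_self]
      simp
    · rw [basis_insert _ _ ha, ← mul_assoc, e_mul_e, neg_mul, mul_assoc, ih]
      by_cases hj : j ∈ S
      · simp [hj]
      · have h2 : j ∉ insert a S := by
          simp [hj, h.ne']
        have h3 : ((insert a S).filter (· < j)).card = (S.filter (· < j)).card + 1 := by
          rw [Finset.filter_insert, if_pos h, Finset.card_insert_of_notMem]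
          simp [haS]
        have h4 : ∀ x ∈ insert j S, a < x := by
          intro x hx
          rcases Finset.mem_insert.1 hx with rfl | hx
          · exact h
          · exact ha x hx
        rw [if_neg hj, if_neg h2, h3, Finset.insert_comm, basis_insert a _ h4, pow_succ]
        simp

theorem annihilation_basis {n : ℕ} (j : Fin n) (S : Finset (Fin n)) :
    annihilation j (basis n S)
      = if j ∈ S then (-1 : ℂ) ^ (S.filter (· < j)).card • basis n (S.erase j) else 0 := by
  induction S using Finset.induction_on_min with
  | empty => simp [basis_empty, annihilation_one]
  | insert a S ha ih =>
    have haS : a ∉ S := fun h => lt_irrefl _ (ha a h)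
    rw [basis_insert _ _ ha, annihilation_e_mul, ih]
    by_cases hja : j = a
    · subst hja
      have h3 : (insert j S).filter (· < j) = ∅ := by
        apply Finset.filter_eq_empty_iff.2
        intro x hx
        rcases Finset.mem_insert.1 hx with rfl | hx
        · exact lt_irrefl _
        · exact not_lt.2 (ha x hx).le
      rw [h3]
      simp [haS]
    · by_cases hj : j ∈ S
      · have h : a < j := ha j hj
        have h3 : ((insert a S).filter (· < j)).card = (S.filter (· < j)).card + 1 := by
          rw [Finset.filter_insert, if_pos h, Finset.card_insert_of_notMem]
          simp [haS]
        have h4 : ∀ x ∈ S.erase j, a < x := fun x hx => ha x (Finset.mem_of_mem_erase hx)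
        have h5 : (insert a S).erase j = insert a (S.erase j) :=
          Finset.erase_insert_of_ne (Ne.symm hja)
        rw [if_neg hja, if_pos hj, if_pos (Finset.mem_insert_of_mem hj), h3, h5,
          basis_insert a _ h4, pow_succ]
        simp
      · simp [hja, hj]

theorem inner_creation {n : ℕ} (j : Fin n) (x y : Fock n) :
    inner ℂ (creation j x) y = inner ℂ x (annihilation j y) := by
  classical
  have key : ∀ S T : Finset (Fin n),
      inner ℂ (creation j (basis n S)) (basis n T)
        = inner ℂ (basis n S) (annihilation j (basis n T)) := by
    intro S T
    have ho := orthonormal_iff_ite.1 (orthonormal_basis n)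
    rw [creation_apply, creation_basis, annihilation_basis]
    by_cases hS : j ∈ S
    · by_cases hT : j ∈ T
      · have : S ≠ T.erase j := fun h => Finset.notMem_erase j T (h ▸ hS)
        simp [hS, hT, inner_smul_right, ho, this]
      · simp [hS, hT]
    · by_cases hT : j ∈ T
      · by_cases h : S = T.erase j
        · subst h
          have h6 : (T.erase j).filter (· < j) = T.filter (· < j) := by
            ext x; simp only [Finset.mem_filter, Finset.mem_erase]
            exact ⟨fun h => ⟨h.1.2, h.2⟩, fun h => ⟨⟨h.2.ne, h.1⟩, h.2⟩⟩
          simp only [hS, hT, if_true, if_false, inner_smul_left, inner_smul_right, ho,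
            Finset.insert_erase hT, h6]
          simp
        · have h7 : insert j S ≠ T := fun h' => h (by rw [← h', Finset.erase_insert hS])
          simp [hS, hT, inner_smul_left, inner_smul_right, ho, h, h7]
      · have h7 : insert j S ≠ T := fun h' => hT (h' ▸ Finset.mem_insert_self j S)
        simp [hS, hT, inner_smul_left, ho, h7]
  rw [← (basis n).sum_repr x, ← (basis n).sum_repr y]
  simp only [map_sum, map_smul, sum_inner, inner_sum, inner_smul_left, inner_smul_right, key]

/-- The action of a linear map on `Λ ℂⁿ`, characterised by `g (v ∧ w) = g v ∧ g w`. -/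
def mapMatrix {n : ℕ} (A : Matrix (Fin n) (Fin n) ℂ) : Fock n →ₗ[ℂ] Fock n :=
  (ExteriorAlgebra.map A.mulVecLin).toLinearMap

theorem mapMatrix_one {n : ℕ} : mapMatrix (1 : Matrix (Fin n) (Fin n) ℂ) = LinearMap.id := by
  rw [mapMatrix, Matrix.mulVecLin_one, ExteriorAlgebra.map_id]; rfl

theorem mapMatrix_mul {n : ℕ} (A B : Matrix (Fin n) (Fin n) ℂ) :
    mapMatrix (A * B) = mapMatrix A ∘ₗ mapMatrix B := by
  rw [mapMatrix, Matrix.mulVecLin_mul, ← ExteriorAlgebra.map_comp_map]; rfl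

theorem mapMatrix_ι_mul {n : ℕ} (A : Matrix (Fin n) (Fin n) ℂ) (v : Fin n → ℂ) (x : Fock n) :
    mapMatrix A (ExteriorAlgebra.ι ℂ v * x)
      = ExteriorAlgebra.ι ℂ (A.mulVec v) * mapMatrix A x := by
  simp [mapMatrix]

theorem ι_eq_sum {n : ℕ} (v : Fin n → ℂ) : ExteriorAlgebra.ι ℂ v = ∑ j, v j • e j := by
  conv_lhs => rw [← (Pi.basisFun ℂ (Fin n)).sum_repr v]
  simp [e]

theorem induction_e {n : ℕ} {P : Fock n → Prop} (h1 : P 1)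
    (hadd : ∀ x y, P x → P y → P (x + y)) (hsmul : ∀ (c : ℂ) x, P x → P (c • x))
    (he : ∀ j x, P x → P (e j * x)) (x : Fock n) : P x := by
  have hb : ∀ S, P (basis n S) := by
    intro S
    induction S using Finset.induction_on_min with
    | empty => rw [basis_empty]; exact h1
    | insert a S ha ih => rw [basis_insert _ _ ha]; exact he _ _ ih
  have h0 : P 0 := by simpa using hsmul 0 1 h1
  rw [← (basis n).sum_repr x]
  exact Finset.sum_induction _ P hadd h0 fun S _ => hsmul _ _ (hb S)

theorem annihilation_mapMatrix {n : ℕ} (A : Matrix (Fin n) (Fin n) ℂ) (j : Fin n) (x : Fock n) :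
    annihilation j (mapMatrix A x) = ∑ k, A j k • mapMatrix A (annihilation k x) := by
  induction x using induction_e with
  | h1 =>
    have : mapMatrix A (1 : Fock n) = 1 := by simp [mapMatrix]
    simp [this, annihilation_one]
  | hadd x y hx hy => simp [hx, hy, Finset.sum_add_distrib]
  | hsmul c x hx => simp [hx, Finset.smul_sum, smul_comm c]
  | he k x hx =>
    rw [e, mapMatrix_ι_mul, annihilation_ι_mul, hx]
    simp only [annihilation_ι_mul, map_sub, map_smul, mapMatrix_ι_mul, smul_sub,
      Finset.sum_sub_distrib, Finset.mul_sum, mul_smul_comm]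
    congr 1
    simp [Pi.single_apply]

theorem inner_mapMatrix {n : ℕ} (A : Matrix (Fin n) (Fin n) ℂ) (hA : A.conjTranspose * A = 1)
    (x y : Fock n) : inner ℂ (mapMatrix A x) (mapMatrix A y) = inner ℂ x y := by
  induction x using induction_e generalizing y with
  | h1 =>
    have h : mapMatrix A (1 : Fock n) = 1 := by simp [mapMatrix]
    rw [h]
    induction y using induction_e with
    | h1 => rw [h]
    | hadd x y hx hy => simp [inner_add_right, hx, hy]
    | hsmul c x hx => simp [inner_smul_right, hx]
    | he k y hy =>
      have h0 : ∀ (v : Fin n → ℂ) (z : Fock n),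
          inner ℂ (1 : Fock n) (ExteriorAlgebra.ι ℂ v * z) = 0 := by
        intro v z
        rw [← inner_conj_symm, ι_eq_sum, Finset.sum_mul, sum_inner]
        simp only [smul_mul_assoc, inner_smul_left, ← creation_apply, inner_creation,
          annihilation_one, inner_zero_right]
        simp
      rw [e, mapMatrix_ι_mul, h0, h0]
  | hadd x y hx hy => simp [inner_add_left, hx, hy]
  | hsmul c x hx => simp [inner_smul_left, hx]
  | he k x hx =>
    rw [e, mapMatrix_ι_mul, ← e, ι_eq_sum, Finset.sum_mul, sum_inner]
    simp only [smul_mul_assoc, inner_smul_left, ← creation_apply, inner_creation,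
      annihilation_mapMatrix, inner_sum, inner_smul_right, hx]
    simp only [Finset.mul_sum]
    rw [Finset.sum_comm]
    have hk : ∀ l, ∑ j, conj (A j k) * A j l = if k = l then 1 else 0 := by
      intro l
      have := congrFun (congrFun hA k) l
      simpa [Matrix.mul_apply, Matrix.one_apply] using this
    simp [← mul_assoc, ← Finset.sum_mul, hk]

end Fock

/-! ## Clifford algebras, spin groups and Dirac spinors -/

/-- Minus the squared Euclidean norm on `ℂⁿ`, viewed as the Euclidean space `ℝ²ⁿ`. -/
def negNormSq (n : ℕ) : QuadraticForm ℝ (Fin n → ℂ) :=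
  - ∑ j, (QuadraticMap.sq (R := ℝ)).comp (Complex.reLm ∘ₗ LinearMap.proj j)
    - ∑ j, (QuadraticMap.sq (R := ℝ)).comp (Complex.imLm ∘ₗ LinearMap.proj j)

theorem negNormSq_apply {n : ℕ} (v : Fin n → ℂ) :
    negNormSq n v = - ∑ j, Complex.normSq (v j) := by
  simp [negNormSq, Complex.normSq_apply, Finset.sum_add_distrib]
  ring

/-- The Clifford algebra `Cliff₂ₙ` of the Euclidean space `ℂⁿ = ℝ²ⁿ`, generated by `ℝ²ⁿ` with the
relations `v w + w v = -2 ⟨v, w⟩`, where `⟨v, w⟩` is the real part of the Hermitian inner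
product. -/
abbrev Cliff (n : ℕ) : Type := CliffordAlgebra (negNormSq n)

/-- The group `Spin(2n)`, consisting of the products of an even number of unit vectors of
`ℂⁿ = ℝ²ⁿ` in the Clifford algebra. -/
abbrev Spin (n : ℕ) : Type := spinGroup (negNormSq n)

/-- The topology of `Spin(2n)` as a subset of the finite-dimensional real vector space
`Cliff₂ₙ`. -/
instance (n : ℕ) : TopologicalSpace (Spin n) :=
  (moduleTopology ℝ (Cliff n)).induced Subtype.val

theorem exists_spinCover {n : ℕ} (x : Spin n) (v : Fin n → ℂ) :
    ∃ w, CliffordAlgebra.ι (negNormSq n) w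
      = (x : Cliff n) * CliffordAlgebra.ι (negNormSq n) v * ((x⁻¹ : Spin n) : Cliff n) :=
  spinGroup.conjAct_smul_ι_mem_range_ι (x := spinGroup.toUnits x) x.2 v

/-- The covering map `Spin(2n) → SO(2n)`: the rotation `v ↦ x v x⁻¹` of `ℂⁿ = ℝ²ⁿ`. -/
def spinCover {n : ℕ} (x : Spin n) (v : Fin n → ℂ) : Fin n → ℂ :=
  (exists_spinCover x v).choose

theorem ι_spinCover {n : ℕ} (x : Spin n) (v : Fin n → ℂ) :
    CliffordAlgebra.ι (negNormSq n) (spinCover x v)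
      = (x : Cliff n) * CliffordAlgebra.ι (negNormSq n) v * ((x⁻¹ : Spin n) : Cliff n) :=
  (exists_spinCover x v).choose_spec

namespace Fock

/-- The operator `φⱼ = i (aⱼ + aⱼ*)`. -/
def phi {n : ℕ} (j : Fin n) : Module.End ℂ (Fock n) := Complex.I • (annihilation j + creation j)

/-- The operator `πⱼ = aⱼ - aⱼ*`. -/
def pi {n : ℕ} (j : Fin n) : Module.End ℂ (Fock n) := annihilation j - creation j

/-- Clifford multiplication by `v = ∑ⱼ (xⱼ + i yⱼ) eⱼ`, which is `∑ⱼ (xⱼ φⱼ + yⱼ πⱼ)`. -/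
def gamma (n : ℕ) : (Fin n → ℂ) →ₗ[ℝ] Module.End ℂ (Fock n) where
  toFun v := ∑ j, (((v j).re : ℂ) • phi j + ((v j).im : ℂ) • pi j)
  map_add' v w := by
    rw [← Finset.sum_add_distrib]
    refine Finset.sum_congr rfl fun j _ => ?_
    simp only [Pi.add_apply, Complex.add_re, Complex.add_im, Complex.ofReal_add, add_smul]
    abel
  map_smul' r v := by
    rw [RingHom.id_apply, ← Complex.coe_smul r, Finset.smul_sum]
    refine Finset.sum_congr rfl fun j _ => ?_
    simp [mul_smul]

theorem gamma_apply {n : ℕ} (v : Fin n → ℂ) (x : Fock n) :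
    gamma n v x = Complex.I • (∑ j, conj (v j) • annihilation j x + ExteriorAlgebra.ι ℂ v * x) := by
  rw [ι_eq_sum, Finset.sum_mul, ← Finset.sum_add_distrib, Finset.smul_sum]
  simp only [gamma, LinearMap.coe_mk, AddHom.coe_mk, LinearMap.sum_apply]
  refine Finset.sum_congr rfl fun j _ => ?_
  have h1 : conj (v j) = (v j).re - (v j).im * Complex.I := by
    apply Complex.ext <;> simp
  have h2 : v j = (v j).re + (v j).im * Complex.I := (Complex.re_add_im _).symm
  have hI : Complex.I * Complex.I = -1 := Complex.I_mul_I
  rw [h1, smul_mul_assoc, ← creation_apply]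
  generalize (v j).re = a at *
  generalize (v j).im = b at *
  rw [h2]
  simp only [phi, pi, LinearMap.add_apply, LinearMap.smul_apply, LinearMap.sub_apply]
  match_scalars
  · linear_combination (b : ℂ) * hI
  · linear_combination - (b : ℂ) * hI

theorem annihilation_comm {n : ℕ} (j k : Fin n) (x : Fock n) :
    annihilation j (annihilation k x) = - annihilation k (annihilation j x) :=
  CliffordAlgebra.contractLeft_comm (Q := 0) _ _ x

theorem gamma_mul_gamma {n : ℕ} (v : Fin n → ℂ) :
    gamma n v * gamma n v = algebraMap ℝ _ (negNormSq n v) := by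
  refine LinearMap.ext fun x => ?_
  have hA : ∀ x : Fock n, (∑ j, conj (v j) • annihilation j (∑ k, conj (v k) • annihilation k x))
      = 0 := by
    intro x
    simp only [map_sum, map_smul, Finset.smul_sum, smul_smul]
    have h : ∀ f : Fin n → Fin n → Fock n, (∀ j k, f j k = - f k j) → ∑ j, ∑ k, f j k = 0 := by
      intro f hf
      have : ∑ j, ∑ k, f j k = - ∑ j, ∑ k, f j k := by
        conv_rhs => rw [Finset.sum_comm]
        simp only [← Finset.sum_neg_distrib]
        exact Finset.sum_congr rfl fun j _ => Finset.sum_congr rfl fun k _ => hf j k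
      have h2 : (2 : ℂ) • ∑ j, ∑ k, f j k = 0 := by
        rw [two_smul]
        nth_rewrite 1 [this]
        exact neg_add_cancel _
      exact (smul_eq_zero.1 h2).resolve_left two_ne_zero
    apply h
    intro j k
    rw [annihilation_comm, smul_neg, mul_comm]
  have hc : ∀ x : Fock n, ExteriorAlgebra.ι ℂ v * (ExteriorAlgebra.ι ℂ v * x) = 0 := by
    intro x
    rw [← mul_assoc, ExteriorAlgebra.ι_sq_zero, zero_mul]
  have hQ : (algebraMap ℝ (Module.End ℂ (Fock n)) (negNormSq n v)) x
      = - ∑ j, (conj (v j) * v j) • x := by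
    rw [Module.algebraMap_end_apply, ← Complex.coe_smul, negNormSq_apply, ← Finset.sum_smul]
    simp [← Complex.normSq_eq_conj_mul_self]
  rw [hQ, Module.End.mul_apply, gamma_apply, gamma_apply]
  have hG : ∀ z : Fock n, ∑ j, conj (v j) • annihilation j (Complex.I • z)
      + ExteriorAlgebra.ι ℂ v * (Complex.I • z)
      = Complex.I • (∑ j, conj (v j) • annihilation j z + ExteriorAlgebra.ι ℂ v * z) := by
    intro z
    rw [smul_add, Finset.smul_sum, mul_smul_comm]
    congr 1
    refine Finset.sum_congr rfl fun j _ => ?_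
    rw [map_smul, smul_comm]
  rw [hG, smul_smul, Complex.I_mul_I, neg_one_smul]
  simp only [map_add, smul_add, Finset.sum_add_distrib, mul_add, hA, hc, annihilation_ι_mul,
    smul_sub, Finset.sum_sub_distrib, Finset.mul_sum, mul_smul_comm, mul_smul]
  abel

/-- The action of the Clifford algebra on `Λ ℂⁿ`. -/
def cliffordAction (n : ℕ) : Cliff n →ₐ[ℝ] Module.End ℂ (Fock n) :=
  CliffordAlgebra.lift (negNormSq n) ⟨gamma n, gamma_mul_gamma⟩

theorem inner_gamma {n : ℕ} (v : Fin n → ℂ) (x y : Fock n) :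
    inner ℂ (gamma n v x) y = - inner ℂ x (gamma n v y) := by
  have h : ∀ x y : Fock n, inner ℂ (ExteriorAlgebra.ι ℂ v * x) y
      = inner ℂ x (∑ j, conj (v j) • annihilation j y) := by
    intro x y
    rw [ι_eq_sum, Finset.sum_mul, sum_inner, inner_sum]
    refine Finset.sum_congr rfl fun j _ => ?_
    rw [smul_mul_assoc, inner_smul_left, inner_smul_right, ← creation_apply, inner_creation]
  have h' : inner ℂ (∑ j, conj (v j) • annihilation j x) y
      = inner ℂ x (ExteriorAlgebra.ι ℂ v * y) := by
    rw [← inner_conj_symm, ← h, inner_conj_symm]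
  rw [gamma_apply, gamma_apply, inner_smul_left, inner_smul_right, inner_add_left,
    inner_add_right, h, h', Complex.conj_I]
  ring

theorem inner_cliffordAction {n : ℕ} (a : Cliff n) (x y : Fock n) :
    inner ℂ (cliffordAction n a x) y = inner ℂ x (cliffordAction n (star a) y) := by
  induction a using CliffordAlgebra.induction generalizing x y with
  | algebraMap r =>
    rw [CliffordAlgebra.star_algebraMap, AlgHom.commutes, Module.algebraMap_end_apply,
      Module.algebraMap_end_apply, ← Complex.coe_smul, ← Complex.coe_smul, inner_smul_left,
      inner_smul_right, Complex.conj_ofReal]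
  | ι v =>
    rw [CliffordAlgebra.star_ι, map_neg, cliffordAction, CliffordAlgebra.lift_ι_apply,
      LinearMap.neg_apply, inner_neg_right]
    exact inner_gamma v x y
  | mul a b ha hb =>
    rw [star_mul, map_mul, map_mul, Module.End.mul_apply, Module.End.mul_apply, ha, hb]
  | add a b ha hb =>
    rw [star_add, map_add, map_add, LinearMap.add_apply, LinearMap.add_apply, inner_add_left,
      inner_add_right, ha, hb]

end Fock

/-- The unitary group `U(V)` of a Hilbert space. -/
abbrev U (V : Type) [NormedAddCommGroup V] [InnerProductSpace ℂ V] : Type := V ≃ₗᵢ[ℂ] V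

/-- The isomorphism `U(f) : U(V) → U(W)`, `T ↦ f T f⁻¹`, induced by a unitary operator `f`. -/
def U.map {V W : Type} [NormedAddCommGroup V] [InnerProductSpace ℂ V]
    [NormedAddCommGroup W] [InnerProductSpace ℂ W] (f : V ≃ₗᵢ[ℂ] W) : U V →* U W where
  toFun T := (f.symm.trans T).trans f
  map_one' := by ext x; simp
  map_mul' S T := by ext x; simp

/-- The Dirac spinor representation of `Spin(2n)` on `Λ ℂⁿ`. -/
def diracRep (n : ℕ) : Spin n →* U (Fock n) where
  toFun s := LinearEquiv.isometryOfInner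
    (LinearEquiv.ofLinearMap (Fock.cliffordAction n s) (Fock.cliffordAction n (star (s : Cliff n)))
      (by rw [← Module.End.mul_eq_comp, ← map_mul, spinGroup.mul_star_self_of_mem s.2, map_one]; rfl)
      (by rw [← Module.End.mul_eq_comp, ← map_mul, spinGroup.star_mul_self_of_mem s.2, map_one]; rfl))
    (fun x y => by
      have h : Fock.cliffordAction n (star (s : Cliff n)) (Fock.cliffordAction n s y) = y := by
        rw [← Module.End.mul_apply, ← map_mul, spinGroup.star_mul_self_of_mem s.2, map_one]; rfl
      simp [Fock.inner_cliffordAction, h])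
  map_one' := by ext x; simp
  map_mul' s t := by ext x; simp

theorem diracRep_apply {n : ℕ} (s : Spin n) (x : Fock n) :
    diracRep n s x = Fock.cliffordAction n s x := rfl

/-- The group `SU(n)`. -/
abbrev SU (n : ℕ) : Type := Matrix.specialUnitaryGroup (Fin n) ℂ

/-- The natural representation of `SU(n)` on `Λ ℂⁿ`, which extends the fundamental representation
on `Λ¹ ℂⁿ = ℂⁿ` and respects wedge products. -/
def extRep (n : ℕ) : SU n →* U (Fock n) where
  toFun A := LinearEquiv.isometryOfInner
    (LinearEquiv.ofLinearMap (Fock.mapMatrix (A : Matrix (Fin n) (Fin n) ℂ))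
      (Fock.mapMatrix ((A⁻¹ : SU n) : Matrix (Fin n) (Fin n) ℂ))
      (by rw [← Fock.mapMatrix_mul, ← Submonoid.coe_mul, mul_inv_cancel, Submonoid.coe_one,
        Fock.mapMatrix_one])
      (by rw [← Fock.mapMatrix_mul, ← Submonoid.coe_mul, inv_mul_cancel, Submonoid.coe_one,
        Fock.mapMatrix_one]))
    (fun x y => Fock.inner_mapMatrix _
      (Matrix.mem_unitaryGroup_iff'.1 (Matrix.mem_specialUnitaryGroup_iff.1 A.2).1) x y)
  map_one' := by ext x; simp [Fock.mapMatrix_one]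
  map_mul' A B := by
    ext x
    exact LinearMap.congr_fun (Fock.mapMatrix_mul _ _) x

theorem extRep_apply {n : ℕ} (A : SU n) (x : Fock n) :
    extRep n A x = ExteriorAlgebra.map (A : Matrix (Fin n) (Fin n) ℂ).mulVecLin x := rfl

/-! ## The Standard Model, `SU(5)` and Pati–Salam data -/

/-- The gauge group `U(1) × SU(2) × SU(3)` of the Standard Model. -/
abbrev GSM : Type := Circle × SU 2 × SU 3

/-- The orthonormal basis of the fermion representation `F` given by the first-generation
fermions: `lepL 0 = ν_L`, `lepL 1 = e⁻_L`, `quarkL 0 c = u_L^c`, `quarkL 1 c = d_L^c`,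
`nuR = ν_R`, `eR = e⁻_R`, `uR c = u_R^c`, `dR c = d_R^c`, where `c = 0, 1, 2` are the colors
red, green and blue. -/
inductive Fermion : Type
  | lepL (i : Fin 2)
  | quarkL (i : Fin 2) (c : Fin 3)
  | nuR
  | eR
  | uR (c : Fin 3)
  | dR (c : Fin 3)
  deriving DecidableEq, Fintype

open Fermion

/-- The matrix of `(α, g, h)` acting on the fermion representation
`F = ℂ₋₁ ⊗ ℂ² ⊗ ℂ ⊕ ℂ_{1/3} ⊗ ℂ² ⊗ ℂ³ ⊕ ℂ₀ ⊗ ℂ ⊗ ℂ ⊕ ℂ₋₂ ⊗ ℂ ⊗ ℂ ⊕ ℂ_{4/3} ⊗ ℂ ⊗ ℂ³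
  ⊕ ℂ_{-2/3} ⊗ ℂ ⊗ ℂ³`,
where `α ∈ U(1)` acts on `ℂ_Y` as multiplication by `α ^ (3 Y)`. -/
def fermionMatrix (x : GSM) : Matrix Fermion Fermion ℂ :=
  Matrix.of fun p q => match p, q with
    | lepL i, lepL j => (x.1 : ℂ) ^ (-3 : ℤ) * x.2.1.1 i j
    | quarkL i c, quarkL j d => (x.1 : ℂ) * (x.2.1.1 i j * x.2.2.1 c d)
    | nuR, nuR => 1
    | eR, eR => (x.1 : ℂ) ^ (-6 : ℤ)
    | uR c, uR d => (x.1 : ℂ) ^ 4 * x.2.2.1 c d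
    | dR c, dR d => (x.1 : ℂ) ^ (-2 : ℤ) * x.2.2.1 c d
    | _, _ => 0

theorem sum_fermion {M : Type} [AddCommMonoid M] (f : Fermion → M) :
    ∑ p, f p = ∑ i, f (lepL i) + ∑ i, ∑ c, f (quarkL i c) + f nuR + f eR
      + ∑ c, f (uR c) + ∑ c, f (dR c) := by
  have h : (Finset.univ : Finset Fermion) =
      {lepL 0, lepL 1, quarkL 0 0, quarkL 0 1, quarkL 0 2, quarkL 1 0, quarkL 1 1, quarkL 1 2,
        nuR, eR, uR 0, uR 1, uR 2, dR 0, dR 1, dR 2} := by decide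
  rw [h]
  simp [Fin.sum_univ_succ]
  simp only [add_assoc]

theorem fermionMatrix_one : fermionMatrix 1 = 1 := by
  ext p q
  cases p <;> cases q <;> simp [fermionMatrix, Matrix.one_apply, ← ite_and]
  exact if_congr and_comm rfl rfl

theorem fermionMatrix_mul (x y : GSM) :
    fermionMatrix (x * y) = fermionMatrix x * fermionMatrix y := by
  have h1 : (((x * y).1 : Circle) : ℂ) = x.1 * y.1 := rfl
  have h2 : (x * y).2.1.1 = x.2.1.1 * y.2.1.1 := rfl
  have h3 : (x * y).2.2.1 = x.2.2.1 * y.2.2.1 := rfl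
  ext p q
  rw [Matrix.mul_apply, sum_fermion]
  cases p <;> cases q <;>
    simp only [fermionMatrix, Matrix.of_apply, zero_mul, mul_zero, Finset.sum_const_zero,
      add_zero, zero_add, h1, h2, h3, Matrix.mul_apply, mul_zpow, mul_pow, mul_one]
  · rw [Finset.mul_sum]
    exact Finset.sum_congr rfl fun j _ => by ring
  · rw [Finset.sum_mul_sum, Finset.mul_sum]
    refine Finset.sum_congr rfl fun j _ => ?_
    rw [Finset.mul_sum]
    exact Finset.sum_congr rfl fun k _ => by ring
  · rw [Finset.mul_sum]
    exact Finset.sum_congr rfl fun j _ => by ring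
  · rw [Finset.mul_sum]
    exact Finset.sum_congr rfl fun j _ => by ring

theorem fermionMatrix_inv (x : GSM) :
    fermionMatrix x⁻¹ = (fermionMatrix x).conjTranspose := by
  have h1 : (((x⁻¹).1 : Circle) : ℂ) = conj (x.1 : ℂ) := Circle.coe_inv_eq_conj x.1
  have h2 : (x⁻¹).2.1.1 = x.2.1.1.conjTranspose := rfl
  have h3 : (x⁻¹).2.2.1 = x.2.2.1.conjTranspose := rfl
  ext p q
  rw [Matrix.conjTranspose_apply]
  cases p <;> cases q <;>
    simp only [fermionMatrix, Matrix.of_apply, h1, h2, h3, Matrix.conjTranspose_apply, star_zero,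
      star_one, star_mul', map_zpow₀, map_pow, RCLike.star_def]

/-- The Hilbert space `F ⊕ F*` of the Standard Model representation. Its orthonormal basis
consists of the fermions `Sum.inl p` and of the dual basis vectors `Sum.inr p` of `F*`. -/
abbrev SMSpace : Type := EuclideanSpace ℂ (Fermion ⊕ Fermion)

/-- The matrix of `x` acting on `F ⊕ F*`; on `F*` this is the dual (contragredient)
representation `(x · ξ)(v) = ξ (x⁻¹ v)`, written in the dual basis. -/
def smMatrix (x : GSM) : Matrix (Fermion ⊕ Fermion) (Fermion ⊕ Fermion) ℂ :=
  Matrix.fromBlocks (fermionMatrix x) 0 0 (fermionMatrix x⁻¹).transpose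

theorem smMatrix_one : smMatrix 1 = 1 := by
  simp [smMatrix, fermionMatrix_one]

theorem smMatrix_mul (x y : GSM) : smMatrix (x * y) = smMatrix x * smMatrix y := by
  simp [smMatrix, fermionMatrix_mul, Matrix.fromBlocks_multiply]

theorem smMatrix_inv (x : GSM) : smMatrix x⁻¹ = (smMatrix x).conjTranspose := by
  rw [smMatrix, smMatrix, Matrix.fromBlocks_conjTranspose, fermionMatrix_inv x,
    fermionMatrix_inv x⁻¹, fermionMatrix_inv x, Matrix.conjTranspose_zero]
  congr 1

/-- The Standard Model representation of `G_SM` on `F ⊕ F*`. -/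
def smRep : GSM →* U SMSpace where
  toFun x := LinearEquiv.isometryOfInner
    (LinearEquiv.ofLinearMap (Matrix.toEuclideanLin (smMatrix x))
      (Matrix.toEuclideanLin (smMatrix x⁻¹))
      (by rw [← Matrix.toLpLin_mul_same, ← smMatrix_mul, mul_inv_cancel, smMatrix_one, Matrix.toLpLin_one])
      (by rw [← Matrix.toLpLin_mul_same, ← smMatrix_mul, inv_mul_cancel, smMatrix_one, Matrix.toLpLin_one]))
    (fun v w => by
      have h : Matrix.toEuclideanLin (smMatrix x⁻¹) (Matrix.toEuclideanLin (smMatrix x) v) = v := by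
        rw [← LinearMap.comp_apply, ← Matrix.toLpLin_mul_same, ← smMatrix_mul, inv_mul_cancel,
          smMatrix_one, Matrix.toLpLin_one, LinearMap.id_apply]
      rw [smMatrix_inv, Matrix.toEuclideanLin_conjTranspose_eq_adjoint] at h
      change inner ℂ (Matrix.toEuclideanLin (smMatrix x) v) (Matrix.toEuclideanLin (smMatrix x) w)
        = inner ℂ v w
      rw [← LinearMap.adjoint_inner_left, h])
  map_one' := by ext x; simp [smMatrix_one]
  map_mul' x y := by
    ext v
    simp [smMatrix_mul]

theorem smRep_apply (x : GSM) (v : SMSpace) :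
    smRep x v = Matrix.toEuclideanLin (smMatrix x) v := rfl

/-- The block diagonal matrix with blocks `A` and `B`. -/
def blockDiag {m n : ℕ} (A : Matrix (Fin m) (Fin m) ℂ) (B : Matrix (Fin n) (Fin n) ℂ) :
    Matrix (Fin (m + n)) (Fin (m + n)) ℂ :=
  Matrix.reindex finSumFinEquiv finSumFinEquiv (Matrix.fromBlocks A 0 0 B)

theorem blockDiag_one {m n : ℕ} :
    blockDiag (1 : Matrix (Fin m) (Fin m) ℂ) (1 : Matrix (Fin n) (Fin n) ℂ) = 1 := by
  simp [blockDiag]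

theorem blockDiag_mul {m n : ℕ} (A A' : Matrix (Fin m) (Fin m) ℂ)
    (B B' : Matrix (Fin n) (Fin n) ℂ) :
    blockDiag (A * A') (B * B') = blockDiag A B * blockDiag A' B' := by
  simp [blockDiag, Matrix.fromBlocks_multiply, Matrix.submatrix_mul_equiv]

theorem blockDiag_mem {m n : ℕ} {A : Matrix (Fin m) (Fin m) ℂ} {B : Matrix (Fin n) (Fin n) ℂ}
    (hA : A * A.conjTranspose = 1) (hB : B * B.conjTranspose = 1) (h : A.det * B.det = 1) :
    blockDiag A B ∈ Matrix.specialUnitaryGroup (Fin (m + n)) ℂ := by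
  rw [Matrix.mem_specialUnitaryGroup_iff, Matrix.mem_unitaryGroup_iff]
  constructor
  · have h' : star (blockDiag A B) = blockDiag A.conjTranspose B.conjTranspose := by
      simp [blockDiag, Matrix.star_eq_conjTranspose, Matrix.conjTranspose_submatrix,
        Matrix.fromBlocks_conjTranspose]
    rw [h', ← blockDiag_mul, hA, hB, blockDiag_one]
  · simpa [blockDiag] using h

theorem smul_unitary {n : ℕ} (α : Circle) (k : ℤ) (A : SU n) :
    ((α : ℂ) ^ k • A.1) * ((α : ℂ) ^ k • A.1).conjTranspose = 1 := by
  have h := Matrix.mem_unitaryGroup_iff.1 (Matrix.mem_specialUnitaryGroup_iff.1 A.2).1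
  rw [Matrix.star_eq_conjTranspose] at h
  have h2 : (α : ℂ) ^ k * star ((α : ℂ) ^ k) = 1 := by
    rw [← Circle.coe_zpow]
    rw [RCLike.star_def, ← Circle.coe_inv_eq_conj, ← Circle.coe_mul, mul_inv_cancel, Circle.coe_one]
  rw [Matrix.conjTranspose_smul, Matrix.smul_mul, Matrix.mul_smul, smul_smul, h, h2, one_smul]

theorem smul_det {n : ℕ} (a : ℂ) (A : SU n) : (a • A.1).det = a ^ n := by
  rw [Matrix.det_smul, (Matrix.mem_specialUnitaryGroup_iff.1 A.2).2]
  simp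

/-- The homomorphism `φ : G_SM → SU(5)`, `(α, g, h) ↦ diag(α³ g, α⁻² h)`. -/
def toSU5 : GSM →* SU 5 where
  toFun x := ⟨blockDiag ((x.1 : ℂ) ^ (3 : ℤ) • x.2.1.1) ((x.1 : ℂ) ^ (-2 : ℤ) • x.2.2.1), by
    refine blockDiag_mem (smul_unitary _ _ _) (smul_unitary _ _ _) ?_
    rw [smul_det, smul_det, ← zpow_natCast, ← zpow_natCast, ← zpow_mul, ← zpow_mul,
      ← zpow_add₀ (Circle.coe_ne_zero _)]
    simp⟩
  map_one' := by
    apply Subtype.ext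
    simp [blockDiag_one]
  map_mul' x y := by
    apply Subtype.ext
    simp only [Prod.fst_mul, Prod.snd_mul, Submonoid.coe_mul, Circle.coe_mul, mul_zpow]
    rw [← blockDiag_mul]
    simp only [Matrix.smul_mul, Matrix.mul_smul, smul_smul, mul_comm]

/-- The homomorphism `β : G_SM → SU(2) × SU(2) × SU(4)`,
`(α, g, h) ↦ (g, diag(α³, α⁻³), diag(α h, α⁻³))`. -/
def toPatiSalam : GSM →* SU 2 × SU 2 × SU 4 where
  toFun x :=
    (x.2.1,
      ⟨blockDiag ((x.1 : ℂ) ^ (3 : ℤ) • (1 : SU 1).1) ((x.1 : ℂ) ^ (-3 : ℤ) • (1 : SU 1).1), by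
        refine blockDiag_mem (smul_unitary _ _ _) (smul_unitary _ _ _) ?_
        rw [smul_det, smul_det, ← zpow_natCast, ← zpow_natCast, ← zpow_mul, ← zpow_mul,
          ← zpow_add₀ (Circle.coe_ne_zero _)]
        simp⟩,
      ⟨blockDiag ((x.1 : ℂ) ^ (1 : ℤ) • x.2.2.1) ((x.1 : ℂ) ^ (-3 : ℤ) • (1 : SU 1).1), by
        refine blockDiag_mem (smul_unitary _ _ _) (smul_unitary _ _ _) ?_
        rw [smul_det, smul_det, ← zpow_natCast, ← zpow_natCast, ← zpow_mul, ← zpow_mul,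
          ← zpow_add₀ (Circle.coe_ne_zero _)]
        simp⟩)
  map_one' := by
    ext : 1
    · rfl
    · ext : 1 <;> apply Subtype.ext <;> simp [blockDiag_one]
  map_mul' x y := by
    ext : 1
    · rfl
    · ext : 1 <;> apply Subtype.ext <;>
      · simp only [Prod.fst_mul, Prod.snd_mul, Submonoid.coe_mul, Circle.coe_mul, mul_zpow]
        rw [← blockDiag_mul]
        simp only [Matrix.smul_mul, Matrix.mul_smul, smul_smul, Submonoid.coe_one, mul_one, mul_comm]

/-! ### The unitary operators `f`, `g` and `h` -/

namespace Fock

theorem finrank (n : ℕ) : Module.finrank ℂ (Fock n) = 2 ^ n := by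
  rw [Module.finrank_eq_card_basis (basis n), Fintype.card_finset, Fintype.card_fin]

theorem basis_toFinset {n : ℕ} (l : List (Fin n)) (h : l.Pairwise (· < ·)) :
    basis n l.toFinset = (l.map e).prod := by
  rw [basis_eq_prod, (List.toFinset_sort (r := (· ≤ ·)) (h.imp ne_of_lt)).2 (h.imp le_of_lt)]

/-- The inclusion of `ℂᵐ` as the first summand of `ℂᵐ⁺ⁿ = ℂᵐ ⊕ ℂⁿ`. -/
def inclLeft (m n : ℕ) : (Fin m → ℂ) →ₗ[ℂ] (Fin (m + n) → ℂ) where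
  toFun v := Fin.append v 0
  map_add' v w := by ext i; refine Fin.addCases ?_ ?_ i <;> simp
  map_smul' c v := by ext i; refine Fin.addCases ?_ ?_ i <;> simp

/-- The inclusion of `ℂⁿ` as the second summand of `ℂᵐ⁺ⁿ = ℂᵐ ⊕ ℂⁿ`. -/
def inclRight (m n : ℕ) : (Fin n → ℂ) →ₗ[ℂ] (Fin (m + n) → ℂ) where
  toFun w := Fin.append 0 w
  map_add' v w := by ext i; refine Fin.addCases ?_ ?_ i <;> simp
  map_smul' c v := by ext i; refine Fin.addCases ?_ ?_ i <;> simp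

/-- The linear map `v ⊗ w ↦ v ∧ w` from `Λ ℂᵐ ⊗ Λ ℂⁿ` to `Λ ℂᵐ⁺ⁿ`. -/
def wedgeLin (m n : ℕ) : Fock m ⊗[ℂ] Fock n →ₗ[ℂ] Fock (m + n) :=
  TensorProduct.lift ((LinearMap.mul ℂ (Fock (m + n))).compl₁₂
    (ExteriorAlgebra.map (inclLeft m n)).toLinearMap
    (ExteriorAlgebra.map (inclRight m n)).toLinearMap)

theorem map_inclLeft_e {m : ℕ} (n : ℕ) (j : Fin m) :
    ExteriorAlgebra.map (inclLeft m n) (e j) = e (Fin.castAdd n j) := by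
  rw [e, ExteriorAlgebra.map_apply_ι, e]
  congr 1
  ext i
  refine Fin.addCases (fun i => ?_) (fun i => ?_) i
  · simp [inclLeft, Pi.single_apply]
  · simp [inclLeft, Pi.single_apply, Fin.ext_iff]
    omega

theorem map_inclRight_e (m : ℕ) {n : ℕ} (j : Fin n) :
    ExteriorAlgebra.map (inclRight m n) (e j) = e (Fin.natAdd m j) := by
  rw [e, ExteriorAlgebra.map_apply_ι, e]
  congr 1
  ext i
  refine Fin.addCases (fun i => ?_) (fun i => ?_) i
  · simp [inclRight, Pi.single_apply, Fin.ext_iff]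
    omega
  · simp [inclRight, Pi.single_apply]

theorem wedgeLin_basis {m n : ℕ} (S : Finset (Fin m)) (T : Finset (Fin n)) :
    wedgeLin m n (basis m S ⊗ₜ basis n T)
      = basis (m + n) ((S.sort (· ≤ ·)).map (Fin.castAdd n)
          ++ (T.sort (· ≤ ·)).map (Fin.natAdd m)).toFinset := by
  rw [basis_toFinset]
  · rw [basis_eq_prod, basis_eq_prod]
    simp [wedgeLin, map_list_prod, Function.comp_def, map_inclLeft_e, map_inclRight_e]
  · rw [List.pairwise_append]
    refine ⟨?_, ?_, ?_⟩
    · rw [List.pairwise_map]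
      exact (Finset.sortedLT_sort S).pairwise.imp fun h => h
    · rw [List.pairwise_map]
      exact (Finset.sortedLT_sort T).pairwise.imp fun h => by
        rw [Fin.lt_def, Fin.val_natAdd, Fin.val_natAdd]
        exact Nat.add_lt_add_left h m
    · intro a ha b hb
      simp only [List.mem_map] at ha hb
      obtain ⟨a, -, rfl⟩ := ha
      obtain ⟨b, -, rfl⟩ := hb
      rw [Fin.lt_def, Fin.val_natAdd, Fin.val_castAdd]
      omega

theorem orthonormal_wedgeLin (m n : ℕ) :
    Orthonormal ℂ (wedgeLin m n ∘ ((basis m).tensorProduct (basis n))) := by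
  have h : wedgeLin m n ∘ ((basis m).tensorProduct (basis n))
      = basis (m + n) ∘ fun p : Finset (Fin m) × Finset (Fin n) =>
          ((p.1.sort (· ≤ ·)).map (Fin.castAdd n)
          ++ (p.2.sort (· ≤ ·)).map (Fin.natAdd m)).toFinset := by
    funext ⟨S, T⟩
    rw [Function.comp_apply, Module.Basis.tensorProduct_apply, wedgeLin_basis]
    rfl
  rw [h]
  refine (orthonormal_basis (m + n)).comp _ ?_
  rintro ⟨S, T⟩ ⟨S', T'⟩ hST
  have hl : ∀ (S : Finset (Fin m)) (T : Finset (Fin n)) (i : Fin m),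
      Fin.castAdd n i ∈ ((S.sort (· ≤ ·)).map (Fin.castAdd n)
        ++ (T.sort (· ≤ ·)).map (Fin.natAdd m)).toFinset ↔ i ∈ S := by
    intro S T i
    simp only [List.mem_toFinset, List.mem_append, List.mem_map, Finset.mem_sort]
    refine ⟨?_, fun h => Or.inl ⟨i, h, rfl⟩⟩
    rintro (⟨a, ha, h⟩ | ⟨a, ha, h⟩)
    · rw [Fin.ext_iff, Fin.val_castAdd, Fin.val_castAdd, ← Fin.ext_iff] at h
      exact h ▸ ha
    · rw [Fin.ext_iff, Fin.val_natAdd, Fin.val_castAdd] at h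
      omega
  have hr : ∀ (S : Finset (Fin m)) (T : Finset (Fin n)) (i : Fin n),
      Fin.natAdd m i ∈ ((S.sort (· ≤ ·)).map (Fin.castAdd n)
        ++ (T.sort (· ≤ ·)).map (Fin.natAdd m)).toFinset ↔ i ∈ T := by
    intro S T i
    simp only [List.mem_toFinset, List.mem_append, List.mem_map, Finset.mem_sort]
    refine ⟨?_, fun h => Or.inr ⟨i, h, rfl⟩⟩
    rintro (⟨a, ha, h⟩ | ⟨a, ha, h⟩)
    · rw [Fin.ext_iff, Fin.val_natAdd, Fin.val_castAdd] at h
      omega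
    · rw [Fin.ext_iff, Fin.val_natAdd, Fin.val_natAdd, Nat.add_left_cancel_iff,
        ← Fin.ext_iff] at h
      exact h ▸ ha
  refine Prod.ext (Finset.ext fun i => ?_) (Finset.ext fun i => ?_)
  · rw [← hl S T i, ← hl S' T' i]
    exact Finset.ext_iff.1 hST _
  · rw [← hr S T i, ← hr S' T' i]
    exact Finset.ext_iff.1 hST _

/-- The unitary operator `Λ ℂᵐ ⊗ Λ ℂⁿ → Λ ℂᵐ⁺ⁿ`, `v ⊗ w ↦ v ∧ w`. -/
def wedge (m n : ℕ) : Fock m ⊗[ℂ] Fock n ≃ₗᵢ[ℂ] Fock (m + n) :=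
  LinearIsometry.toLinearIsometryEquiv
    ((wedgeLin m n).isometryOfOrthonormal
      (Orthonormal.basisTensorProduct (orthonormal_basis m) (orthonormal_basis n))
      (orthonormal_wedgeLin m n))
    (by rw [Module.finrank_tensorProduct, finrank, finrank, finrank, pow_add])

theorem wedge_tmul {m n : ℕ} (v : Fock m) (w : Fock n) :
    wedge m n (v ⊗ₜ w) =
      ExteriorAlgebra.map (inclLeft m n) v * ExteriorAlgebra.map (inclRight m n) w := rfl

end Fock

open Fock Fermion

/-- The isomorphism `g : Λ ℂ² ⊗ Λ ℂ³ → Λ ℂ⁵`, `v ⊗ w ↦ v ∧ w`. -/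
def mapG : Fock 2 ⊗[ℂ] Fock 3 ≃ₗᵢ[ℂ] Fock 5 := wedge 2 3

/-- The binary code for `SU(5)`. Here `u, d, r, g, b` is the standard basis of `ℂ⁵` and
`gb, br, rg` are the anticolors `r̄, ḡ, b̄`. The antifermions are the following vectors of `F*`,
where `p*` is the dual basis vector of the fermion `p`: `ν̄_R = -ν_L*` and `ū_R^c̄ = -(u_L^c)*`,
and `p*` for each other fermion `p`. The two signs are those of the isomorphism
`ℂ² ≅ ℂ²*`, `u ↦ d*`, `d ↦ -u*`, of representations of `SU(2)`. -/
def su5Code : Fermion ⊕ Fermion → Fock 5 :=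
  let u := e 0; let d := e 1; let r := e 2; let g := e 3; let b := e 4
  let color := ![r, g, b]
  let anticolor := ![g * b, b * r, r * g]
  fun p => match p with
    | .inl (lepL i) => ![u, d] i * (r * g * b)
    | .inl (quarkL i c) => ![u, d] i * color c
    | .inl nuR => u * d * (r * g * b)
    | .inl eR => r * g * b
    | .inl (uR c) => u * d * color c
    | .inl (dR c) => color c
    | .inr (lepL i) => ![-d, u] i
    | .inr (quarkL i c) => ![-d, u] i * anticolor c
    | .inr nuR => 1
    | .inr eR => u * d
    | .inr (uR c) => anticolor c
    | .inr (dR c) => u * d * anticolor c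

/-- The binary code for the Pati–Salam model; the antifermions are as in `su5Code`. -/
def patiSalamCode : Fermion ⊕ Fermion → Fock 2 ⊗[ℂ] Fock 3 :=
  let u := e 0; let d := e 1
  let r := e 0; let g := e 1; let b := e 2
  let color := ![r, g, b]
  let anticolor := ![g * b, b * r, r * g]
  fun p => match p with
    | .inl (lepL i) => ![u, d] i ⊗ₜ (r * g * b)
    | .inl (quarkL i c) => ![u, d] i ⊗ₜ color c
    | .inl nuR => (u * d) ⊗ₜ (r * g * b)
    | .inl eR => 1 ⊗ₜ (r * g * b)
    | .inl (uR c) => (u * d) ⊗ₜ color c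
    | .inl (dR c) => 1 ⊗ₜ color c
    | .inr (lepL i) => ![-d, u] i ⊗ₜ 1
    | .inr (quarkL i c) => ![-d, u] i ⊗ₜ anticolor c
    | .inr nuR => 1 ⊗ₜ 1
    | .inr eR => (u * d) ⊗ₜ 1
    | .inr (uR c) => 1 ⊗ₜ anticolor c
    | .inr (dR c) => (u * d) ⊗ₜ anticolor c

theorem Fock.orthonormal_of_eq_smul {ι κ V : Type} [NormedAddCommGroup V]
    [InnerProductSpace ℂ V] {b : κ → V} (hb : Orthonormal ℂ b) {v : ι → V} {k : ι → κ}
    (hk : Function.Injective k) (h : ∀ i, v i = b (k i) ∨ v i = - b (k i)) : Orthonormal ℂ v := by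
  refine ⟨fun i => ?_, fun i j hij => ?_⟩
  · rcases h i with h | h <;> simp [h, hb.1]
  · have h0 := hb.2 (fun h => hij (hk h) : k i ≠ k j)
    rcases h i with hi | hi <;> rcases h j with hj | hj <;> simp [hi, hj, h0]

/-- The positions of the bits equal to `1` in the code of a basis vector. -/
def codeList : Fermion ⊕ Fermion → List (Fin 2) × List (Fin 3)
  | .inl (lepL i) => ([i], [0, 1, 2])
  | .inl (quarkL i c) => ([i], [c])
  | .inl nuR => ([0, 1], [0, 1, 2])
  | .inl eR => ([], [0, 1, 2])
  | .inl (uR c) => ([0, 1], [c])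
  | .inl (dR c) => ([], [c])
  | .inr (lepL i) => ([1 - i], [])
  | .inr (quarkL i c) => ([1 - i], ![[1, 2], [0, 2], [0, 1]] c)
  | .inr nuR => ([], [])
  | .inr eR => ([0, 1], [])
  | .inr (uR c) => ([], ![[1, 2], [0, 2], [0, 1]] c)
  | .inr (dR c) => ([0, 1], ![[1, 2], [0, 2], [0, 1]] c)

theorem codeList_sorted (p : Fermion ⊕ Fermion) :
    (codeList p).1.Pairwise (· < ·) ∧ (codeList p).2.Pairwise (· < ·) := by
  revert p; decide

theorem codeList_injective : Function.Injective
    fun p => ((codeList p).1.toFinset, (codeList p).2.toFinset) := by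
  decide

theorem orthonormal_patiSalamCode : Orthonormal ℂ patiSalamCode := by
  refine orthonormal_of_eq_smul
    (Orthonormal.basisTensorProduct (orthonormal_basis 2) (orthonormal_basis 3))
    codeList_injective fun p => ?_
  rw [Module.Basis.tensorProduct_apply, basis_toFinset _ (codeList_sorted p).1,
    basis_toFinset _ (codeList_sorted p).2]
  rcases p with (⟨i⟩ | ⟨i, c⟩ | _ | _ | ⟨c⟩ | ⟨c⟩) | (⟨i⟩ | ⟨i, c⟩ | _ | _ | ⟨c⟩ | ⟨c⟩) <;>
    (try fin_cases i) <;> (try fin_cases c) <;>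
    simp [patiSalamCode, codeList, mul_assoc, e_mul_e (2 : Fin 3) 0, TensorProduct.neg_tmul,
      TensorProduct.tmul_neg]

/-- The positions of the bits equal to `1` in the code of a basis vector. -/
def codeList5 (p : Fermion ⊕ Fermion) : List (Fin 5) :=
  (codeList p).1.map (Fin.castAdd 3) ++ (codeList p).2.map (Fin.natAdd 2)

theorem codeList5_sorted (p : Fermion ⊕ Fermion) : (codeList5 p).Pairwise (· < ·) := by
  revert p; decide

theorem codeList5_injective : Function.Injective fun p => (codeList5 p).toFinset := by
  decide

theorem orthonormal_su5Code : Orthonormal ℂ su5Code := by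
  refine orthonormal_of_eq_smul (orthonormal_basis 5) codeList5_injective fun p => ?_
  rw [basis_toFinset _ (codeList5_sorted p)]
  have h0 : Fin.castAdd 3 (0 : Fin 2) = (0 : Fin 5) := rfl
  have h1 : Fin.castAdd 3 (1 : Fin 2) = (1 : Fin 5) := rfl
  have h2 : Fin.natAdd 2 (0 : Fin 3) = (2 : Fin 5) := rfl
  have h3 : Fin.natAdd 2 (1 : Fin 3) = (3 : Fin 5) := rfl
  have h4 : Fin.natAdd 2 (2 : Fin 3) = (4 : Fin 5) := rfl
  rcases p with (⟨i⟩ | ⟨i, c⟩ | _ | _ | ⟨c⟩ | ⟨c⟩) | (⟨i⟩ | ⟨i, c⟩ | _ | _ | ⟨c⟩ | ⟨c⟩) <;>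
    (try fin_cases i) <;> (try fin_cases c) <;>
    simp [su5Code, codeList5, codeList, mul_assoc, e_mul_e (4 : Fin 5) 2, h0, h1, h2, h3, h4]

/-- The dimension of `F ⊕ F*`. -/
theorem finrank_SMSpace : Module.finrank ℂ SMSpace = 32 := by
  rw [finrank_euclideanSpace]; rfl

/-- The unitary operator `F ⊕ F* → V` that sends the basis vectors to an orthonormal family `c`. -/
def ofCode {V : Type} [NormedAddCommGroup V] [InnerProductSpace ℂ V] [FiniteDimensional ℂ V]
    (c : Fermion ⊕ Fermion → V) (hc : Orthonormal ℂ c) (hV : Module.finrank ℂ V = 32) :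
    SMSpace ≃ₗᵢ[ℂ] V :=
  LinearIsometry.toLinearIsometryEquiv
    (((EuclideanSpace.basisFun (Fermion ⊕ Fermion) ℂ).toBasis.constr ℂ c).isometryOfOrthonormal
      (v := (EuclideanSpace.basisFun (Fermion ⊕ Fermion) ℂ).toBasis)
      (by simp [(EuclideanSpace.basisFun (Fermion ⊕ Fermion) ℂ).orthonormal])
      (by
        convert hc using 1
        funext p
        exact Module.Basis.constr_basis _ _ _ _))
    (finrank_SMSpace.trans hV.symm)

theorem ofCode_single {V : Type} [NormedAddCommGroup V] [InnerProductSpace ℂ V]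
    [FiniteDimensional ℂ V] (c : Fermion ⊕ Fermion → V) (hc : Orthonormal ℂ c)
    (hV : Module.finrank ℂ V = 32) (p : Fermion ⊕ Fermion) :
    ofCode c hc hV (EuclideanSpace.single p 1) = c p := by
  have h := Module.Basis.constr_basis (EuclideanSpace.basisFun (Fermion ⊕ Fermion) ℂ).toBasis ℂ c p
  rw [OrthonormalBasis.coe_toBasis, EuclideanSpace.basisFun_apply] at h
  exact h

/-- The isomorphism `f : F ⊕ F* → Λ ℂ⁵` given by the binary code for `SU(5)`. -/
def mapF : SMSpace ≃ₗᵢ[ℂ] Fock 5 :=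
  ofCode su5Code orthonormal_su5Code (Fock.finrank 5)

/-- The isomorphism `h : F ⊕ F* → Λ ℂ² ⊗ Λ ℂ³` given by the binary code for the Pati–Salam
model. -/
def mapH : SMSpace ≃ₗᵢ[ℂ] Fock 2 ⊗[ℂ] Fock 3 :=
  ofCode patiSalamCode orthonormal_patiSalamCode
    (by rw [Module.finrank_tensorProduct, Fock.finrank, Fock.finrank]; norm_num)

/-! ### Spin groups acting on spinors -/

/-- The representation of `Spin(2m) × Spin(2n)` on `Λ ℂᵐ ⊗ Λ ℂⁿ`, the tensor product of the Dirac
spinor representations. -/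
def diracTensorRep (m n : ℕ) : Spin m × Spin n →* U (Fock m ⊗[ℂ] Fock n) where
  toFun x := TensorProduct.congrIsometry (diracRep m x.1) (diracRep n x.2)
  map_one' := by
    apply LinearIsometryEquiv.toLinearEquiv_injective
    apply LinearEquiv.toLinearMap_injective
    apply TensorProduct.ext'
    intro v w
    simp
  map_mul' x y := by
    apply LinearIsometryEquiv.toLinearEquiv_injective
    apply LinearEquiv.toLinearMap_injective
    apply TensorProduct.ext'
    intro v w
    simp

theorem diracTensorRep_tmul {m n : ℕ} (x : Spin m) (y : Spin n) (v : Fock m) (w : Fock n) :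
    diracTensorRep m n (x, y) (v ⊗ₜ w) = diracRep m x v ⊗ₜ diracRep n y w := by
  simp [diracTensorRep]

/-- `Spin(4)`. -/
abbrev Spin4 : Type := Spin 2

/-- `Spin(6)`. -/
abbrev Spin6 : Type := Spin 3

/-- `Spin(10)`. -/
abbrev Spin10 : Type := Spin 5

/-- The basis `u, d` of `Λ^odd ℂ²`, which spans the left-handed isospin space. -/
def isospinL : Fin 2 → Fock 2 := ![e 0, e 1]

/-- The basis `u ∧ d, 1` of `Λ^ev ℂ²`, which spans the right-handed isospin space. -/
def isospinR : Fin 2 → Fock 2 := ![e 0 * e 1, 1]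

/-- The basis `r, g, b, w = r ∧ g ∧ b` of `Λ^odd ℂ³`; the vector `w` is the fourth color, white. -/
def color4 : Fin 4 → Fock 3 := ![e 0, e 1, e 2, e 0 * e 1 * e 2]

end GUT

end

open GUT

noncomputable section

namespace GUT

/-! ### Operators generated by Clifford multiplication -/

namespace Fock

variable {n : ℕ}

/-! Spinors decide everything. The whole Clifford algebra acts faithfully on Λℂⁿ
(`cliffordAction_injective`): complex combinations of Clifford multiplications include every aⱼ and
aⱼ*, hence all operators, and the real dimension of the Clifford algebra equals the complex
dimension 4ⁿ of the operator algebra. So an element of a spin group is determined by its operator. A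
map into a spin group with prescribed multiplicative operators is then a homomorphism, and its
continuity can be tested on spinors (`continuous_spin_iff`). Properties of Spin(2n) are proved on
generators, since each element is a product of pairs of unit vectors (`spin_induction`).

The lift ψ. For a complex reflection A, the operator ΛA is z times a product of two unit vectors,
with z² = det A. Complex reflections generate the unitary group, so the same holds for every unitary
A (`exists_spin_mapMatrix_smul`). If det A = 1 then z = ±1, and -1 lies in Spin(2n), so ΛA itself
comes from Spin(2n).

The lift η. The Clifford algebras of orthogonal summands embed in that of the sum, and their even
elements commute; (x, y) ↦ xy is the lift. The map v ⊗ w ↦ v ∧ w intertwines the spinor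
representations (`diracRep_spinProd_wedge`).

The isomorphism α. It is inverse to the map that reads off matrices on half-spinors. A unit vector
exchanges odd and even spinors by explicit special unitary matrices, so a product of two of them
gives a pair in SU(2) × SU(2), or a matrix in SU(4) on odd spinors with its conjugate on even ones.
Injectivity is faithfulness. Surjectivity for Spin(4) uses the lift of SU(2) and its conjugate by a
unit vector; for Spin(6) it is transitivity on the unit sphere with stabilizer SU(3).

The cube. The faces over ψ and η hold by construction, and the bottom is g ∘ h = f, checked on the
codes. The faces over φ and θ are two cases of one comparison of hypercharges (`map_mapH`). The top
follows from the other five faces because Spin(10) acts faithfully. -/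

theorem gamma_single_one (j : Fin n) : gamma n (Pi.single j 1) = phi j := by
  simp only [gamma, LinearMap.coe_mk, AddHom.coe_mk]
  rw [Finset.sum_eq_single j] <;> simp +contextual

theorem gamma_single_I (j : Fin n) : gamma n (Pi.single j Complex.I) = pi j := by
  simp only [gamma, LinearMap.coe_mk, AddHom.coe_mk]
  rw [Finset.sum_eq_single j] <;> simp +contextual

theorem neg_half_I_smul_phi (j : Fin n) :
    (-(Complex.I / 2)) • phi j = (1 / 2 : ℂ) • (annihilation j + creation j) := by
  rw [phi, smul_smul]
  congr 1
  linear_combination (-1 / 2 : ℂ) * Complex.I_mul_I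

theorem annihilation_eq (j : Fin n) :
    annihilation j = (-(Complex.I / 2)) • gamma n (Pi.single j 1)
      + (1 / 2 : ℂ) • gamma n (Pi.single j Complex.I) := by
  rw [gamma_single_one, gamma_single_I, neg_half_I_smul_phi, pi]
  module

theorem creation_eq (j : Fin n) :
    creation j = (-(Complex.I / 2)) • gamma n (Pi.single j 1)
      - (1 / 2 : ℂ) • gamma n (Pi.single j Complex.I) := by
  rw [gamma_single_one, gamma_single_I, neg_half_I_smul_phi, pi]
  module

/-- The complex algebra of operators on `Λ ℂⁿ` generated by the Clifford algebra. -/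
def cliffordSpan (n : ℕ) : Subalgebra ℂ (Module.End ℂ (Fock n)) :=
  Algebra.adjoin ℂ (Set.range (cliffordAction n))

theorem cliffordAction_ι (v : Fin n → ℂ) :
    cliffordAction n (CliffordAlgebra.ι _ v) = gamma n v :=
  CliffordAlgebra.lift_ι_apply _ _ _

theorem gamma_mem_cliffordSpan (v : Fin n → ℂ) : gamma n v ∈ cliffordSpan n :=
  Algebra.subset_adjoin ⟨_, cliffordAction_ι v⟩

theorem annihilation_mem_cliffordSpan (j : Fin n) : annihilation j ∈ cliffordSpan n := by
  rw [annihilation_eq]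
  exact add_mem (Subalgebra.smul_mem _ (gamma_mem_cliffordSpan _) _)
    (Subalgebra.smul_mem _ (gamma_mem_cliffordSpan _) _)

theorem creation_mem_cliffordSpan (j : Fin n) : creation j ∈ cliffordSpan n := by
  rw [creation_eq]
  exact sub_mem (Subalgebra.smul_mem _ (gamma_mem_cliffordSpan _) _)
    (Subalgebra.smul_mem _ (gamma_mem_cliffordSpan _) _)

/-- Multiplication by a wedge product of basis vectors is a product of creation operators. -/
theorem mulLeft_mem_cliffordSpan (x : Fock n) : LinearMap.mulLeft ℂ x ∈ cliffordSpan n := by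
  induction x using induction_e with
  | h1 => rw [LinearMap.mulLeft_one]; exact one_mem _
  | hadd x y hx hy =>
    have : LinearMap.mulLeft ℂ (x + y) = LinearMap.mulLeft ℂ x + LinearMap.mulLeft ℂ y := by
      ext; simp [add_mul]
    rw [this]; exact add_mem hx hy
  | hsmul c x hx =>
    have : LinearMap.mulLeft ℂ (c • x) = c • LinearMap.mulLeft ℂ x := by
      ext; simp
    rw [this]; exact Subalgebra.smul_mem _ hx c
  | he j x hx =>
    rw [LinearMap.mulLeft_mul]
    exact mul_mem (creation_mem_cliffordSpan j) hx

/-- The operator aⱼ aⱼ* keeps the basis vectors that do not involve eⱼ and kills the others; the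
projection is the product of these operators over s. -/
theorem exists_disjoint_projection (s : Finset (Fin n)) : ∃ P ∈ cliffordSpan n,
    ∀ T, P (basis n T) = if Disjoint s T then basis n T else 0 := by
  induction s using Finset.induction_on with
  | empty => exact ⟨1, one_mem _, by simp⟩
  | insert j s _ ih =>
    obtain ⟨P, hP, h⟩ := ih
    refine ⟨annihilation j * creation j * P,
      mul_mem (mul_mem (annihilation_mem_cliffordSpan j) (creation_mem_cliffordSpan j)) hP,
      fun T => ?_⟩
    rw [Module.End.mul_apply, Module.End.mul_apply, h]
    simp only [Finset.disjoint_insert_left]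
    by_cases hs : Disjoint s T
    · rw [if_pos hs, creation_apply, annihilation_e_mul, annihilation_basis]
      by_cases hj : j ∈ T
      · have : e j * basis n (T.erase j)
            = (-1 : ℂ) ^ ((T.erase j).filter (· < j)).card • basis n T := by
          rw [creation_basis, if_neg (Finset.notMem_erase j T), Finset.insert_erase hj]
        have h6 : (T.erase j).filter (· < j) = T.filter (· < j) := by
          ext x; simp only [Finset.mem_filter, Finset.mem_erase]
          exact ⟨fun h => ⟨h.1.2, h.2⟩, fun h => ⟨⟨h.2.ne, h.1⟩, h.2⟩⟩
        rw [if_pos hj, mul_smul_comm, this, h6, smul_smul, ← mul_pow]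
        simp [hj]
      · simp [hj, hs]
    · simp [hs]

/-- Annihilating the factors of e_S one after another leads to the vacuum 1, up to a sign that is
compensated; the projection onto the vacuum then removes whatever comes from other basis vectors. -/
theorem exists_basis_functional (S : Finset (Fin n)) : ∃ P ∈ cliffordSpan n,
    ∀ T, P (basis n T) = if T = S then 1 else 0 := by
  induction S using Finset.induction_on with
  | empty =>
    obtain ⟨P, hP, h⟩ := exists_disjoint_projection (Finset.univ : Finset (Fin n))
    refine ⟨P, hP, fun T => ?_⟩
    rw [h]
    by_cases hT : T = ∅
    · subst hT; simp [basis_empty]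
    · rw [if_neg hT, if_neg]
      rwa [← Finset.top_eq_univ, top_disjoint]
  | insert j S hj ih =>
    obtain ⟨P, hP, h⟩ := ih
    refine ⟨(-1 : ℂ) ^ ((insert j S).filter (· < j)).card • (P * annihilation j),
      Subalgebra.smul_mem _ (mul_mem hP (annihilation_mem_cliffordSpan j)) _, fun T => ?_⟩
    rw [LinearMap.smul_apply, Module.End.mul_apply, annihilation_basis]
    by_cases hT : T = insert j S
    · subst hT
      rw [if_pos (Finset.mem_insert_self j S), map_smul, h, if_pos (Finset.erase_insert hj),
        if_pos rfl, smul_smul, ← mul_pow]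
      simp
    · rw [if_neg hT]
      by_cases hjT : j ∈ T
      · rw [if_pos hjT, map_smul, h, if_neg, smul_zero, smul_zero]
        rintro rfl
        exact hT (Finset.insert_erase hjT).symm
      · simp [hjT]

/-- If P_S sends e_S to 1 and the other basis vectors to 0, then T is the sum over S of P_S followed
by left multiplication by T e_S. -/
theorem cliffordSpan_eq_top (n : ℕ) : cliffordSpan n = ⊤ := by
  refine eq_top_iff.2 fun T _ => ?_
  choose P hP h using exists_basis_functional (n := n)
  have : T = ∑ S, LinearMap.mulLeft ℂ (T (basis n S)) * P S := by
    refine (basis n).ext fun S => ?_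
    rw [LinearMap.sum_apply, Finset.sum_eq_single S]
    · simp [h]
    · intro S' _ hS'
      simp [h, hS'.symm]
    · simp
  rw [this]
  exact sum_mem fun S _ => mul_mem (mulLeft_mem_cliffordSpan _) (hP S)

/-- The image of the Clifford algebra is already closed under products, so the complex algebra that
it generates is merely its linear span. -/
theorem span_range_cliffordAction (n : ℕ) :
    Submodule.span ℂ (Set.range (cliffordAction n)) = ⊤ := by
  have h := congrArg Subalgebra.toSubmodule (cliffordSpan_eq_top n)
  rw [cliffordSpan, Algebra.adjoin_eq_span, Algebra.top_toSubmodule] at h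
  rw [← h]
  congr 1
  exact (congrArg SetLike.coe
    (Submonoid.closure_eq (MonoidHom.mrange (cliffordAction n).toRingHom.toMonoidHom))).symm

end Fock

/-! ### Faithfulness of the spinor representation -/

theorem finrank_cliff (n : ℕ) : Module.finrank ℝ (Cliff n) = 2 ^ (2 * n) := by
  let b := (Module.finBasis ℝ (Fin n → ℂ)).ExteriorAlgebra
  rw [(CliffordAlgebra.equivExterior (negNormSq n)).finrank_eq, Module.finrank_eq_card_basis b,
    Fintype.card_finset, Fintype.card_fin]
  congr 1
  rw [Module.finrank_pi_fintype]
  simp [Complex.finrank_real_complex, mul_comm]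

instance (n : ℕ) : FiniteDimensional ℝ (Cliff n) :=
  Module.finite_of_finrank_pos (by rw [finrank_cliff]; positivity)

/-- The Clifford algebra acts faithfully on spinors. -/
theorem cliffordAction_injective (n : ℕ) : Function.Injective (Fock.cliffordAction n) := by
  let b := Module.finBasis ℝ (Cliff n)
  have hspan : ⊤ ≤ Submodule.span ℂ (Set.range (Fock.cliffordAction n ∘ b)) := by
    rw [← Fock.span_range_cliffordAction n, Submodule.span_le]
    rintro _ ⟨x, rfl⟩
    rw [← b.sum_repr x, map_sum]
    refine sum_mem fun i _ => ?_
    rw [map_smul, ← Complex.coe_smul]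
    exact Submodule.smul_mem _ _ (Submodule.subset_span ⟨i, rfl⟩)
  have hli : LinearIndependent ℂ (Fock.cliffordAction n ∘ b) := by
    -- The family has 4ⁿ members and spans a complex space of dimension 4ⁿ, so it is independent
    -- over ℂ and a fortiori over ℝ.
    refine linearIndependent_of_top_le_span_of_card_eq_finrank hspan ?_
    rw [Fintype.card_fin, finrank_cliff, Module.finrank_linearMap, Fock.finrank, ← pow_add,
      two_mul]
  have hR : LinearIndependent ℝ (Fock.cliffordAction n ∘ b) :=
    hli.restrict_scalars (R := ℝ) fun x y h => by simpa using h
  have hk : LinearMap.ker (Fock.cliffordAction n).toLinearMap = ⊥ := by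
    refine LinearMap.ker_eq_bot'.2 fun x hx => ?_
    have h0 : ∑ i, b.repr x i • (Fock.cliffordAction n ∘ b) i = 0 := by
      rw [← hx]
      conv_rhs => rw [← b.sum_repr x]
      simp only [map_sum, map_smul]
      rfl
    have h1 := Fintype.linearIndependent_iff.1 hR _ h0
    rw [← b.sum_repr x]
    simp [h1]
  exact LinearMap.ker_eq_bot.1 hk

theorem diracRep_injective (n : ℕ) : Function.Injective (diracRep n) := by
  intro x y h
  apply Subtype.ext
  apply cliffordAction_injective n
  refine LinearMap.ext fun v => ?_
  rw [← diracRep_apply, h, diracRep_apply]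

end GUT

namespace GUT

open CliffordAlgebra (ι)

/-! ### Generators of the spin groups -/

variable {n : ℕ}

theorem negNormSq_smul_unit (v : Fin n → ℂ) (hv : v ≠ 0) :
    ∃ (r : ℝ) (u : Fin n → ℂ), 0 ≤ r ∧ negNormSq n u = -1 ∧ v = r • u := by
  have hpos : 0 < ∑ j, Complex.normSq (v j) := by
    obtain ⟨j, hj⟩ := Function.ne_iff.1 hv
    exact Finset.sum_pos' (fun _ _ => Complex.normSq_nonneg _)
      ⟨j, Finset.mem_univ j, Complex.normSq_pos.2 hj⟩
  have hs : 0 < √(∑ j, Complex.normSq (v j)) := Real.sqrt_pos.2 hpos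
  refine ⟨_, (√(∑ j, Complex.normSq (v j)))⁻¹ • v, hs.le, ?_, ?_⟩
  · rw [QuadraticMap.map_smul, negNormSq_apply, smul_eq_mul, ← mul_inv,
      Real.mul_self_sqrt hpos.le, mul_neg, inv_mul_cancel₀ hpos.ne']
  · rw [smul_smul, mul_inv_cancel₀ hs.ne', one_smul]

theorem ι_mem_pinGroup {u : Fin n → ℂ} (hu : negNormSq n u = -1) :
    ι (negNormSq n) u ∈ pinGroup (negNormSq n) := by
  have h : ι (negNormSq n) u * ι (negNormSq n) u = -1 := by
    rw [CliffordAlgebra.ι_sq_scalar, hu]; simp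
  refine ⟨⟨⟨ι _ u, - ι _ u, by simp [h], by simp [h]⟩, Subgroup.subset_closure ⟨u, rfl⟩, rfl⟩, ?_⟩
  exact Unitary.mem_iff.2 (by simp [CliffordAlgebra.star_ι, h])

theorem ι_mul_ι_mem_spinGroup {u v : Fin n → ℂ} (hu : negNormSq n u = -1)
    (hv : negNormSq n v = -1) :
    ι (negNormSq n) u * ι (negNormSq n) v ∈ spinGroup (negNormSq n) :=
  ⟨mul_mem (ι_mem_pinGroup hu) (ι_mem_pinGroup hv), CliffordAlgebra.ι_mul_ι_mem_evenOdd_zero _ _ _⟩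

/-- The products of an even number of unit vectors in the Clifford algebra. -/
def evenProducts (n : ℕ) : Submonoid (Cliff n) :=
  Submonoid.closure {y | ∃ u v : Fin n → ℂ, negNormSq n u = -1 ∧
      negNormSq n v = -1 ∧ ι (negNormSq n) u * ι (negNormSq n) v = y}

/-- The nonnegative multiples of products of unit vectors in the Clifford algebra. -/
def IsScaledProduct (x : Cliff n) : Prop :=
  ∃ r : ℝ, 0 ≤ r ∧ ∃ z ∈ evenProducts n,
    x = r • z ∨ ∃ u : Fin n → ℂ, negNormSq n u = -1 ∧ x = r • (ι (negNormSq n) u * z)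

/-- The Lipschitz group is generated by invertible vectors, and each vector is a nonnegative
multiple of a unit vector. Unit vectors are absorbed in pairs; the two alternatives of
`IsScaledProduct` record whether one is left over. -/
theorem isScaledProduct_of_mem_lipschitzGroup (x : (Cliff n)ˣ)
    (hx : x ∈ lipschitzGroup (negNormSq n)) : IsScaledProduct (x : Cliff n) := by
  have key : ∀ (a : Fin n → ℂ) (x y : (Cliff n)ˣ), ι (negNormSq n) a = x →
      IsScaledProduct (y : Cliff n) → IsScaledProduct ((x * y : (Cliff n)ˣ) : Cliff n) := by
    rintro a x y ha ⟨r, hr, z, hz, h⟩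
    rw [Units.val_mul, ← ha]
    by_cases ha0 : a = 0
    -- The zero vector is not invertible, but the scale factor 0 covers it without an argument.
    · exact ⟨0, le_rfl, 1, one_mem _, Or.inl (by simp [ha0])⟩
    obtain ⟨s, u, hs, hu, rfl⟩ := negNormSq_smul_unit a ha0
    rcases h with h | ⟨u', hu', h⟩
    · exact ⟨s * r, mul_nonneg hs hr, z, hz, Or.inr ⟨u, hu, by simp [h, mul_smul, smul_comm r s]⟩⟩
    · refine ⟨s * r, mul_nonneg hs hr, _,
        mul_mem (Submonoid.subset_closure ⟨u, u', hu, hu', rfl⟩) hz, Or.inl ?_⟩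
      simp [h, mul_smul, mul_assoc, smul_comm r s]
  induction hx using Subgroup.closure_induction_left with
  | one => exact ⟨1, zero_le_one, 1, one_mem _, Or.inl (by simp)⟩
  | mul_left x hx y _ ih =>
    obtain ⟨a, ha⟩ := hx
    exact key a x y ha ih
  | inv_mul_cancel x hx y _ ih =>
    obtain ⟨a, ha⟩ := hx
    let := x.invertible
    let : Invertible (ι (negNormSq n) a) := by rwa [ha]
    let : Invertible (negNormSq n a) := CliffordAlgebra.invertibleOfInvertibleι _ a
    -- The inverse of a vector a is Q(a)⁻¹ a, again a vector.
    refine key (⅟(negNormSq n a) • a) x⁻¹ y ?_ ih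
    rw [← CliffordAlgebra.invOf_ι, ← invOf_units x]
    simp only [ha]

/-- `Spin(2n)` consists of the products of pairs of unit vectors. -/
theorem spin_induction {P : ∀ x : Cliff n, x ∈ spinGroup (negNormSq n) → Prop}
    (one : P 1 (one_mem _))
    (mul : ∀ (u v : Fin n → ℂ) (hu : negNormSq n u = -1) (hv : negNormSq n v = -1) (x : Cliff n)
      (hx : x ∈ spinGroup (negNormSq n)), P x hx →
      P (ι (negNormSq n) u * ι (negNormSq n) v * x) (mul_mem (ι_mul_ι_mem_spinGroup hu hv) hx))
    {x : Cliff n} (hx : x ∈ spinGroup (negNormSq n)) : P x hx := by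
  have hC : ∀ z ∈ evenProducts n, ∃ h : z ∈ spinGroup (negNormSq n), P z h := by
    intro z hz
    induction hz using Submonoid.closure_induction_left with
    | one => exact ⟨one_mem _, one⟩
    | mul_left y hy z _ ih =>
      obtain ⟨u, v, hu, hv, rfl⟩ := hy
      exact ⟨_, mul u v hu hv z ih.1 ih.2⟩
  obtain ⟨⟨x', hx', hxx⟩, hstar⟩ := hx.1
  obtain ⟨r, hr, z, hz, h⟩ := isScaledProduct_of_mem_lipschitzGroup x' hx'
  rw [show (x' : Cliff n) = x from hxx] at h
  have h1 : star x * x = 1 := spinGroup.star_mul_self_of_mem hx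
  have hz1 : star z * z = 1 := spinGroup.star_mul_self_of_mem (hC z hz).1
  rcases h with rfl | ⟨u, hu, h⟩
  · rw [CliffordAlgebra.star_smul, smul_mul_smul_comm, hz1] at h1
    -- Letting both sides of x*x = 1 act on the vacuum 1 turns the equation into one between
    -- scalars; then r = 1, as r is nonnegative.
    have h2 : r * r = 1 := by
      have := congrArg (Fock.cliffordAction n · 1) h1
      simp only [map_smul, map_one, LinearMap.smul_apply, Module.End.one_apply] at this
      rw [← Complex.coe_smul, ← sub_eq_zero, ← one_smul ℂ (1 : Fock n), smul_smul, ← sub_smul,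
        mul_one] at this
      rcases smul_eq_zero.1 this with h | h
      · exact_mod_cast sub_eq_zero.1 h
      · exact absurd h one_ne_zero
    have h3 : r = 1 := by nlinarith
    simp only [h3, one_smul]
    exact (hC z hz).2
  -- With a vector left over, x would be both even and odd, hence 0, contrary to x*x = 1.
  · exfalso
    have hodd : x ∈ CliffordAlgebra.evenOdd (negNormSq n) 1 := by
      rw [h]
      refine Submodule.smul_mem _ _ ?_
      have := SetLike.mul_mem_graded (A := CliffordAlgebra.evenOdd (negNormSq n))
        (CliffordAlgebra.ι_mem_evenOdd_one (negNormSq n) u) (hC z hz).1.2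
      simpa using this
    have hx0 : x = 0 := by
      have := (CliffordAlgebra.evenOdd_isCompl (negNormSq n)).disjoint
      exact (Submodule.disjoint_def.1 this) x hx.2 hodd
    have := congrArg (Fock.cliffordAction n · 1) h1
    simp [hx0] at this

/-! ### The topology of the spin groups -/

/-- Evaluation on the basis spinors embeds the finite-dimensional Clifford algebra linearly in a
finite power of Λℂⁿ, so the topology of the spin group is that of pointwise convergence on spinors.
-/
theorem continuous_spin_iff {X : Type*} [TopologicalSpace X] {f : X → Spin n} :
    Continuous f ↔ ∀ v, Continuous fun x => diracRep n (f x) v := by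
  let : TopologicalSpace (Cliff n) := moduleTopology ℝ (Cliff n)
  have : IsModuleTopology ℝ (Cliff n) := ⟨rfl⟩
  have : ContinuousAdd (Cliff n) := IsModuleTopology.toContinuousAdd ℝ _
  have : ContinuousSMul ℝ (Cliff n) := IsModuleTopology.toContinuousSMul ℝ _
  have : IsTopologicalAddGroup (Cliff n) := IsModuleTopology.topologicalAddGroup ℝ _
  constructor
  · intro hf v
    let L : Cliff n →ₗ[ℝ] Fock n :=
      { toFun := fun a => Fock.cliffordAction n a v
        map_add' := fun a b => by simp
        map_smul' := fun r a => by simp }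
    have hL : Continuous L := IsModuleTopology.continuous_of_linearMap L
    exact hL.comp (continuous_induced_dom.comp hf)
  · intro h
    let L : Cliff n →ₗ[ℝ] (Finset (Fin n) → Fock n) :=
      { toFun := fun a S => Fock.cliffordAction n a (Fock.basis n S)
        map_add' := fun a b => by ext1 S; simp
        map_smul' := fun r a => by ext1 S; simp }
    have hL : LinearMap.ker L = ⊥ := by
      refine LinearMap.ker_eq_bot'.2 fun a ha => cliffordAction_injective n ?_
      rw [map_zero]
      exact (Fock.basis n).ext fun S => congrFun ha S
    -- A linear left inverse between finite-dimensional spaces is continuous, and it recovers the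
    -- Clifford element from its values on the basis spinors.
    obtain ⟨R, hR⟩ := L.exists_leftInverse_of_injective hL
    have hRc : Continuous R := LinearMap.continuous_of_finiteDimensional R
    rw [continuous_induced_rng]
    have : Subtype.val ∘ f = R ∘ fun x S => diracRep n (f x) (Fock.basis n S) := by
      funext x
      exact (LinearMap.congr_fun hR (f x : Cliff n)).symm
    rw [this]
    exact hRc.comp (continuous_pi fun S => h _)

end GUT

namespace GUT

open CliffordAlgebra (ι)
open Matrix

variable {n : ℕ}

/-! ### Contraction with a vector -/

namespace Fock

/-- The annihilation operator `∑ⱼ v̄ⱼ aⱼ` of a vector `v`. -/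
def contract (v : Fin n → ℂ) : Fock n →ₗ[ℂ] Fock n :=
  CliffordAlgebra.contractLeft (∑ j, conj (v j) • LinearMap.proj j : (Fin n → ℂ) →ₗ[ℂ] ℂ)

theorem contract_eq_sum (v : Fin n → ℂ) (x : Fock n) :
    contract v x = ∑ j, conj (v j) • annihilation j x := by
  simp only [contract, map_sum, map_smul, LinearMap.sum_apply, LinearMap.smul_apply]
  rfl

theorem contract_ι_mul (v w : Fin n → ℂ) (x : Fock n) :
    contract v (ExteriorAlgebra.ι ℂ w * x)
      = (star v ⬝ᵥ w) • x - ExteriorAlgebra.ι ℂ w * contract v x := by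
  rw [contract, ExteriorAlgebra.ι, CliffordAlgebra.contractLeft_ι_mul]
  congr 2
  simp [dotProduct]

theorem contract_one (v : Fin n → ℂ) : contract v (1 : Fock n) = 0 :=
  CliffordAlgebra.contractLeft_one (Q := 0) _

theorem contract_contract (v : Fin n → ℂ) (x : Fock n) : contract v (contract v x) = 0 :=
  CliffordAlgebra.contractLeft_contractLeft (Q := 0) _ x

theorem gamma_apply_eq (v : Fin n → ℂ) (x : Fock n) :
    gamma n v x = Complex.I • (contract v x + ExteriorAlgebra.ι ℂ v * x) := by
  rw [gamma_apply, contract_eq_sum]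

theorem ι_mul_ι_mul (v : Fin n → ℂ) (x : Fock n) :
    ExteriorAlgebra.ι ℂ v * (ExteriorAlgebra.ι ℂ v * x) = 0 := by
  rw [← mul_assoc, ExteriorAlgebra.ι_sq_zero, zero_mul]

theorem ι_mul_ι_mul_comm (v w : Fin n → ℂ) (x : Fock n) :
    ExteriorAlgebra.ι ℂ v * (ExteriorAlgebra.ι ℂ w * x)
      = - (ExteriorAlgebra.ι ℂ w * (ExteriorAlgebra.ι ℂ v * x)) := by
  rw [← mul_assoc, ← mul_assoc, ← neg_mul]
  congr 1
  exact eq_neg_of_add_eq_zero_left (ExteriorAlgebra.ι_add_mul_swap _ _)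

end Fock

/-! ### Complex reflections -/

/-- The matrix `1 + c u u*`, a complex reflection if `|1 + c |u|²| = 1`. -/
def reflection (u : Fin n → ℂ) (c : ℂ) : Matrix (Fin n) (Fin n) ℂ :=
  1 + c • vecMulVec u (star u)

theorem reflection_mulVec (u : Fin n → ℂ) (c : ℂ) (v : Fin n → ℂ) :
    reflection u c *ᵥ v = v + (c * (star u ⬝ᵥ v)) • u := by
  rw [reflection, add_mulVec, one_mulVec, smul_mulVec, vecMulVec_mulVec, mul_smul]
  simp

theorem det_reflection (u : Fin n → ℂ) (c : ℂ) :
    (reflection u c).det = 1 + c * (star u ⬝ᵥ u) := by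
  rw [reflection, ← smul_vecMulVec, vecMulVec_eq Unit, det_one_add_replicateCol_mul_replicateRow,
    dotProduct_smul, smul_eq_mul]

theorem reflection_conjTranspose (u : Fin n → ℂ) (c : ℂ) :
    (reflection u c)ᴴ = reflection u (conj c) := by
  ext i j
  simp [reflection, vecMulVec_apply, one_apply, eq_comm, mul_comm]

theorem reflection_mul (u : Fin n → ℂ) (c d : ℂ) :
    reflection u c * reflection u d = reflection u (c + d + c * d * (star u ⬝ᵥ u)) := by
  simp only [reflection, mul_add, add_mul, mul_one, one_mul, smul_mul_smul_comm,
    vecMulVec_mul_vecMulVec]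
  rw [vecMulVec_smul]
  module

theorem reflection_smul (u : Fin n → ℂ) (r : ℝ) (c : ℂ) :
    reflection ((r : ℂ) • u) c = reflection u (c * r ^ 2) := by
  ext i j
  simp [reflection, vecMulVec_apply]
  ring

/-- The induced automorphism stops at first order in c, because terms with two factors u vanish. -/
theorem mapMatrix_reflection (u : Fin n → ℂ) (c : ℂ) (x : Fock n) :
    Fock.mapMatrix (reflection u c) x
      = x + c • (ExteriorAlgebra.ι ℂ u * Fock.contract u x) := by
  induction x using Fock.induction_e with
  | h1 => simp [Fock.mapMatrix, Fock.contract_one]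
  | hadd x y hx hy =>
    rw [map_add, hx, hy, map_add, mul_add, smul_add]
    abel
  | hsmul a x hx => rw [map_smul, hx, map_smul, mul_smul_comm, smul_add, smul_comm]
  | he j x hx =>
    rw [Fock.e, Fock.mapMatrix_ι_mul, hx, reflection_mulVec, Fock.contract_ι_mul, map_add,
      map_smul, add_mul, mul_add, mul_add, mul_sub, mul_smul_comm, smul_mul_assoc, smul_mul_assoc,
      mul_smul_comm, mul_smul_comm, Fock.ι_mul_ι_mul, Fock.ι_mul_ι_mul_comm u]
    module

/-- With a the contraction by u and a* the wedge with u, the product is -(a + a*)(z̄a + za*), and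
aa* = 1 - a*a for a unit vector. -/
theorem gamma_mul_gamma_smul (u : Fin n → ℂ) (hu : star u ⬝ᵥ u = 1) (z : ℂ) (x : Fock n) :
    Fock.gamma n u (Fock.gamma n (z • u) x)
      = -z • x + (z - conj z) • (ExteriorAlgebra.ι ℂ u * Fock.contract u x) := by
  have h : Fock.contract (z • u) x = conj z • Fock.contract u x := by
    simp [Fock.contract_eq_sum, Finset.smul_sum, smul_smul]
  have hI : ∀ z, Complex.I * z * Complex.I = -z := fun z => by
    rw [mul_right_comm, Complex.I_mul_I, neg_one_mul]
  simp only [Fock.gamma_apply_eq, h, map_smul, map_add, smul_add, smul_mul_assoc,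
    Fock.contract_ι_mul, Fock.contract_contract, Fock.ι_mul_ι_mul, hu, smul_smul, zero_add,
    add_zero, one_smul, smul_sub, hI]
  module

theorem negNormSq_eq_neg_one_iff (u : Fin n → ℂ) : negNormSq n u = -1 ↔ star u ⬝ᵥ u = 1 := by
  rw [negNormSq_apply, neg_inj]
  have : star u ⬝ᵥ u = ((∑ j, Complex.normSq (u j) : ℝ) : ℂ) := by
    simp [dotProduct, Complex.normSq_eq_conj_mul_self]
  rw [this]
  norm_cast

/-- The spin element is u · (-z̄u). By `gamma_mul_gamma_smul` it acts as z̄ + (z - z̄)a*a, and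
multiplication by z gives 1 + (z² - 1)a*a. -/
theorem exists_spin_reflection (u : Fin n → ℂ) (hu : star u ⬝ᵥ u = 1) (z : ℂ)
    (hz : z * conj z = 1) :
    ∃ x ∈ spinGroup (negNormSq n),
      Fock.mapMatrix (reflection u (z ^ 2 - 1)) = z • Fock.cliffordAction n x := by
  refine ⟨_, ι_mul_ι_mem_spinGroup (u := u) (v := (-conj z) • u)
    ((negNormSq_eq_neg_one_iff u).2 hu) ((negNormSq_eq_neg_one_iff _).2 ?_), ?_⟩
  · rw [star_smul, smul_dotProduct, dotProduct_smul, hu]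
    simpa using hz
  · refine LinearMap.ext fun x => ?_
    rw [mapMatrix_reflection, map_mul, Fock.cliffordAction_ι, Fock.cliffordAction_ι,
      LinearMap.smul_apply, Module.End.mul_apply, gamma_mul_gamma_smul u hu, smul_add, smul_smul,
      smul_smul, map_neg, Complex.conj_conj, neg_neg, hz, one_smul]
    congr 2
    linear_combination hz

theorem star_mulVec_dotProduct_mulVec {A : Matrix (Fin n) (Fin n) ℂ}
    (hA : A ∈ unitaryGroup (Fin n) ℂ) (v w : Fin n → ℂ) :
    star (A *ᵥ v) ⬝ᵥ (A *ᵥ w) = star v ⬝ᵥ w := by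
  rw [star_mulVec, dotProduct_mulVec, vecMul_vecMul, ← star_eq_conjTranspose,
    mem_unitaryGroup_iff'.1 hA, vecMul_one]

theorem star_dotProduct_self_ne_zero {v : Fin n → ℂ} (hv : v ≠ 0) : star v ⬝ᵥ v ≠ 0 := by
  open scoped ComplexOrder in
  exact fun h => hv (dotProduct_star_self_eq_zero.1 h)

theorem reflection_mem_unitaryGroup {u : Fin n → ℂ} {c : ℂ}
    (h : c + conj c + c * conj c * (star u ⬝ᵥ u) = 0) :
    reflection u c ∈ unitaryGroup (Fin n) ℂ := by
  rw [mem_unitaryGroup_iff, star_eq_conjTranspose, reflection_conjTranspose, reflection_mul, h]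
  simp [reflection]

/-- The unitary group is generated by complex reflections. -/
theorem unitaryGroup_le_of_reflection_mem (S : Submonoid (Matrix (Fin n) (Fin n) ℂ))
    (hS : ∀ (u : Fin n → ℂ) (z : ℂ), star u ⬝ᵥ u = 1 → z * conj z = 1 →
      reflection u (z ^ 2 - 1) ∈ S) : unitaryGroup (Fin n) ℂ ≤ S := by
  have hS' : ∀ (u : Fin n → ℂ) (c : ℂ), u ≠ 0 →
      c + conj c + c * conj c * (star u ⬝ᵥ u) = 0 → reflection u c ∈ S := by
    intro u c hu hc
    obtain ⟨r, v, -, hv, rfl⟩ := negNormSq_smul_unit u hu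
    rw [negNormSq_eq_neg_one_iff] at hv
    rw [← Complex.coe_smul] at hc ⊢
    rw [reflection_smul]
    -- After normalizing u, the nontrivial eigenvalue of the reflection is 1 + c r²; the unitarity
    -- condition on c gives it, and hence its square root z, modulus 1.
    obtain ⟨z, hz⟩ := IsAlgClosed.exists_pow_nat_eq (1 + c * r ^ 2) two_pos
    have hzz : (z * conj z) ^ 2 = 1 := by
      rw [mul_pow, ← map_pow, hz]
      rw [star_smul, smul_dotProduct, dotProduct_smul, hv] at hc
      simp at hc ⊢
      linear_combination (r : ℂ) ^ 2 * hc
    rw [Complex.mul_conj] at hzz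
    have hn : Complex.normSq z = 1 := by
      have h1 : (Complex.normSq z) ^ 2 = 1 := by exact_mod_cast hzz
      nlinarith [Complex.normSq_nonneg z]
    have := hS v z hv (by rw [Complex.mul_conj, hn]; simp)
    rwa [hz, add_sub_cancel_left] at this
  -- Induction on a set of basis vectors outside which A fixes everything: one reflection suffices
  -- to fix one more basis vector.
  have key : ∀ (s : Finset (Fin n)) (A : Matrix (Fin n) (Fin n) ℂ),
      A ∈ unitaryGroup (Fin n) ℂ → (∀ i ∉ s, A *ᵥ Pi.single i 1 = Pi.single i 1) → A ∈ S := by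
    intro s
    induction s using Finset.induction_on with
    | empty =>
      intro A _ h
      have : A = 1 := ext_of_mulVec_single fun i => by
        rw [h i (by simp), one_mulVec]
      rw [this]; exact one_mem S
    | insert a s ha ih =>
      intro A hA h
      set v := A *ᵥ Pi.single a 1 with hv
      by_cases hva : v = Pi.single a 1
      · refine ih A hA fun i hi => ?_
        by_cases hia : i = a
        · rw [hia]; exact hva
        · exact h i (by simp [hia, hi])
      have hd : v - Pi.single a 1 ≠ 0 := sub_ne_zero.2 hva
      have hvv : star v ⬝ᵥ v = 1 := by
        rw [hv, star_mulVec_dotProduct_mulVec hA]; simp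
      have hdv : star (v - Pi.single a 1) ⬝ᵥ v = 1 - v a := by
        rw [star_sub, sub_dotProduct, hvv, ← Pi.single_star, star_one, single_one_dotProduct]
      have hdd : star (v - Pi.single a 1) ⬝ᵥ (v - Pi.single a 1) = (1 - v a) + (1 - conj (v a)) := by
        rw [dotProduct_sub, hdv, dotProduct_single_one]
        simp
        ring
      have hne : 1 - v a ≠ 0 := by
        intro h0
        refine star_dotProduct_self_ne_zero hd ?_
        rw [hdd, h0, ← map_one (starRingEnd ℂ), ← map_sub, h0]
        simp
      have hne' : 1 - conj (v a) ≠ 0 := by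
        rw [← map_one (starRingEnd ℂ), ← map_sub]
        exact (map_ne_zero _).2 hne
      set d := v - Pi.single a 1
      -- Chosen so that the reflection along d = v - e_a takes v = A e_a to e_a: indeed d*v = 1 -
      -- v_a, so v is moved by -d.
      set c := -(1 - v a)⁻¹
      have hc : c + conj c + c * conj c * (star d ⬝ᵥ d) = 0 := by
        rw [hdd]
        simp only [c, map_neg, map_inv₀, map_sub, map_one]
        field_simp
        ring
      have hR : reflection d c ∈ unitaryGroup (Fin n) ℂ := reflection_mem_unitaryGroup hc
      have hfix : ∀ i ∉ s, (reflection d c * A) *ᵥ Pi.single i 1 = Pi.single i 1 := by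
        intro i hi
        rw [← mulVec_mulVec]
        by_cases hia : i = a
        · rw [hia, ← hv, reflection_mulVec, hdv, neg_mul, inv_mul_cancel₀ hne]
          simp [d]
        · rw [h i (by simp [hia, hi]), reflection_mulVec, dotProduct_single_one]
          -- A vector e_i that A already fixes is orthogonal to A e_a and to e_a, hence to d, so the
          -- reflection fixes it too.
          have h1 : star (A *ᵥ Pi.single a 1) ⬝ᵥ (A *ᵥ Pi.single i 1) = 0 := by
            rw [star_mulVec_dotProduct_mulVec hA]
            simp [Ne.symm hia]
          rw [h i (by simp [hia, hi]), dotProduct_single_one] at h1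
          have h2 : star d i = 0 := by
            simp only [d, star_sub, Pi.sub_apply]
            rw [hv, h1]
            simp [hia]
          rw [h2]
          simp
      have hA' : A = reflection d (conj c) * (reflection d c * A) := by
        rw [← mul_assoc, ← reflection_conjTranspose, ← star_eq_conjTranspose,
          mem_unitaryGroup_iff'.1 hR, one_mul]
      rw [hA']
      refine mul_mem (hS' _ _ hd ?_) (ih _ (mul_mem hR hA) hfix)
      rw [Complex.conj_conj]
      linear_combination hc
  exact fun A hA => key Finset.univ A hA (by simp)

/-! ### The lift of `SU(n)` to `Spin(2n)` -/

/-- The property is multiplicative in A and holds for complex reflections, where det = z². The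
square root of the determinant is the obstruction to lifting all of U(n). -/
theorem exists_spin_mapMatrix_smul {A : Matrix (Fin n) (Fin n) ℂ}
    (hA : A ∈ unitaryGroup (Fin n) ℂ) : ∃ x ∈ spinGroup (negNormSq n), ∃ z : ℂ, z ^ 2 = A.det ∧
      Fock.mapMatrix A = z • Fock.cliffordAction n x := by
  let S : Submonoid (Matrix (Fin n) (Fin n) ℂ) :=
    { carrier := {A | ∃ x ∈ spinGroup (negNormSq n), ∃ z : ℂ, z ^ 2 = A.det ∧
        Fock.mapMatrix A = z • Fock.cliffordAction n x}
      one_mem' := ⟨1, one_mem _, 1, by simp, by rw [Fock.mapMatrix_one, map_one, one_smul]; rfl⟩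
      mul_mem' := by
        rintro A B ⟨x, hx, z, hz, h⟩ ⟨y, hy, w, hw, h'⟩
        refine ⟨x * y, mul_mem hx hy, z * w, by rw [mul_pow, hz, hw, det_mul], ?_⟩
        rw [Fock.mapMatrix_mul, h, h', map_mul, ← Module.End.mul_eq_comp, smul_mul_smul_comm] }
  refine unitaryGroup_le_of_reflection_mem S (fun u z hu hz => ?_) hA
  obtain ⟨x, hx, h⟩ := exists_spin_reflection u hu z hz
  exact ⟨x, hx, z, by rw [det_reflection, hu]; ring, h⟩

/-- -1 is the square of a unit vector; this is where n > 0 is needed. -/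
theorem neg_one_mem_spinGroup [NeZero n] : (-1 : Cliff n) ∈ spinGroup (negNormSq n) := by
  have h : negNormSq n (Pi.single 0 1) = -1 := by
    rw [negNormSq_eq_neg_one_iff]; simp
  have := ι_mul_ι_mem_spinGroup h h
  rwa [CliffordAlgebra.ι_sq_scalar, h, map_neg, map_one] at this

theorem exists_spin_extRep [NeZero n] (A : SU n) : ∃ x : Spin n, diracRep n x = extRep n A := by
  obtain ⟨hA, hdet⟩ := mem_specialUnitaryGroup_iff.1 A.2
  obtain ⟨x, hx, z, hz, h⟩ := exists_spin_mapMatrix_smul hA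
  rcases sq_eq_one_iff.1 (hz.trans hdet) with rfl | rfl
  · refine ⟨⟨x, hx⟩, LinearIsometryEquiv.ext fun v => ?_⟩
    rw [one_smul] at h
    exact (LinearMap.congr_fun h v).symm
  · refine ⟨⟨-1 * x, mul_mem neg_one_mem_spinGroup hx⟩, LinearIsometryEquiv.ext fun v => ?_⟩
    rw [diracRep_apply, map_mul, map_neg, map_one, neg_one_mul, ← neg_one_smul ℂ, ← h]
    rfl

/-- The lift of the inclusion `SU(n) ⊂ SO(2n)` to `Spin(2n)`. -/
def suLift (n : ℕ) [NeZero n] : SU n →* Spin n where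
  toFun A := (exists_spin_extRep A).choose
  map_one' := diracRep_injective n (by rw [(exists_spin_extRep 1).choose_spec, map_one, map_one])
  map_mul' A B := diracRep_injective n (by
    rw [(exists_spin_extRep (A * B)).choose_spec, map_mul, map_mul,
      (exists_spin_extRep A).choose_spec, (exists_spin_extRep B).choose_spec])

theorem diracRep_suLift [NeZero n] (A : SU n) : diracRep n (suLift n A) = extRep n A :=
  (exists_spin_extRep A).choose_spec

/-- Each further wedge factor contributes a sum of matrix entries times creation operators. -/
theorem continuous_extRep (n : ℕ) (v : Fock n) : Continuous fun A : SU n => extRep n A v := by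
  induction v using Fock.induction_e with
  | h1 => simpa [extRep_apply] using continuous_const
  | hadd x y hx hy => simp only [map_add]; exact hx.add hy
  | hsmul c x hx => simp only [map_smul]; exact hx.const_smul c
  | he j x hx =>
    have h : ∀ A : SU n, extRep n A (Fock.e j * x)
        = ∑ i, A.1 i j • Fock.creation i (extRep n A x) := by
      intro A
      have h1 := Fock.mapMatrix_ι_mul A.1 (Pi.single j 1) x
      rw [mulVec_single_one, Fock.ι_eq_sum (A.1.col j), Finset.sum_mul] at h1
      simp only [smul_mul_assoc] at h1
      exact h1
    simp only [h]
    refine continuous_finsetSum _ fun i _ => Continuous.fun_smul ?_ ?_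
    · exact (continuous_apply_apply i j).comp continuous_subtype_val
    · exact (LinearMap.continuous_of_finiteDimensional (Fock.creation i)).comp hx

theorem continuous_suLift (n : ℕ) [NeZero n] : Continuous (suLift n) := by
  rw [continuous_spin_iff]
  intro v
  simp only [diracRep_suLift]
  exact continuous_extRep n v

/-! ### The rotations covered by the lift -/

theorem gamma_injective (n : ℕ) : Function.Injective (Fock.gamma n) := by
  intro v w h
  -- A vector is recovered from its action on the vacuum: γ(v)1 = iv.
  have h1 := LinearMap.congr_fun h 1
  rw [Fock.gamma_apply_eq, Fock.gamma_apply_eq, Fock.contract_one, Fock.contract_one, zero_add,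
    zero_add, mul_one, mul_one] at h1
  exact ExteriorAlgebra.ι_leftInverse.injective (smul_right_injective _ Complex.I_ne_zero h1)

theorem ι_negNormSq_injective (n : ℕ) : Function.Injective (ι (negNormSq n)) := by
  intro v w h
  apply gamma_injective n
  rw [← Fock.cliffordAction_ι, ← Fock.cliffordAction_ι, h]

theorem gamma_spinCover (x : Spin n) (v : Fin n → ℂ) (y : Fock n) :
    Fock.gamma n (spinCover x v) (diracRep n x y) = diracRep n x (Fock.gamma n v y) := by
  rw [← Fock.cliffordAction_ι, ι_spinCover, diracRep_apply, diracRep_apply,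
    ← Fock.cliffordAction_ι, ← Module.End.mul_apply, ← Module.End.mul_apply, ← map_mul, ← map_mul,
    mul_assoc, mul_assoc, show ((x⁻¹ : Spin n) : Cliff n) * x = 1 from
      congrArg Subtype.val (inv_mul_cancel x), mul_one]

/-- The wedge part is natural for every matrix. The contraction part needs A to preserve the
Hermitian product, since contraction by v depends on v through its dual. -/
theorem mapMatrix_gamma {A : Matrix (Fin n) (Fin n) ℂ} (hA : A ∈ unitaryGroup (Fin n) ℂ)
    (v : Fin n → ℂ) (y : Fock n) :
    Fock.gamma n (A *ᵥ v) (Fock.mapMatrix A y) = Fock.mapMatrix A (Fock.gamma n v y) := by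
  rw [Fock.gamma_apply, Fock.gamma_apply, map_smul, map_add, Fock.mapMatrix_ι_mul, map_sum]
  congr 2
  simp only [Fock.annihilation_mapMatrix, map_smul, Finset.smul_sum, smul_smul]
  rw [Finset.sum_comm]
  refine Finset.sum_congr rfl fun k _ => ?_
  rw [← Finset.sum_smul]
  congr 1
  have h := star_mulVec_dotProduct_mulVec hA v (Pi.single k 1)
  rw [dotProduct_single_one] at h
  simpa [dotProduct] using h

/-- By `gamma_spinCover` and `mapMatrix_gamma`, Clifford multiplication by either vector is the
conjugate of γ(v) by the same operator ΛA. -/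
theorem spinCover_suLift [NeZero n] (A : SU n) (v : Fin n → ℂ) :
    spinCover (suLift n A) v = A.1 *ᵥ v := by
  refine gamma_injective n (LinearMap.ext fun y => ?_)
  obtain ⟨y, rfl⟩ := (diracRep n (suLift n A)).surjective y
  rw [gamma_spinCover, diracRep_suLift]
  exact (mapMatrix_gamma (mem_specialUnitaryGroup_iff.1 A.2).1 v y).symm

end GUT

namespace GUT

open CliffordAlgebra (ι)
open Fock

variable {m n : ℕ}

/-! ### The homomorphism `Spin(2m) × Spin(2n) → Spin(2(m + n))` -/

theorem inclLeft_add_inclRight (v : Fin m → ℂ) (w : Fin n → ℂ) :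
    inclLeft m n v + inclRight m n w = Fin.append v w := by
  ext i
  refine Fin.addCases ?_ ?_ i <;> simp [inclLeft, inclRight]

theorem negNormSq_append (v : Fin m → ℂ) (w : Fin n → ℂ) :
    negNormSq (m + n) (Fin.append v w) = negNormSq m v + negNormSq n w := by
  simp [negNormSq_apply, Fin.sum_univ_add]
  ring

theorem negNormSq_inclLeft (v : Fin m → ℂ) :
    negNormSq (m + n) (inclLeft m n v) = negNormSq m v := by
  have := negNormSq_append v (0 : Fin n → ℂ)
  rwa [map_zero, add_zero] at this

theorem negNormSq_inclRight (w : Fin n → ℂ) :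
    negNormSq (m + n) (inclRight m n w) = negNormSq n w := by
  have := negNormSq_append (0 : Fin m → ℂ) w
  rwa [map_zero, zero_add] at this

/-- The homomorphism of Clifford algebras induced by the inclusion `ℂᵐ → ℂᵐ⁺ⁿ`. -/
def cliffLeft (m n : ℕ) : Cliff m →ₐ[ℝ] Cliff (m + n) :=
  CliffordAlgebra.map
    { (inclLeft m n).restrictScalars ℝ with map_app' := negNormSq_inclLeft }

/-- The homomorphism of Clifford algebras induced by the inclusion `ℂⁿ → ℂᵐ⁺ⁿ`. -/
def cliffRight (m n : ℕ) : Cliff n →ₐ[ℝ] Cliff (m + n) :=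
  CliffordAlgebra.map
    { (inclRight m n).restrictScalars ℝ with map_app' := negNormSq_inclRight }

theorem cliffLeft_ι (v : Fin m → ℂ) :
    cliffLeft m n (ι _ v) = ι (negNormSq (m + n)) (inclLeft m n v) :=
  CliffordAlgebra.map_apply_ι _ _

theorem cliffRight_ι (w : Fin n → ℂ) :
    cliffRight m n (ι _ w) = ι (negNormSq (m + n)) (inclRight m n w) :=
  CliffordAlgebra.map_apply_ι _ _

theorem cliffLeft_mem_spinGroup {x : Cliff m} (hx : x ∈ spinGroup (negNormSq m)) :
    cliffLeft m n x ∈ spinGroup (negNormSq (m + n)) := by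
  induction hx using spin_induction with
  | one => rw [map_one]; exact one_mem _
  | mul u v hu hv x _ ih =>
    rw [map_mul, map_mul, cliffLeft_ι, cliffLeft_ι]
    exact mul_mem (ι_mul_ι_mem_spinGroup (by rwa [negNormSq_inclLeft])
      (by rwa [negNormSq_inclLeft])) ih

theorem cliffRight_mem_spinGroup {x : Cliff n} (hx : x ∈ spinGroup (negNormSq n)) :
    cliffRight m n x ∈ spinGroup (negNormSq (m + n)) := by
  induction hx using spin_induction with
  | one => rw [map_one]; exact one_mem _
  | mul u v hu hv x _ ih =>
    rw [map_mul, map_mul, cliffRight_ι, cliffRight_ι]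
    exact mul_mem (ι_mul_ι_mem_spinGroup (by rwa [negNormSq_inclRight])
      (by rwa [negNormSq_inclRight])) ih

theorem ι_inclLeft_mul_ι_inclRight (v : Fin m → ℂ) (w : Fin n → ℂ) :
    ι (negNormSq (m + n)) (inclLeft m n v) * ι (negNormSq (m + n)) (inclRight m n w)
      = -(ι (negNormSq (m + n)) (inclRight m n w) * ι (negNormSq (m + n)) (inclLeft m n v)) := by
  refine CliffordAlgebra.ι_mul_ι_comm_of_isOrtho ?_
  rw [QuadraticMap.isOrtho_def, inclLeft_add_inclRight, negNormSq_append, negNormSq_inclLeft,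
    negNormSq_inclRight]

/-- Vectors of the two orthogonal summands anticommute, so a vector of one commutes with a product
of an even number of vectors of the other. -/
theorem commute_ι_inclLeft_cliffRight (v : Fin m → ℂ) {y : Cliff n}
    (hy : y ∈ spinGroup (negNormSq n)) :
    Commute (ι (negNormSq (m + n)) (inclLeft m n v)) (cliffRight m n y) := by
  induction hy using spin_induction with
  | one => rw [map_one]; exact Commute.one_right _
  | mul u w hu hw y _ ih =>
    rw [map_mul, map_mul, cliffRight_ι, cliffRight_ι]
    refine Commute.mul_right ?_ ih
    rw [Commute, SemiconjBy, ← mul_assoc, ι_inclLeft_mul_ι_inclRight, neg_mul, mul_assoc,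
      ι_inclLeft_mul_ι_inclRight, mul_neg, neg_neg, mul_assoc]

theorem commute_ι_inclRight_cliffLeft (w : Fin n → ℂ) {x : Cliff m}
    (hx : x ∈ spinGroup (negNormSq m)) :
    Commute (ι (negNormSq (m + n)) (inclRight m n w)) (cliffLeft m n x) := by
  have h : ∀ v, ι (negNormSq (m + n)) (inclRight m n w) * ι (negNormSq (m + n)) (inclLeft m n v)
      = -(ι (negNormSq (m + n)) (inclLeft m n v) * ι (negNormSq (m + n)) (inclRight m n w)) :=
    fun v => by rw [ι_inclLeft_mul_ι_inclRight, neg_neg]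
  induction hx using spin_induction with
  | one => rw [map_one]; exact Commute.one_right _
  | mul u v hu hv x _ ih =>
    rw [map_mul, map_mul, cliffLeft_ι, cliffLeft_ι]
    refine Commute.mul_right ?_ ih
    rw [Commute, SemiconjBy, ← mul_assoc, h, neg_mul, mul_assoc, h, mul_neg, neg_neg, mul_assoc]

theorem commute_cliffLeft_cliffRight {x : Cliff m} (hx : x ∈ spinGroup (negNormSq m))
    {y : Cliff n} (hy : y ∈ spinGroup (negNormSq n)) :
    Commute (cliffLeft m n x) (cliffRight m n y) := by
  induction hx using spin_induction with
  | one => rw [map_one]; exact Commute.one_left _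
  | mul u v hu hv x _ ih =>
    rw [map_mul, map_mul, cliffLeft_ι, cliffLeft_ι]
    exact ((commute_ι_inclLeft_cliffRight u hy).mul_left
      (commute_ι_inclLeft_cliffRight v hy)).mul_left ih

/-- The lift of the block diagonal inclusion `SO(2m) × SO(2n) → SO(2(m + n))` to spin groups. -/
def spinProd (m n : ℕ) : Spin m × Spin n →* Spin (m + n) where
  toFun p := ⟨cliffLeft m n p.1 * cliffRight m n p.2,
    mul_mem (cliffLeft_mem_spinGroup p.1.2) (cliffRight_mem_spinGroup p.2.2)⟩
  map_one' := Subtype.ext (by simp)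
  map_mul' p q := Subtype.ext (by
    simp only [Prod.fst_mul, Prod.snd_mul, Submonoid.coe_mul, map_mul]
    rw [mul_assoc, mul_assoc, ← mul_assoc (cliffLeft m n q.1),
      commute_cliffLeft_cliffRight q.1.2 p.2.2, mul_assoc])

theorem coe_spinProd (x : Spin m) (y : Spin n) :
    (spinProd m n (x, y) : Cliff (m + n)) = cliffLeft m n x * cliffRight m n y := rfl

theorem coe_spin_mul_inv (x : Spin n) : (x : Cliff n) * ((x⁻¹ : Spin n) : Cliff n) = 1 :=
  congrArg Subtype.val (mul_inv_cancel x)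

theorem spinCover_spinProd (x : Spin m) (y : Spin n) (v : Fin m → ℂ) (w : Fin n → ℂ) :
    spinCover (spinProd m n (x, y)) (Fin.append v w)
      = Fin.append (spinCover x v) (spinCover y w) := by
  apply ι_negNormSq_injective
  have hx : cliffLeft m n x * cliffLeft m n (x⁻¹ : Spin m) = 1 := by
    rw [← map_mul, coe_spin_mul_inv, map_one]
  have hy : cliffRight m n y * cliffRight m n (y⁻¹ : Spin n) = 1 := by
    rw [← map_mul, coe_spin_mul_inv, map_one]
  rw [ι_spinCover, ← map_inv, Prod.inv_mk, coe_spinProd, coe_spinProd, ← inclLeft_add_inclRight,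
    ← inclLeft_add_inclRight, map_add, map_add, ← cliffLeft_ι (spinCover x v), ι_spinCover,
    ← cliffRight_ι (spinCover y w), ι_spinCover, mul_add, add_mul]
  simp only [map_mul, cliffLeft_ι, cliffRight_ι]
  -- On the first summand the factor y moves past v and cancels; on the second the factor x does.
  -- All the commutations involved are those of even elements.
  congr 1
  · rw [mul_assoc (cliffLeft m n x), ← (commute_ι_inclLeft_cliffRight v y.2).eq, mul_assoc,
      mul_assoc, (commute_cliffLeft_cliffRight (x⁻¹).2 (y⁻¹).2).eq,
      ← mul_assoc (cliffRight m n y), hy, one_mul, mul_assoc]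
  · rw [(commute_cliffLeft_cliffRight x.2 y.2).eq, mul_assoc, mul_assoc,
      ← mul_assoc (ι _ _), (commute_ι_inclRight_cliffLeft w (x⁻¹).2).eq,
      ← mul_assoc (cliffLeft m n x), ← mul_assoc (cliffLeft m n x), hx, one_mul, mul_assoc]

/-! ### Spinors of a direct sum -/

namespace Fock

/-- The involution of `Λ ℂⁿ` that is `-1` on odd elements. -/
def parity (n : ℕ) : Fock n →ₗ[ℂ] Fock n := mapMatrix (-1)

theorem parity_ι_mul (v : Fin n → ℂ) (x : Fock n) :
    parity n (ExteriorAlgebra.ι ℂ v * x) = -(ExteriorAlgebra.ι ℂ v * parity n x) := by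
  rw [parity, mapMatrix_ι_mul, Matrix.neg_mulVec, Matrix.one_mulVec, map_neg, neg_mul]

theorem parity_parity (x : Fock n) : parity n (parity n x) = x := by
  rw [parity, ← LinearMap.comp_apply, ← mapMatrix_mul, neg_mul_neg, one_mul, mapMatrix_one,
    LinearMap.id_apply]

theorem parity_one : parity n 1 = 1 := by simp [parity, mapMatrix]

theorem star_inclLeft_dotProduct_inclRight (v : Fin m → ℂ) (w : Fin n → ℂ) :
    star (inclLeft m n v) ⬝ᵥ inclRight m n w = 0 := by
  simp [dotProduct, Fin.sum_univ_add, inclLeft, inclRight]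

theorem star_inclRight_dotProduct_inclLeft (v : Fin m → ℂ) (w : Fin n → ℂ) :
    star (inclRight m n w) ⬝ᵥ inclLeft m n v = 0 := by
  simp [dotProduct, Fin.sum_univ_add, inclLeft, inclRight]

theorem star_inclLeft_dotProduct_inclLeft (v w : Fin m → ℂ) :
    star (inclLeft m n v) ⬝ᵥ inclLeft m n w = star v ⬝ᵥ w := by
  simp [dotProduct, Fin.sum_univ_add, inclLeft]

theorem star_inclRight_dotProduct_inclRight (v w : Fin n → ℂ) :
    star (inclRight m n v) ⬝ᵥ inclRight m n w = star v ⬝ᵥ w := by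
  simp [dotProduct, Fin.sum_univ_add, inclRight]

theorem contract_inclLeft_map_inclRight (v : Fin m → ℂ) (y : Fock n) :
    contract (inclLeft m n v) (ExteriorAlgebra.map (inclRight m n) y) = 0 := by
  induction y using induction_e with
  | h1 => rw [map_one, contract_one]
  | hadd x y hx hy => rw [map_add, map_add, hx, hy, add_zero]
  | hsmul c x hx => rw [map_smul, map_smul, hx, smul_zero]
  | he j x hx =>
    rw [map_mul, e, ExteriorAlgebra.map_apply_ι, contract_ι_mul, hx,
      star_inclLeft_dotProduct_inclRight, zero_smul, mul_zero, sub_zero]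

theorem gamma_inclLeft_mul (v : Fin m → ℂ) (x : Fock m) (y : Fock n) :
    gamma (m + n) (inclLeft m n v)
        (ExteriorAlgebra.map (inclLeft m n) x * ExteriorAlgebra.map (inclRight m n) y)
      = ExteriorAlgebra.map (inclLeft m n) (gamma m v x)
        * ExteriorAlgebra.map (inclRight m n) y := by
  have h : contract (inclLeft m n v)
        (ExteriorAlgebra.map (inclLeft m n) x * ExteriorAlgebra.map (inclRight m n) y)
      = ExteriorAlgebra.map (inclLeft m n) (contract v x)
        * ExteriorAlgebra.map (inclRight m n) y := by
    induction x using induction_e with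
    | h1 => rw [map_one, one_mul, contract_inclLeft_map_inclRight, contract_one, map_zero, zero_mul]
    | hadd x y hx hy => simp only [map_add, add_mul, hx, hy]
    | hsmul c x hx => simp only [map_smul, smul_mul_assoc, hx]
    | he j x hx =>
      rw [map_mul (ExteriorAlgebra.map _), e, ExteriorAlgebra.map_apply_ι, mul_assoc,
        contract_ι_mul, hx, contract_ι_mul,
        star_inclLeft_dotProduct_inclLeft, map_sub, map_smul, map_mul, ExteriorAlgebra.map_apply_ι,
        sub_mul, smul_mul_assoc, mul_assoc]
  rw [gamma_apply_eq, gamma_apply_eq, h, map_smul, map_add, map_mul, ExteriorAlgebra.map_apply_ι,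
    smul_mul_assoc, add_mul, mul_assoc]

theorem gamma_inclRight_map (w : Fin n → ℂ) (y : Fock n) :
    gamma (m + n) (inclRight m n w) (ExteriorAlgebra.map (inclRight m n) y)
      = ExteriorAlgebra.map (inclRight m n) (gamma n w y) := by
  have h : contract (inclRight m n w) (ExteriorAlgebra.map (inclRight m n) y)
      = ExteriorAlgebra.map (inclRight m n) (contract w y) := by
    induction y using induction_e with
    | h1 => rw [map_one, contract_one, contract_one, map_zero]
    | hadd x y hx hy => simp only [map_add, hx, hy]
    | hsmul c x hx => simp only [map_smul, hx]
    | he j x hx =>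
      rw [map_mul, e, ExteriorAlgebra.map_apply_ι, contract_ι_mul, hx, contract_ι_mul,
        star_inclRight_dotProduct_inclRight, map_sub, map_smul, map_mul,
        ExteriorAlgebra.map_apply_ι]
  rw [gamma_apply_eq, gamma_apply_eq, h, map_smul, map_add, map_mul, ExteriorAlgebra.map_apply_ι]

/-- Both the wedge with w and the contraction by w change sign each time they pass a vector of the
first summand; `parity` collects these signs. -/
theorem gamma_inclRight_mul (w : Fin n → ℂ) (x : Fock m) (y : Fock n) :
    gamma (m + n) (inclRight m n w)
        (ExteriorAlgebra.map (inclLeft m n) x * ExteriorAlgebra.map (inclRight m n) y)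
      = ExteriorAlgebra.map (inclLeft m n) (parity m x)
        * ExteriorAlgebra.map (inclRight m n) (gamma n w y) := by
  induction x using induction_e with
  | h1 => rw [parity_one, map_one, one_mul, one_mul, gamma_inclRight_map]
  | hadd x y hx hy => simp only [map_add, add_mul, hx, hy]
  | hsmul c x hx => simp only [map_smul, smul_mul_assoc, hx]
  | he j x hx =>
    rw [map_mul (ExteriorAlgebra.map _), e, ExteriorAlgebra.map_apply_ι, mul_assoc, parity_ι_mul,
      map_neg, map_mul (ExteriorAlgebra.map _),
      ExteriorAlgebra.map_apply_ι, neg_mul, mul_assoc, ← hx, gamma_apply_eq, gamma_apply_eq,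
      contract_ι_mul, star_inclRight_dotProduct_inclLeft, zero_smul, zero_sub, mul_smul_comm,
      ι_mul_ι_mul_comm, mul_add, ← neg_add, smul_neg]

theorem cliffordAction_cliffLeft {x : Cliff m} (hx : x ∈ spinGroup (negNormSq m))
    (a : Fock m) (b : Fock n) :
    cliffordAction (m + n) (cliffLeft m n x)
        (ExteriorAlgebra.map (inclLeft m n) a * ExteriorAlgebra.map (inclRight m n) b)
      = ExteriorAlgebra.map (inclLeft m n) (cliffordAction m x a)
        * ExteriorAlgebra.map (inclRight m n) b := by
  induction hx using spin_induction with
  | one => simp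
  | mul u v hu hv x _ ih =>
    simp only [map_mul, cliffLeft_ι, Module.End.mul_apply, cliffordAction_ι]
    rw [ih, gamma_inclLeft_mul, gamma_inclLeft_mul]

/-- The parity operators come in pairs and cancel, because an element of the spin group is a product
of pairs of vectors. -/
theorem cliffordAction_cliffRight {y : Cliff n} (hy : y ∈ spinGroup (negNormSq n))
    (a : Fock m) (b : Fock n) :
    cliffordAction (m + n) (cliffRight m n y)
        (ExteriorAlgebra.map (inclLeft m n) a * ExteriorAlgebra.map (inclRight m n) b)
      = ExteriorAlgebra.map (inclLeft m n) a
        * ExteriorAlgebra.map (inclRight m n) (cliffordAction n y b) := by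
  induction hy using spin_induction with
  | one => simp
  | mul u v hu hv y _ ih =>
    simp only [map_mul, cliffRight_ι, Module.End.mul_apply, cliffordAction_ι]
    rw [ih, gamma_inclRight_mul, gamma_inclRight_mul, parity_parity]

end Fock

theorem diracRep_spinProd_wedge (x : Spin m) (y : Spin n) (t : Fock m ⊗[ℂ] Fock n) :
    diracRep (m + n) (spinProd m n (x, y)) (wedge m n t)
      = wedge m n (diracTensorRep m n (x, y) t) := by
  induction t using TensorProduct.induction_on with
  | zero => simp
  | add s t hs ht => simp only [map_add, hs, ht]
  | tmul a b =>
    rw [diracTensorRep_tmul, wedge_tmul, wedge_tmul, diracRep_apply, coe_spinProd,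
      map_mul (cliffordAction _),
      Module.End.mul_apply, cliffordAction_cliffRight y.2, cliffordAction_cliffLeft x.2]
    rfl

theorem diracRep_spinProd (p : Spin m × Spin n) :
    diracRep (m + n) (spinProd m n p) = U.map (wedge m n) (diracTensorRep m n p) := by
  refine LinearIsometryEquiv.ext fun v => ?_
  obtain ⟨t, rfl⟩ := (wedge m n).surjective v
  rw [diracRep_spinProd_wedge]
  simp [U.map]

theorem continuous_diracRep (v : Fock n) : Continuous fun x : Spin n => diracRep n x v :=
  continuous_spin_iff.1 continuous_id v

theorem continuous_spinProd (m n : ℕ) : Continuous (spinProd m n) := by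
  rw [continuous_spin_iff]
  intro v
  obtain ⟨t, rfl⟩ := (wedge m n).surjective v
  simp only [Prod.mk.eta ▸ diracRep_spinProd_wedge (m := m) (n := n) _ _ _]
  refine (wedge m n).continuous.comp ?_
  induction t using TensorProduct.induction_on with
  | zero => simpa using continuous_const
  | add s t hs ht => simp only [map_add]; exact hs.add ht
  | tmul a b =>
    -- Expanding the first tensor factor in the basis leaves a finite sum of continuous scalars
    -- times linear images of the second factor, so joint continuity follows.
    have h : ∀ p : Spin m × Spin n, diracTensorRep m n p (a ⊗ₜ b) =
        ∑ S, (basis m).repr (diracRep m p.1 a) S •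
          TensorProduct.mk ℂ (Fock m) (Fock n) (basis m S) (diracRep n p.2 b) := by
      rintro ⟨x, y⟩
      rw [diracTensorRep_tmul]
      conv_lhs => rw [← (basis m).sum_repr (diracRep m x a), TensorProduct.sum_tmul]
      simp [TensorProduct.smul_tmul']
    simp only [h]
    refine continuous_finsetSum _ fun S _ => Continuous.fun_smul ?_ ?_
    · exact (LinearMap.continuous_of_finiteDimensional ((basis m).coord S)).comp
        ((continuous_diracRep a).comp continuous_fst)
    · exact (LinearMap.continuous_of_finiteDimensional _).comp
        ((continuous_diracRep b).comp continuous_snd)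

end GUT

namespace GUT

open CliffordAlgebra (ι)
open Matrix Fock

/-! ### Operators given by matrices -/

section ActsBy

variable {V W X : Type} [AddCommGroup V] [Module ℂ V] [AddCommGroup W] [Module ℂ W]
  [AddCommGroup X] [Module ℂ X] {k : ℕ}

/-- The linear map `T` has the matrix `A` with respect to the families `b` and `c`. -/
def ActsBy (T : V →ₗ[ℂ] W) (b : Fin k → V) (c : Fin k → W) (A : Matrix (Fin k) (Fin k) ℂ) : Prop :=
  ∀ j, T (b j) = ∑ i, A i j • c i

theorem ActsBy.comp {S : W →ₗ[ℂ] X} {T : V →ₗ[ℂ] W} {b : Fin k → V} {c : Fin k → W}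
    {d : Fin k → X} {A B : Matrix (Fin k) (Fin k) ℂ} (hS : ActsBy S c d B) (hT : ActsBy T b c A) :
    ActsBy (S ∘ₗ T) b d (B * A) := by
  intro j
  rw [LinearMap.comp_apply, hT j, map_sum]
  simp only [map_smul, hS _, Finset.smul_sum, smul_smul, mul_apply, Finset.sum_smul]
  rw [Finset.sum_comm]
  exact Finset.sum_congr rfl fun i _ => Finset.sum_congr rfl fun l _ => by rw [mul_comm]

theorem ActsBy.mul {S T : Module.End ℂ V} {b c d : Fin k → V} {A B : Matrix (Fin k) (Fin k) ℂ}
    (hS : ActsBy S c d B) (hT : ActsBy T b c A) : ActsBy (S * T) b d (B * A) :=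
  hS.comp hT

theorem ActsBy.id (b : Fin k → V) : ActsBy LinearMap.id b b 1 := by
  intro j
  simp [one_apply]

theorem ActsBy.neg {T : V →ₗ[ℂ] W} {b : Fin k → V} {c : Fin k → W}
    {A : Matrix (Fin k) (Fin k) ℂ} (h : ActsBy T b c A) : ActsBy (-T) b c (-A) := by
  intro j
  simp [h j]

/-- Inner products with the orthonormal target family give the matrix entries. -/
theorem ActsBy.unique {V W : Type} [AddCommGroup V] [Module ℂ V] [NormedAddCommGroup W]
    [InnerProductSpace ℂ W] {T : V →ₗ[ℂ] W} {b : Fin k → V} {c : Fin k → W}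
    {A B : Matrix (Fin k) (Fin k) ℂ} (hc : Orthonormal ℂ c)
    (hA : ActsBy T b c A) (hB : ActsBy T b c B) : A = B := by
  ext i j
  rw [← hc.inner_right_fintype (fun i => A i j) i, ← hA j, hB j, hc.inner_right_fintype]

end ActsBy

/-! ### Bases of spinors -/

/-- The basis `g ∧ b, b ∧ r, r ∧ g, -1` of `Λ^ev ℂ³`. -/
def anticolor4 : Fin 4 → Fock 3 := ![e 1 * e 2, e 2 * e 0, e 0 * e 1, -1]

theorem orthonormal_isospin : Orthonormal ℂ (Sum.elim isospinL isospinR) := by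
  let l : Fin 2 ⊕ Fin 2 → List (Fin 2) := Sum.elim ![[0], [1]] ![[0, 1], []]
  have hl : ∀ i, (l i).Pairwise (· < ·) := by decide
  have hinj : Function.Injective fun i => (l i).toFinset := by decide
  refine orthonormal_of_eq_smul (orthonormal_basis 2) hinj fun i => Or.inl ?_
  rw [basis_toFinset _ (hl i)]
  rcases i with i | i <;> fin_cases i <;> simp [l, isospinL, isospinR]

/-- Up to sign these are the standard basis vectors, for distinct index sets; the signs come from b
∧ r and from -1. -/
theorem orthonormal_color : Orthonormal ℂ (Sum.elim color4 anticolor4) := by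
  let l : Fin 4 ⊕ Fin 4 → List (Fin 3) :=
    Sum.elim ![[0], [1], [2], [0, 1, 2]] ![[1, 2], [0, 2], [0, 1], []]
  have hl : ∀ i, (l i).Pairwise (· < ·) := by decide
  have hinj : Function.Injective fun i => (l i).toFinset := by decide
  refine orthonormal_of_eq_smul (orthonormal_basis 3) hinj fun i => ?_
  rw [basis_toFinset _ (hl i)]
  rcases i with i | i <;> fin_cases i <;>
    simp [l, color4, anticolor4, mul_assoc, e_mul_e (2 : Fin 3) 0]

theorem orthonormal_isospinL : Orthonormal ℂ isospinL := by
  have := orthonormal_isospin.comp _ Sum.inl_injective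
  rwa [Sum.elim_comp_inl] at this

theorem orthonormal_isospinR : Orthonormal ℂ isospinR := by
  have := orthonormal_isospin.comp _ Sum.inr_injective
  rwa [Sum.elim_comp_inr] at this

theorem orthonormal_color4 : Orthonormal ℂ color4 := by
  have := orthonormal_color.comp _ Sum.inl_injective
  rwa [Sum.elim_comp_inl] at this

theorem linearMap_ext_of_orthonormal {ι V W : Type} [Fintype ι] [NormedAddCommGroup V]
    [InnerProductSpace ℂ V] [FiniteDimensional ℂ V] [AddCommGroup W] [Module ℂ W] {b : ι → V}
    (hb : Orthonormal ℂ b) (hcard : Fintype.card ι = Module.finrank ℂ V) {S T : V →ₗ[ℂ] W}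
    (h : ∀ i, S (b i) = T (b i)) : S = T := by
  have hspan := hb.linearIndependent.span_eq_top_of_card_eq_finrank' hcard
  exact LinearMap.ext_on_range hspan h

theorem ext_isospin {W : Type} [AddCommGroup W] [Module ℂ W] {S T : Fock 2 →ₗ[ℂ] W}
    (hL : ∀ i, S (isospinL i) = T (isospinL i)) (hR : ∀ i, S (isospinR i) = T (isospinR i)) :
    S = T :=
  linearMap_ext_of_orthonormal orthonormal_isospin (by rw [Fock.finrank]; rfl)
    (Sum.rec hL hR)

theorem ext_color {W : Type} [AddCommGroup W] [Module ℂ W] {S T : Fock 3 →ₗ[ℂ] W}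
    (h : ∀ i, S (color4 i) = T (color4 i)) (h' : ∀ i, S (anticolor4 i) = T (anticolor4 i)) :
    S = T :=
  linearMap_ext_of_orthonormal orthonormal_color (by rw [Fock.finrank]; rfl)
    (Sum.rec h h')

/-! ### The spinors of `Spin(4)` -/

/-- The matrix of `γ(v) : Λ^odd ℂ² → Λ^ev ℂ²`. -/
def gammaL (v : Fin 2 → ℂ) : Matrix (Fin 2) (Fin 2) ℂ :=
  Complex.I • !![-v 1, v 0; conj (v 0), conj (v 1)]

/-- The matrix of `γ(v) : Λ^ev ℂ² → Λ^odd ℂ²`. -/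
def gammaR (v : Fin 2 → ℂ) : Matrix (Fin 2) (Fin 2) ℂ :=
  Complex.I • !![-conj (v 1), v 0; conj (v 0), v 1]

theorem annihilation_e {n : ℕ} (j k : Fin n) :
    annihilation j (e k) = if j = k then 1 else 0 := by
  have := annihilation_e_mul j k 1
  rwa [mul_one, annihilation_one, mul_zero, sub_zero] at this

theorem actsBy_gammaL (v : Fin 2 → ℂ) : ActsBy (gamma 2 v) isospinL isospinR (gammaL v) := by
  intro j
  fin_cases j <;>
    simp [gamma_apply, isospinL, isospinR, gammaL, Fin.sum_univ_succ, ι_eq_sum, add_mul,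
      annihilation_e, e_mul_self, e_mul_e (1 : Fin 2) 0] <;>
    module

theorem actsBy_gammaR (v : Fin 2 → ℂ) : ActsBy (gamma 2 v) isospinR isospinL (gammaR v) := by
  intro j
  have h : (e 0 * (e 0 * e 1) : Fock 2) = 0 := by rw [← mul_assoc, e_mul_self, zero_mul]
  have h' : (e 1 * (e 0 * e 1) : Fock 2) = 0 := by
    rw [e_mul_e 0, mul_neg, ← mul_assoc, e_mul_self, zero_mul, neg_zero]
  fin_cases j <;>
    simp [gamma_apply, isospinL, isospinR, gammaR, Fin.sum_univ_succ, ι_eq_sum, add_mul,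
      annihilation_e, annihilation_e_mul, annihilation_one, h, h'] <;>
    module

theorem I_smul_mem_unitaryGroup {k : ℕ} {A : Matrix (Fin k) (Fin k) ℂ}
    (hA : A ∈ unitaryGroup (Fin k) ℂ) : Complex.I • A ∈ unitaryGroup (Fin k) ℂ := by
  rw [mem_unitaryGroup_iff] at hA ⊢
  rw [star_smul, smul_mul_smul_comm, hA]
  simp

theorem dotProduct_two {v : Fin 2 → ℂ} (hv : negNormSq 2 v = -1) :
    conj (v 0) * v 0 + conj (v 1) * v 1 = 1 := by
  have := (negNormSq_eq_neg_one_iff v).1 hv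
  simpa [dotProduct, Fin.sum_univ_succ] using this

theorem gammaL_mem {v : Fin 2 → ℂ} (hv : negNormSq 2 v = -1) :
    gammaL v ∈ specialUnitaryGroup (Fin 2) ℂ := by
  have h := dotProduct_two hv
  refine mem_specialUnitaryGroup_iff.2 ⟨I_smul_mem_unitaryGroup (mem_unitaryGroup_iff'.2 ?_), ?_⟩
  · ext i j
    fin_cases i <;> fin_cases j <;> simp [mul_apply, Fin.sum_univ_succ] <;>
      first | linear_combination h | ring
  · rw [gammaL, det_smul, det_fin_two]
    simp
    linear_combination h

theorem gammaR_mem {v : Fin 2 → ℂ} (hv : negNormSq 2 v = -1) :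
    gammaR v ∈ specialUnitaryGroup (Fin 2) ℂ := by
  have h := dotProduct_two hv
  refine mem_specialUnitaryGroup_iff.2 ⟨I_smul_mem_unitaryGroup (mem_unitaryGroup_iff'.2 ?_), ?_⟩
  · ext i j
    fin_cases i <;> fin_cases j <;> simp [mul_apply, Fin.sum_univ_succ] <;>
      first | linear_combination h | ring
  · rw [gammaR, det_smul, det_fin_two]
    simp
    linear_combination h

/-- The group `Spin(4)` acts on odd and even spinors by matrices in `SU(2)`. -/
theorem exists_actsBy_isospin {x : Cliff 2} (hx : x ∈ spinGroup (negNormSq 2)) :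
    ∃ a b : SU 2, ActsBy (cliffordAction 2 x) isospinL isospinL a.1 ∧
      ActsBy (cliffordAction 2 x) isospinR isospinR b.1 := by
  induction hx using spin_induction with
  | one =>
    rw [map_one]
    exact ⟨1, 1, ActsBy.id _, ActsBy.id _⟩
  | mul u v hu hv x hx ih =>
    obtain ⟨a, b, ha, hb⟩ := ih
    rw [map_mul, map_mul, cliffordAction_ι, cliffordAction_ι]
    -- Each vector exchanges odd and even spinors, so the product of u and v uses one matrix of each
    -- kind, in opposite orders on the two half-spinor spaces.
    refine ⟨⟨_, gammaR_mem hu⟩ * ⟨_, gammaL_mem hv⟩ * a, ⟨_, gammaL_mem hu⟩ * ⟨_, gammaR_mem hv⟩ * b,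
      ?_, ?_⟩ <;> simp only [Submonoid.coe_mul]
    · exact ((actsBy_gammaR u).mul (actsBy_gammaL v)).mul ha
    · exact ((actsBy_gammaL u).mul (actsBy_gammaR v)).mul hb

/-! ### The spinors of `Spin(6)` -/

/-- The matrix of `γ(v) : Λ^odd ℂ³ → Λ^ev ℂ³`. -/
def gammaC (v : Fin 3 → ℂ) : Matrix (Fin 4) (Fin 4) ℂ :=
  Complex.I • !![0, -v 2, v 1, conj (v 0); v 2, 0, -v 0, conj (v 1); -v 1, v 0, 0, conj (v 2);
    -conj (v 0), -conj (v 1), -conj (v 2), 0]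

theorem actsBy_gammaC (v : Fin 3 → ℂ) : ActsBy (gamma 3 v) color4 anticolor4 (gammaC v) := by
  intro j
  have h00 : (e 0 * (e 0 * (e 1 * e 2)) : Fock 3) = 0 := by rw [← mul_assoc, e_mul_self, zero_mul]
  have h1 : (e 1 * (e 0 * (e 1 * e 2)) : Fock 3) = 0 := by
    rw [← mul_assoc, e_mul_e 1 0, neg_mul, mul_assoc, ← mul_assoc (e 1) (e 1), e_mul_self, zero_mul,
      mul_zero, neg_zero]
  have h2 : (e 2 * (e 0 * (e 1 * e 2)) : Fock 3) = 0 := by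
    rw [e_mul_e 1 2, mul_neg, ← mul_assoc (e 0), e_mul_e 0 2, neg_mul, mul_assoc, neg_neg,
      ← mul_assoc, e_mul_self, zero_mul]
  fin_cases j <;>
    simp [gamma_apply, color4, anticolor4, gammaC, Fin.sum_univ_succ, ι_eq_sum, add_mul, mul_assoc,
      annihilation_e, annihilation_e_mul, e_mul_self, e_mul_e (1 : Fin 3) 0, e_mul_e (2 : Fin 3) 0,
      e_mul_e (2 : Fin 3) 1, h00, h1, h2] <;>
    module

/-- The sign of the last vector -1 of `anticolor4` is chosen to make this matrix exactly the
conjugate of the one from odd to even spinors. -/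
theorem actsBy_gammaC_conj (v : Fin 3 → ℂ) :
    ActsBy (gamma 3 v) anticolor4 color4 ((gammaC v).map conj) := by
  intro j
  have hz : ∀ i k : Fin 3, (e i * (e i * e k) : Fock 3) = 0 := fun i k => by
    rw [← mul_assoc, e_mul_self, zero_mul]
  have hz' : ∀ i k : Fin 3, (e k * (e i * e k) : Fock 3) = 0 := fun i k => by
    rw [e_mul_e i, mul_neg, hz, neg_zero]
  have h102 : (e 1 * (e 0 * e 2) : Fock 3) = -(e 0 * (e 1 * e 2)) := by
    rw [← mul_assoc, e_mul_e 1 0, neg_mul, mul_assoc]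
  have h201 : (e 2 * (e 0 * e 1) : Fock 3) = e 0 * (e 1 * e 2) := by
    rw [← mul_assoc, e_mul_e 2 0, neg_mul, mul_assoc, e_mul_e 2 1, mul_neg, neg_neg]
  fin_cases j <;>
    simp [gamma_apply, color4, anticolor4, gammaC, Fin.sum_univ_succ, ι_eq_sum, add_mul, mul_assoc,
      annihilation_e, annihilation_e_mul, annihilation_one, e_mul_e (2 : Fin 3) 0, h102, h201, hz,
      hz'] <;>
    module

theorem dotProduct_three {v : Fin 3 → ℂ} (hv : negNormSq 3 v = -1) :
    conj (v 0) * v 0 + conj (v 1) * v 1 + conj (v 2) * v 2 = 1 := by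
  have := (negNormSq_eq_neg_one_iff v).1 hv
  simpa [dotProduct, Fin.sum_univ_succ, add_assoc] using this

theorem gammaC_mem {v : Fin 3 → ℂ} (hv : negNormSq 3 v = -1) :
    gammaC v ∈ specialUnitaryGroup (Fin 4) ℂ := by
  have h := dotProduct_three hv
  refine mem_specialUnitaryGroup_iff.2 ⟨I_smul_mem_unitaryGroup (mem_unitaryGroup_iff'.2 ?_), ?_⟩
  · ext i j
    fin_cases i <;> fin_cases j <;> simp [mul_apply, Fin.sum_univ_succ] <;>
      first | linear_combination h | ring
  · rw [gammaC, det_smul, det_succ_row_zero]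
    simp [Fin.sum_univ_succ, det_fin_three, Fin.succAbove, submatrix_apply]
    -- The matrix is antisymmetric and its determinant is |v|⁴; the coefficient comes from |v|⁴ - 1
    -- = (|v|² + 1)(|v|² - 1).
    linear_combination (conj (v 0) * v 0 + conj (v 1) * v 1 + conj (v 2) * v 2 + 1) * h

theorem conj_mem {k : ℕ} {A : Matrix (Fin k) (Fin k) ℂ}
    (hA : A ∈ specialUnitaryGroup (Fin k) ℂ) : A.map conj ∈ specialUnitaryGroup (Fin k) ℂ := by
  obtain ⟨h1, h2⟩ := mem_specialUnitaryGroup_iff.1 hA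
  rw [mem_specialUnitaryGroup_iff, mem_unitaryGroup_iff]
  rw [mem_unitaryGroup_iff] at h1
  constructor
  · have h3 : star (A.map conj) = (star A).map conj := by
      ext i j; simp
    have h4 := congrArg (fun M : Matrix (Fin k) (Fin k) ℂ => M.map (starRingEnd ℂ)) h1
    simp only [Matrix.map_mul] at h4
    rw [h3, h4]
    ext i j; simp [one_apply, apply_ite]
  · have := RingHom.map_det (starRingEnd ℂ) A
    rw [h2, map_one] at this
    exact this.symm

/-- The group `Spin(6)` acts on odd spinors by matrices in `SU(4)`, and on even spinors by the
complex conjugate matrices. -/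
theorem exists_actsBy_color {x : Cliff 3} (hx : x ∈ spinGroup (negNormSq 3)) :
    ∃ c : SU 4, ActsBy (cliffordAction 3 x) color4 color4 c.1 ∧
      ActsBy (cliffordAction 3 x) anticolor4 anticolor4 (c.1.map conj) := by
  induction hx using spin_induction with
  | one =>
    rw [map_one]
    refine ⟨1, ActsBy.id _, ?_⟩
    rw [OneMemClass.coe_one, Matrix.map_one _ (map_zero _) (map_one _)]
    exact ActsBy.id _
  | mul u v hu hv x hx ih =>
    obtain ⟨c, hc, hc'⟩ := ih
    rw [map_mul, map_mul, cliffordAction_ι, cliffordAction_ι]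
    refine ⟨⟨_, conj_mem (gammaC_mem hu)⟩ * ⟨_, gammaC_mem hv⟩ * c, ?_, ?_⟩ <;>
      simp only [Submonoid.coe_mul, Matrix.map_mul, Matrix.map_map]
    · exact ((actsBy_gammaC_conj u).mul (actsBy_gammaC v)).mul hc
    · have h : (gammaC u).map (conj ∘ conj) = gammaC u := by ext i j; simp
      rw [h]
      exact ((actsBy_gammaC u).mul (actsBy_gammaC_conj v)).mul hc'

end GUT

namespace GUT

open CliffordAlgebra (ι)
open Matrix Fock

/-! ### Realizing matrices by elements of the spin groups -/

theorem extRep_mul {n : ℕ} (A : SU n) (x y : Fock n) :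
    extRep n A (x * y) = extRep n A x * extRep n A y := by
  simp only [extRep_apply, map_mul]

theorem extRep_one {n : ℕ} (A : SU n) : extRep n A 1 = 1 := by
  rw [extRep_apply, map_one]

theorem extRep_e {n : ℕ} (A : SU n) (j : Fin n) : extRep n A (e j) = ∑ i, A.1 i j • e i := by
  rw [extRep_apply, e, ExteriorAlgebra.map_apply_ι, mulVecLin_apply, mulVec_single_one, ι_eq_sum]
  rfl

theorem extRep_two_top (A : SU 2) : extRep 2 A (e 0 * e 1) = e 0 * e 1 := by
  have hdet := (mem_specialUnitaryGroup_iff.1 A.2).2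
  rw [det_fin_two] at hdet
  simp only [extRep_mul, extRep_e, Fin.sum_univ_two, mul_add, add_mul, smul_mul_smul_comm,
    e_mul_self, e_mul_e (1 : Fin 2) 0]
  refine Eq.trans ?_ ((congrArg (· • (e 0 * e 1 : Fock 2)) hdet).trans (one_smul ℂ _))
  module

theorem extRep_three_top (A : SU 3) : extRep 3 A (e 0 * e 1 * e 2) = e 0 * e 1 * e 2 := by
  have hdet := (mem_specialUnitaryGroup_iff.1 A.2).2
  rw [det_fin_three] at hdet
  have hz : ∀ i k : Fin 3, (e i * (e i * e k) : Fock 3) = 0 := fun i k => by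
    rw [← mul_assoc, e_mul_self, zero_mul]
  have hz' : ∀ i k : Fin 3, (e k * (e i * e k) : Fock 3) = 0 := fun i k => by
    rw [e_mul_e i, mul_neg, hz, neg_zero]
  have h102 : (e 1 * (e 0 * e 2) : Fock 3) = -(e 0 * (e 1 * e 2)) := by
    rw [← mul_assoc, e_mul_e 1 0, neg_mul, mul_assoc]
  have h201 : (e 2 * (e 0 * e 1) : Fock 3) = e 0 * (e 1 * e 2) := by
    rw [← mul_assoc, e_mul_e 2 0, neg_mul, mul_assoc, e_mul_e 2 1, mul_neg, neg_neg]
  simp only [extRep_mul, extRep_e, Fin.sum_univ_three, mul_add, add_mul, smul_mul_smul_comm,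
    mul_assoc, e_mul_self, e_mul_e (1 : Fin 3) 0, e_mul_e (2 : Fin 3) 0, e_mul_e (2 : Fin 3) 1,
    mul_neg, hz, hz', h102, h201, mul_zero]
  refine Eq.trans ?_ ((congrArg (· • (e 0 * (e 1 * e 2) : Fock 3)) hdet).trans (one_smul ℂ _))
  module

theorem actsBy_suLift_isospinL (A : SU 2) :
    ActsBy (cliffordAction 2 (suLift 2 A)) isospinL isospinL A.1 := by
  refine Fin.forall_fin_two.2 ⟨?_, ?_⟩ <;> rw [← diracRep_apply, diracRep_suLift] <;>
    simp [isospinL, extRep_e, Fin.sum_univ_two]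

/-- Even spinors are Λ⁰ and Λ², and det A = 1 acts on the latter. Hence the lift of SU(2) realizes
the pairs (A, 1). -/
theorem actsBy_suLift_isospinR (A : SU 2) :
    ActsBy (cliffordAction 2 (suLift 2 A)) isospinR isospinR 1 := by
  refine Fin.forall_fin_two.2 ⟨?_, ?_⟩ <;> rw [← diracRep_apply, diracRep_suLift] <;>
    simp [isospinR, extRep_one, extRep_two_top, Fin.sum_univ_two]

/-- The conditions say that B = diag(A, 1): the lift of SU(3) acts by A on Λ¹ and fixes w, since det
A = 1. -/
theorem actsBy_suLift_color4 (A : SU 3) {B : Matrix (Fin 4) (Fin 4) ℂ}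
    (hA : ∀ i j : Fin 3, B i.castSucc j.castSucc = A.1 i j)
    (hl : ∀ i : Fin 3, B i.castSucc 3 = 0) (hr : ∀ i : Fin 3, B 3 i.castSucc = 0)
    (h33 : B 3 3 = 1) :
    ActsBy (cliffordAction 3 (suLift 3 A)) color4 color4 B := by
  have hcol : ∀ i : Fin 3, color4 i.castSucc = e i := by
    intro i; fin_cases i <;> rfl
  intro j
  rw [← diracRep_apply, diracRep_suLift, Fin.sum_univ_castSucc]
  refine Fin.lastCases ?_ (fun j => ?_) j
  · simp only [Fin.reduceLast, hl, h33, zero_smul, Finset.sum_const_zero, zero_add, one_smul]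
    exact extRep_three_top A
  · simp only [Fin.reduceLast, hcol, hA, hr, zero_smul, add_zero]
    exact extRep_e A j

theorem ι_mul_mul_ι_mem_spinGroup {n : ℕ} {u v : Fin n → ℂ} (hu : negNormSq n u = -1)
    (hv : negNormSq n v = -1) {x : Cliff n} (hx : x ∈ spinGroup (negNormSq n)) :
    ι (negNormSq n) u * x * ι (negNormSq n) v ∈ spinGroup (negNormSq n) := by
  refine ⟨mul_mem (mul_mem (ι_mem_pinGroup hu) hx.1) (ι_mem_pinGroup hv), ?_⟩
  have h1 := SetLike.mul_mem_graded (A := CliffordAlgebra.evenOdd (negNormSq n))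
    (CliffordAlgebra.ι_mem_evenOdd_one (negNormSq n) u) hx.2
  have h2 := SetLike.mul_mem_graded (A := CliffordAlgebra.evenOdd (negNormSq n)) h1
    (CliffordAlgebra.ι_mem_evenOdd_one (negNormSq n) v)
  rwa [show (1 + 0 + 1 : ZMod 2) = 0 from rfl] at h2

/-- The lift of a realizes (a, 1). Conjugation by a unit vector exchanges odd and even spinors and
so turns the lift of b into a realization of (1, b). -/
theorem exists_spin_isospin (a b : SU 2) : ∃ x : Spin 2,
    ActsBy (cliffordAction 2 x) isospinL isospinL a.1 ∧
      ActsBy (cliffordAction 2 x) isospinR isospinR b.1 := by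
  -- Clifford multiplication by this unit vector is π_d, which sends u, d to u ∧ d, 1, so its matrix
  -- from odd to even spinors is the identity. Its inverse is -p.
  set p : Fin 2 → ℂ := Pi.single 1 Complex.I with hp
  have hpu : negNormSq 2 p = -1 := by
    rw [negNormSq_eq_neg_one_iff]; simp [p]
  have hpu' : negNormSq 2 (-p) = -1 := by rwa [QuadraticMap.map_neg]
  have hL : ActsBy (gamma 2 p) isospinL isospinR 1 := by
    convert actsBy_gammaL p
    ext i j
    fin_cases i <;> fin_cases j <;> simp [gammaL, p]
  have hR : ActsBy (gamma 2 p) isospinR isospinL (-1) := by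
    convert actsBy_gammaR p
    ext i j
    fin_cases i <;> fin_cases j <;> simp [gammaR, p]
  have hL' : ActsBy (gamma 2 (-p)) isospinL isospinR (-1) := by rw [map_neg]; exact hL.neg
  have hR' : ActsBy (gamma 2 (-p)) isospinR isospinL 1 := by
    rw [map_neg]; simpa using hR.neg
  refine ⟨⟨(suLift 2 a : Cliff 2)
      * (ι (negNormSq 2) p * (suLift 2 b : Cliff 2) * ι (negNormSq 2) (-p)),
    mul_mem (suLift 2 a).2 (ι_mul_mul_ι_mem_spinGroup hpu hpu' (suLift 2 b).2)⟩, ?_, ?_⟩ <;>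
    rw [map_mul, map_mul, map_mul, cliffordAction_ι, cliffordAction_ι]
  · have := (actsBy_suLift_isospinL a).mul ((hR.mul (actsBy_suLift_isospinR b)).mul hL')
    rwa [mul_one, neg_mul_neg, one_mul, mul_one] at this
  · have := (actsBy_suLift_isospinR a).mul ((hL.mul (actsBy_suLift_isospinL b)).mul hR')
    rwa [mul_one, one_mul, one_mul] at this

/-- There is a unit vector orthogonal to a given vector of `ℂ³`. -/
theorem exists_unit_orthogonal (z : Fin 3 → ℂ) : ∃ w : Fin 3 → ℂ, negNormSq 3 w = -1 ∧
    conj (z 0) * w 0 + conj (z 1) * w 1 + conj (z 2) * w 2 = 0 := by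
  obtain ⟨w, hw, h⟩ : ∃ w : Fin 3 → ℂ, w ≠ 0 ∧
      conj (z 0) * w 0 + conj (z 1) * w 1 + conj (z 2) * w 2 = 0 := by
    by_cases hz : z 0 = 0
    · exact ⟨![1, 0, 0], fun h => one_ne_zero (congrFun h 0), by simp [hz]⟩
    · refine ⟨![-conj (z 1), conj (z 0), 0], fun h => hz ?_, by simp; ring⟩
      simpa using congrFun h 1
  obtain ⟨r, u, -, hu, rfl⟩ := negNormSq_smul_unit w hw
  refine ⟨u, hu, ?_⟩
  have hr : (r : ℂ) ≠ 0 := by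
    rintro h0
    rw [Complex.ofReal_eq_zero] at h0
    simp [h0] at hw
  simp only [Pi.smul_apply, Complex.real_smul] at h
  refine (mul_eq_zero.1 ?_).resolve_left hr
  linear_combination h

/-- The product uv of vectors applied to w = r ∧ g ∧ b: the color part is the conjugate of the cross
product u × v, and the white part is minus the Hermitian product of u and v. -/
theorem gammaC_conj_mul_gammaC (u v : Fin 3 → ℂ) (i : Fin 4) :
    ((gammaC u).map conj * gammaC v) i 3 =
      ![conj (u 1 * v 2 - u 2 * v 1), conj (u 2 * v 0 - u 0 * v 2), conj (u 0 * v 1 - u 1 * v 0),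
        -(u 0 * conj (v 0) + u 1 * conj (v 1) + u 2 * conj (v 2))] i := by
  have h : ∀ A : Matrix (Fin 4) (Fin 4) ℂ, (Complex.I • A).map conj = (-Complex.I) • A.map conj := by
    intro A; ext i j; simp
  rw [gammaC, gammaC, h, smul_mul_smul_comm, neg_mul, Complex.I_mul_I, neg_neg, one_smul,
    mul_apply, Fin.sum_univ_four]
  fin_cases i <;> simp <;> ring

/-- `Spin(6)` acts transitively on the unit sphere of `Λ^odd ℂ³`. -/
theorem exists_unit_pair (c : SU 4) : ∃ u v : Fin 3 → ℂ, negNormSq 3 u = -1 ∧ negNormSq 3 v = -1 ∧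
    ∀ i, ((gammaC u).map conj * gammaC v) i 3 = c.1 i 3 := by
  obtain ⟨w, hw, h⟩ := exists_unit_orthogonal ![c.1 0 3, c.1 1 3, c.1 2 3]
  have h' := congrArg conj h
  have hw1 := dotProduct_three hw
  have hc : conj (c.1 0 3) * c.1 0 3 + conj (c.1 1 3) * c.1 1 3 + conj (c.1 2 3) * c.1 2 3
      + conj (c.1 3 3) * c.1 3 3 = 1 := by
    have := congrFun (congrFun (mem_unitaryGroup_iff'.1 (mem_specialUnitaryGroup_iff.1 c.2).1) 3) 3
    simpa [mul_apply, Fin.sum_univ_four] using this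
  simp only [cons_val_zero, cons_val_one, cons_val, map_add, map_mul, Complex.conj_conj,
    map_zero] at h h'
  set z0 := c.1 0 3
  set z1 := c.1 1 3
  set z2 := c.1 2 3
  set t := c.1 3 3
  -- Here u = -t w + conj(w × z), where the column is (z, t) and w is a unit vector orthogonal to z.
  -- The two terms of u are orthogonal, so |u|² = |t|² + |z|² = 1; the triple product identity gives
  -- conj(u × w) = z, and the Hermitian product of u with w is -t.
  refine ⟨![-t * w 0 + conj (w 1 * z2 - w 2 * z1), -t * w 1 + conj (w 2 * z0 - w 0 * z2),
    -t * w 2 + conj (w 0 * z1 - w 1 * z0)], w, (negNormSq_eq_neg_one_iff _).2 ?_, hw, fun i => ?_⟩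
  · simp [dotProduct, Fin.sum_univ_succ]
    linear_combination (conj (w 0) * w 0 + conj (w 1) * w 1 + conj (w 2) * w 2) * hc + hw1
      - (z0 * conj (w 0) + z1 * conj (w 1) + z2 * conj (w 2)) * h
  · rw [gammaC_conj_mul_gammaC]
    fin_cases i <;> simp
    · linear_combination z0 * hw1 - w 0 * h'
    · linear_combination z1 * hw1 - w 1 * h'
    · linear_combination z2 * hw1 - w 2 * h'
    · linear_combination t * hw1

theorem det_eq_det_castSucc {k : ℕ} {M : Matrix (Fin (k + 1)) (Fin (k + 1)) ℂ}
    (h : ∀ i, M i (Fin.last k) = if i = Fin.last k then 1 else 0) :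
    M.det = (of fun i j : Fin k => M i.castSucc j.castSucc).det := by
  rw [det_succ_column M (Fin.last k), Finset.sum_eq_single (Fin.last k)]
  · rw [h, if_pos rfl, Fin.succAbove_last, Even.neg_one_pow ⟨_, rfl⟩, one_mul, one_mul]
    rfl
  · intro i _ hi
    rw [h, if_neg hi, mul_zero, zero_mul]
  · simp

/-- A matrix in `SU(4)` that fixes the last basis vector belongs to `SU(3)`. -/
theorem exists_specialUnitary_three (d : SU 4) (hd : ∀ i, d.1 i 3 = if i = 3 then 1 else 0) :
    ∃ A : SU 3, (∀ i j : Fin 3, d.1 i.castSucc j.castSucc = A.1 i j) ∧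
      ∀ i : Fin 3, d.1 3 i.castSucc = 0 := by
  obtain ⟨hu, hdet⟩ := mem_specialUnitaryGroup_iff.1 d.2
  have hu := fun i j => congrFun (congrFun (mem_unitaryGroup_iff'.1 hu) i) j
  have hne : ∀ i : Fin 3, i.castSucc ≠ (3 : Fin 4) := fun i => (Fin.castSucc_lt_last i).ne
  simp only [mul_apply, star_apply] at hu
  have hr : ∀ i : Fin 3, d.1 3 i.castSucc = 0 := by
    intro i
    -- The last column is the last basis vector, and orthogonality of the other columns to it makes
    -- the rest of the last row vanish.
    have := hu 3 i.castSucc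
    simpa [hd, one_apply, (hne i).symm, apply_ite] using this
  refine ⟨⟨of fun i j => d.1 i.castSucc j.castSucc, mem_specialUnitaryGroup_iff.2
    ⟨mem_unitaryGroup_iff'.2 ?_, ?_⟩⟩, fun i j => rfl, hr⟩
  · ext i j
    have := hu i.castSucc j.castSucc
    rw [Fin.sum_univ_castSucc, show Fin.last 3 = 3 from rfl, hr, mul_comm, hr] at this
    simpa [mul_apply, one_apply] using this
  · rw [← hdet, det_eq_det_castSucc hd]

/-- An orbit and stabilizer argument: a product b of two unit vectors has the last column of c, so
b⁻¹c fixes w and lies in SU(3), which has a lift. -/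
theorem exists_spin_color (c : SU 4) :
    ∃ x : Spin 3, ActsBy (cliffordAction 3 x) color4 color4 c.1 := by
  obtain ⟨u, v, hu, hv, h⟩ := exists_unit_pair c
  let b : SU 4 := ⟨_, conj_mem (gammaC_mem hu)⟩ * ⟨_, gammaC_mem hv⟩
  have hd : ∀ i, (b⁻¹ * c).1 i 3 = if i = 3 then 1 else 0 := by
    intro i
    have h1 : (b⁻¹ * c).1 i 3 = (b⁻¹ * b).1 i 3 := by
      rw [Submonoid.coe_mul, Submonoid.coe_mul, mul_apply, mul_apply]
      exact Finset.sum_congr rfl fun j _ => by rw [← h j]; rfl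
    rw [h1, inv_mul_cancel, OneMemClass.coe_one, one_apply]
  obtain ⟨A, hA, hr⟩ := exists_specialUnitary_three _ hd
  refine ⟨⟨_, mul_mem (ι_mul_ι_mem_spinGroup hu hv) (suLift 3 A).2⟩, ?_⟩
  have h3 := ((actsBy_gammaC_conj u).mul (actsBy_gammaC v)).mul
    (actsBy_suLift_color4 A hA (fun i => by
      rw [hd, if_neg (show i.castSucc ≠ (3 : Fin 4) from (Fin.castSucc_lt_last i).ne)]) hr
      (by rw [hd, if_pos rfl]))
  have h4 : (gammaC u).map conj * gammaC v * (b⁻¹ * c).1 = c.1 := by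
    change (b * (b⁻¹ * c)).1 = c.1
    rw [mul_inv_cancel_left]
  rw [h4] at h3
  rwa [map_mul, map_mul, cliffordAction_ι, cliffordAction_ι]

end GUT

namespace GUT

open CliffordAlgebra (ι)
open Matrix Fock

/-! ### The isomorphism `SU(2) × SU(2) × SU(4) ≅ Spin(4) × Spin(6)` -/

theorem exists_isospin_matrices (x : Spin 2) : ∃ p : SU 2 × SU 2,
    ActsBy (cliffordAction 2 x) isospinL isospinL p.1.1 ∧
      ActsBy (cliffordAction 2 x) isospinR isospinR p.2.1 := by
  obtain ⟨a, b, h⟩ := exists_actsBy_isospin x.2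
  exact ⟨(a, b), h⟩

theorem isospin_matrices_unique {x : Cliff 2} {p q : SU 2 × SU 2}
    (hp : ActsBy (cliffordAction 2 x) isospinL isospinL p.1.1 ∧
      ActsBy (cliffordAction 2 x) isospinR isospinR p.2.1)
    (hq : ActsBy (cliffordAction 2 x) isospinL isospinL q.1.1 ∧
      ActsBy (cliffordAction 2 x) isospinR isospinR q.2.1) : p = q :=
  Prod.ext (Subtype.ext (hp.1.unique orthonormal_isospinL hq.1))
    (Subtype.ext (hp.2.unique orthonormal_isospinR hq.2))

/-- The homomorphism `Spin(4) → SU(2) × SU(2)` given by odd and even spinors. -/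
def isospinHom : Spin 2 →* SU 2 × SU 2 where
  toFun x := (exists_isospin_matrices x).choose
  map_one' := isospin_matrices_unique (exists_isospin_matrices 1).choose_spec
    (by rw [OneMemClass.coe_one, map_one]; exact ⟨ActsBy.id _, ActsBy.id _⟩)
  map_mul' x y := isospin_matrices_unique (exists_isospin_matrices (x * y)).choose_spec (by
    have hx := (exists_isospin_matrices x).choose_spec
    have hy := (exists_isospin_matrices y).choose_spec
    rw [Submonoid.coe_mul, map_mul]
    exact ⟨hx.1.mul hy.1, hx.2.mul hy.2⟩)

theorem isospinHom_spec (x : Spin 2) :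
    ActsBy (cliffordAction 2 x) isospinL isospinL (isospinHom x).1.1 ∧
      ActsBy (cliffordAction 2 x) isospinR isospinR (isospinHom x).2.1 :=
  (exists_isospin_matrices x).choose_spec

theorem isospinHom_bijective : Function.Bijective isospinHom := by
  constructor
  · intro x y h
    refine Subtype.ext (cliffordAction_injective 2 (ext_isospin (fun j => ?_) fun j => ?_))
    · rw [(isospinHom_spec x).1 j, (isospinHom_spec y).1 j, h]
    · rw [(isospinHom_spec x).2 j, (isospinHom_spec y).2 j, h]
  · rintro ⟨a, b⟩
    obtain ⟨x, hx⟩ := exists_spin_isospin a b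
    exact ⟨x, isospin_matrices_unique (isospinHom_spec x) hx⟩

theorem actsBy_anticolor4 {x : Cliff 3} (hx : x ∈ spinGroup (negNormSq 3))
    {A : Matrix (Fin 4) (Fin 4) ℂ} (h : ActsBy (cliffordAction 3 x) color4 color4 A) :
    ActsBy (cliffordAction 3 x) anticolor4 anticolor4 (A.map conj) := by
  obtain ⟨c, hc, hc'⟩ := exists_actsBy_color hx
  rwa [h.unique orthonormal_color4 hc]

theorem exists_color_matrix (x : Spin 3) : ∃ c : SU 4,
    ActsBy (cliffordAction 3 x) color4 color4 c.1 := by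
  obtain ⟨c, h, -⟩ := exists_actsBy_color x.2
  exact ⟨c, h⟩

theorem color_matrix_unique {x : Cliff 3} {c d : SU 4}
    (hc : ActsBy (cliffordAction 3 x) color4 color4 c.1)
    (hd : ActsBy (cliffordAction 3 x) color4 color4 d.1) : c = d :=
  Subtype.ext (hc.unique orthonormal_color4 hd)

/-- The homomorphism `Spin(6) → SU(4)` given by odd spinors. -/
def colorHom : Spin 3 →* SU 4 where
  toFun x := (exists_color_matrix x).choose
  map_one' := color_matrix_unique (exists_color_matrix 1).choose_spec
    (by rw [OneMemClass.coe_one, map_one]; exact ActsBy.id _)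
  map_mul' x y := color_matrix_unique (exists_color_matrix (x * y)).choose_spec (by
    rw [Submonoid.coe_mul, map_mul]
    exact (exists_color_matrix x).choose_spec.mul (exists_color_matrix y).choose_spec)

theorem colorHom_spec (x : Spin 3) :
    ActsBy (cliffordAction 3 x) color4 color4 (colorHom x).1 :=
  (exists_color_matrix x).choose_spec

/-- For injectivity, the matrix on odd spinors also fixes the action on even spinors, which is by
the conjugate matrix; faithfulness then applies. -/
theorem colorHom_bijective : Function.Bijective colorHom := by
  constructor
  · intro x y h
    refine Subtype.ext (cliffordAction_injective 3 (ext_color (fun j => ?_) fun j => ?_))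
    · rw [colorHom_spec x j, colorHom_spec y j, h]
    · rw [actsBy_anticolor4 x.2 (colorHom_spec x) j, actsBy_anticolor4 y.2 (colorHom_spec y) j, h]
  · intro c
    obtain ⟨x, hx⟩ := exists_spin_color c
    exact ⟨x, color_matrix_unique (colorHom_spec x) hx⟩

theorem ActsBy.continuous_apply {X V : Type} [TopologicalSpace X] [NormedAddCommGroup V]
    [InnerProductSpace ℂ V] {k : ℕ} {T : X → V →ₗ[ℂ] V} {b : Fin k → V}
    {A : X → Matrix (Fin k) (Fin k) ℂ} (h : ∀ x, ActsBy (T x) b b (A x)) (hA : Continuous A)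
    (j : Fin k) : Continuous fun x => T x (b j) := by
  simp only [h _ j]
  exact continuous_finsetSum _ fun i _ =>
    Continuous.fun_smul ((continuous_apply_apply i j).comp hA) continuous_const

theorem ActsBy.continuous_matrix {X V : Type} [TopologicalSpace X] [NormedAddCommGroup V]
    [InnerProductSpace ℂ V] {k : ℕ} {T : X → V →ₗ[ℂ] V} {b : Fin k → V} (hb : Orthonormal ℂ b)
    {A : X → Matrix (Fin k) (Fin k) ℂ} (h : ∀ x, ActsBy (T x) b b (A x))
    (hT : ∀ v, Continuous fun x => T x v) : Continuous A := by
  refine _root_.continuous_matrix fun i j => ?_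
  have : ∀ x, A x i j = inner ℂ (b i) (T x (b j)) := by
    intro x
    rw [h x j, hb.inner_right_fintype]
  simp only [this]
  exact continuous_const.inner (hT _)

theorem continuous_of_orthonormal {X ι V W : Type} [TopologicalSpace X] [Fintype ι]
    [NormedAddCommGroup V] [InnerProductSpace ℂ V] [FiniteDimensional ℂ V] [NormedAddCommGroup W]
    [InnerProductSpace ℂ W] {b : ι → V} (hb : Orthonormal ℂ b)
    (hcard : Fintype.card ι = Module.finrank ℂ V) {T : X → V →ₗ[ℂ] W}
    (h : ∀ i, Continuous fun x => T x (b i)) (v : V) : Continuous fun x => T x v := by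
  have hv : v ∈ Submodule.span ℂ (Set.range b) := by
    rw [hb.linearIndependent.span_eq_top_of_card_eq_finrank' hcard]
    trivial
  induction hv using Submodule.span_induction with
  | mem v hv => obtain ⟨i, rfl⟩ := hv; exact h i
  | zero => simpa using continuous_const
  | add v w _ _ hv hw => simp only [map_add]; exact hv.add hw
  | smul c v _ hv => simp only [map_smul]; exact hv.const_smul c

theorem continuous_isospinHom : Continuous isospinHom :=
  ((ActsBy.continuous_matrix orthonormal_isospinL (fun x => (isospinHom_spec x).1)
    continuous_diracRep).subtype_mk _).prodMk
  ((ActsBy.continuous_matrix orthonormal_isospinR (fun x => (isospinHom_spec x).2)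
    continuous_diracRep).subtype_mk _)

theorem continuous_colorHom : Continuous colorHom :=
  (ActsBy.continuous_matrix orthonormal_color4 colorHom_spec continuous_diracRep).subtype_mk _

/-- The isomorphism `Spin(4) ≅ SU(2) × SU(2)`. -/
def isospinEquiv : Spin 2 ≃* SU 2 × SU 2 := MulEquiv.ofBijective isospinHom isospinHom_bijective

/-- The isomorphism `Spin(6) ≅ SU(4)`. -/
def colorEquiv : Spin 3 ≃* SU 4 := MulEquiv.ofBijective colorHom colorHom_bijective

theorem isospinEquiv_symm_spec (p : SU 2 × SU 2) :
    ActsBy (cliffordAction 2 (isospinEquiv.symm p)) isospinL isospinL p.1.1 ∧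
      ActsBy (cliffordAction 2 (isospinEquiv.symm p)) isospinR isospinR p.2.1 := by
  have := isospinHom_spec (isospinEquiv.symm p)
  rwa [show isospinHom (isospinEquiv.symm p) = p from isospinEquiv.apply_symm_apply p] at this

theorem colorEquiv_symm_spec (c : SU 4) :
    ActsBy (cliffordAction 3 (colorEquiv.symm c)) color4 color4 c.1 := by
  have := colorHom_spec (colorEquiv.symm c)
  rwa [show colorHom (colorEquiv.symm c) = c from colorEquiv.apply_symm_apply c] at this

theorem continuous_isospinEquiv_symm : Continuous isospinEquiv.symm := by
  rw [continuous_spin_iff]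
  refine continuous_of_orthonormal (T := fun p => cliffordAction 2 (isospinEquiv.symm p))
    orthonormal_isospin (by rw [Fock.finrank]; rfl) (Sum.rec (fun j => ?_) fun j => ?_)
  · exact ActsBy.continuous_apply (fun p => (isospinEquiv_symm_spec p).1)
      (continuous_subtype_val.comp continuous_fst) j
  · exact ActsBy.continuous_apply (fun p => (isospinEquiv_symm_spec p).2)
      (continuous_subtype_val.comp continuous_snd) j

theorem continuous_colorEquiv_symm : Continuous colorEquiv.symm := by
  rw [continuous_spin_iff]
  refine continuous_of_orthonormal (T := fun c => cliffordAction 3 (colorEquiv.symm c))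
    orthonormal_color (by rw [Fock.finrank]; rfl) (Sum.rec (fun j => ?_) fun j => ?_)
  · exact ActsBy.continuous_apply colorEquiv_symm_spec continuous_subtype_val j
  · exact ActsBy.continuous_apply
      (fun c => actsBy_anticolor4 (colorEquiv.symm c).2 (colorEquiv_symm_spec c))
      (continuous_subtype_val.matrix_map Complex.continuous_conj) j

/-- The isomorphism `SU(2) × SU(2) × SU(4) ≅ Spin(4) × Spin(6)`. -/
def patiSalamEquiv : (SU 2 × SU 2 × SU 4) ≃ₜ* (Spin4 × Spin6) where
  toFun p := (isospinEquiv.symm (p.1, p.2.1), colorEquiv.symm p.2.2)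
  invFun x := ((isospinEquiv x.1).1, (isospinEquiv x.1).2, colorEquiv x.2)
  left_inv p := by simp
  right_inv x := by simp
  map_mul' p q := by simp [← map_mul]
  continuous_toFun := (continuous_isospinEquiv_symm.comp (by fun_prop)).prodMk
    (continuous_colorEquiv_symm.comp (by fun_prop))
  continuous_invFun := (continuous_isospinHom.comp continuous_fst).fst.prodMk
    ((continuous_isospinHom.comp continuous_fst).snd.prodMk
      (continuous_colorHom.comp continuous_snd))

end GUT

namespace GUT

open Matrix Fock Fermion

/-! ### The Standard Model representation in terms of spinors -/

theorem eq_sum_single (v : SMSpace) : v = ∑ q, v q • EuclideanSpace.single q (1 : ℂ) := by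
  simpa using ((EuclideanSpace.basisFun (Fermion ⊕ Fermion) ℂ).sum_repr v).symm

theorem mapH_apply (v : SMSpace) : mapH v = ∑ q, v q • patiSalamCode q := by
  conv_lhs => rw [eq_sum_single v]
  rw [map_sum]
  exact Finset.sum_congr rfl fun q _ => by rw [map_smul, mapH, ofCode_single]

theorem mapF_apply (v : SMSpace) : mapF v = ∑ q, v q • su5Code q := by
  conv_lhs => rw [eq_sum_single v]
  rw [map_sum]
  exact Finset.sum_congr rfl fun q _ => by rw [map_smul, mapF, ofCode_single]

theorem mapG_patiSalamCode (p : Fermion ⊕ Fermion) : mapG (patiSalamCode p) = su5Code p := by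
  have hl : ∀ j : Fin 2, ExteriorAlgebra.map (inclLeft 2 3) (e j) = e (Fin.castAdd 3 j) :=
    map_inclLeft_e 3
  have hr : ∀ j : Fin 3, ExteriorAlgebra.map (inclRight 2 3) (e j) = e (Fin.natAdd 2 j) :=
    map_inclRight_e 2
  have h0 : Fin.castAdd 3 (0 : Fin 2) = (0 : Fin 5) := rfl
  have h1 : Fin.castAdd 3 (1 : Fin 2) = (1 : Fin 5) := rfl
  have h2 : Fin.natAdd 2 (0 : Fin 3) = (2 : Fin 5) := rfl
  have h3 : Fin.natAdd 2 (1 : Fin 3) = (3 : Fin 5) := rfl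
  have h4 : Fin.natAdd 2 (2 : Fin 3) = (4 : Fin 5) := rfl
  have hw : ∀ (v : Fock 2) (w : Fock 3), mapG (v ⊗ₜ w)
      = ((ExteriorAlgebra.map (inclLeft 2 3) v : Fock (2 + 3)) : Fock 5)
        * (ExteriorAlgebra.map (inclRight 2 3) w : Fock (2 + 3)) := wedge_tmul
  rcases p with (⟨i⟩ | ⟨i, c⟩ | _ | _ | ⟨c⟩ | ⟨c⟩) | (⟨i⟩ | ⟨i, c⟩ | _ | _ | ⟨c⟩ | ⟨c⟩) <;>
    (try fin_cases i) <;> (try fin_cases c) <;>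
    simp [patiSalamCode, su5Code, hw, hl, hr, h0, h1, h2, h3, h4]

theorem mapG_mapH (v : SMSpace) : mapG (mapH v) = mapF v := by
  rw [mapH_apply, mapF_apply, map_sum]
  exact Finset.sum_congr rfl fun q _ => by rw [map_smul, mapG_patiSalamCode]

theorem smRep_single (x : GSM) (p q : Fermion ⊕ Fermion) :
    smRep x (EuclideanSpace.single p 1) q = smMatrix x q p := by
  simp [smRep_apply, toLpLin_apply]

/-- The dual basis `-d, u` of `ℂ²`, in the isospin representation. -/
def isospinDual : Fin 2 → Fock 2 := ![-e 1, e 0]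

/-- The anticolors `g ∧ b, b ∧ r, r ∧ g`. -/
def anticolor : Fin 3 → Fock 3 := ![e 1 * e 2, e 2 * e 0, e 0 * e 1]

/-- For determinant 1 the inverse is both the adjoint and the adjugate. This is the self-duality of
ℂ² that the signs in the antifermion codes reflect. -/
theorem specialUnitary_two_conj (A : SU 2) :
    conj (A.1 0 0) = A.1 1 1 ∧ conj (A.1 1 0) = -A.1 0 1 := by
  obtain ⟨hu, hdet⟩ := mem_specialUnitaryGroup_iff.1 A.2
  have h : star A.1 = A.1.adjugate := by
    have h1 := mem_unitaryGroup_iff'.1 hu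
    have h2 := mul_adjugate A.1
    rw [hdet, one_smul] at h2
    calc star A.1 = star A.1 * (A.1 * A.1.adjugate) := by rw [h2, mul_one]
      _ = A.1.adjugate := by rw [← mul_assoc, h1, one_mul]
  rw [adjugate_fin_two] at h
  constructor
  · simpa using congrFun (congrFun h 0) 0
  · simpa using congrFun (congrFun h 0) 1

theorem smul_sum_tmul_smul_sum {V W : Type} [AddCommGroup V] [Module ℂ V] [AddCommGroup W]
    [Module ℂ W] {m n : ℕ} (a b : ℂ) (f : Fin m → ℂ) (g : Fin n → ℂ) (v : Fin m → V)
    (w : Fin n → W) : (a • ∑ i, f i • v i) ⊗ₜ[ℂ] (b • ∑ j, g j • w j)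
      = ∑ i, ∑ j, (a * b * (f i * g j)) • (v i ⊗ₜ[ℂ] w j) := by
  rw [TensorProduct.smul_tmul_smul, TensorProduct.sum_tmul, Finset.smul_sum]
  refine Finset.sum_congr rfl fun i _ => ?_
  rw [TensorProduct.tmul_sum, Finset.smul_sum]
  exact Finset.sum_congr rfl fun j _ => by rw [TensorProduct.smul_tmul_smul, smul_smul]

theorem smul_sum_tmul_smul {V W : Type} [AddCommGroup V] [Module ℂ V] [AddCommGroup W]
    [Module ℂ W] {m : ℕ} (a b : ℂ) (f : Fin m → ℂ) (v : Fin m → V)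
    (w : W) : (a • ∑ i, f i • v i) ⊗ₜ[ℂ] (b • w) = ∑ i, (a * b * f i) • (v i ⊗ₜ[ℂ] w) := by
  rw [TensorProduct.smul_tmul_smul, TensorProduct.sum_tmul, Finset.smul_sum]
  exact Finset.sum_congr rfl fun j _ => by rw [← TensorProduct.smul_tmul', smul_smul]

theorem smul_tmul_smul_sum {V W : Type} [AddCommGroup V] [Module ℂ V] [AddCommGroup W]
    [Module ℂ W] {n : ℕ} (a b : ℂ) (g : Fin n → ℂ) (v : V)
    (w : Fin n → W) : (a • v) ⊗ₜ[ℂ] (b • ∑ j, g j • w j) = ∑ j, (a * b * g j) • (v ⊗ₜ[ℂ] w j) := by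
  rw [TensorProduct.smul_tmul_smul, TensorProduct.tmul_sum, Finset.smul_sum]
  exact Finset.sum_congr rfl fun j _ => by rw [TensorProduct.tmul_smul, smul_smul]

theorem conj_circle_zpow (z : Circle) (k : ℤ) : conj ((z : ℂ) ^ k) = (z : ℂ) ^ (-k) := by
  rw [map_zpow₀, ← Circle.coe_inv_eq_conj, Circle.coe_inv, _root_.inv_zpow, _root_.zpow_neg]

theorem mapH_smRep_single (x : GSM) (p : Fermion ⊕ Fermion) :
    mapH (smRep x (EuclideanSpace.single p 1)) = ∑ q, smMatrix x q p • patiSalamCode q := by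
  rw [mapH_apply]
  exact Finset.sum_congr rfl fun q _ => by rw [smRep_single]

/-- The common core of the faces over φ and θ. The operators X and Y act on each graded piece by the
Standard Model matrices times a power of α, and the twelve equations say that the exponents add up
to 3Y on each fermion multiplet and to -3Y on its dual. Only these sums matter, so the unitary group
element may distribute its phases between the factors in different ways. -/
theorem map_mapH {x : GSM} {X : Module.End ℂ (Fock 2)} {Y : Module.End ℂ (Fock 3)}
    {kL kU k1 kC kW kA k0 : ℤ}
    (hL : ∀ j, X (isospinL j) = (x.1 : ℂ) ^ kL • ∑ i, x.2.1.1 i j • isospinL i)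
    (hU : X (e 0 * e 1) = (x.1 : ℂ) ^ kU • (e 0 * e 1)) (h1 : X 1 = (x.1 : ℂ) ^ k1 • 1)
    (hC : ∀ j, Y (e j) = (x.1 : ℂ) ^ kC • ∑ i, x.2.2.1 i j • e i)
    (hW : Y (e 0 * e 1 * e 2) = (x.1 : ℂ) ^ kW • (e 0 * e 1 * e 2))
    (hA : ∀ j, Y (anticolor j) = (x.1 : ℂ) ^ kA • ∑ i, conj (x.2.2.1 i j) • anticolor i)
    (h0 : Y 1 = (x.1 : ℂ) ^ k0 • 1)
    (hLW : kL + kW = -3) (hLC : kL + kC = 1) (hUW : kU + kW = 0) (h1W : k1 + kW = -6)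
    (hUC : kU + kC = 4) (h1C : k1 + kC = -2) (hL0 : kL + k0 = 3) (hLA : kL + kA = -1)
    (h10 : k1 + k0 = 0) (hU0 : kU + k0 = 6) (h1A : k1 + kA = -4) (hUA : kU + kA = 2)
    (v : SMSpace) : TensorProduct.map X Y (mapH v) = mapH (smRep x v) := by
  have hz : ∀ a b : ℤ, (x.1 : ℂ) ^ a * (x.1 : ℂ) ^ b = (x.1 : ℂ) ^ (a + b) := fun a b =>
    (zpow_add₀ (Circle.coe_ne_zero _) a b).symm
  -- The vectors -d, u transform like the dual basis of u, d, so the action on isospin antiparticles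
  -- follows from that on u, d.
  have hD : ∀ j, X (isospinDual j) = (x.1 : ℂ) ^ kL • ∑ i, conj (x.2.1.1 i j) • isospinDual i := by
    obtain ⟨g0, g1⟩ := specialUnitary_two_conj x.2.1
    have g2 := congrArg conj g0
    have g3 := congrArg conj g1
    rw [map_neg, Complex.conj_conj] at g3
    rw [Complex.conj_conj] at g2
    have hL0 := hL 0
    have hL1 := hL 1
    simp only [isospinL, Fin.sum_univ_two, cons_val_zero, cons_val_one] at hL0 hL1
    refine Fin.forall_fin_two.2 ⟨?_, ?_⟩
    · simp only [isospinDual, Fin.sum_univ_two, cons_val_zero, cons_val_one, map_neg, hL1, g0, g1]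
      module
    · have g4 : conj (x.2.1.1 0 1) = -x.2.1.1 1 0 := by rw [g3, neg_neg]
      simp only [isospinDual, Fin.sum_univ_two, cons_val_zero, cons_val_one, hL0, g4, ← g2]
      module
  have hcol : (![e 0, e 1, e 2] : Fin 3 → Fock 3) = e := by
    ext j : 1
    fin_cases j <;> rfl
  have hinr : ∀ p q, (fermionMatrix x⁻¹)ᵀ q p = conj (fermionMatrix x q p) := fun p q => by
    rw [fermionMatrix_inv]; rfl
  have hcode : ∀ p, TensorProduct.map X Y (patiSalamCode p)
      = mapH (smRep x (EuclideanSpace.single p 1)) := by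
    intro p
    rw [mapH_smRep_single, Fintype.sum_sum_type, sum_fermion, sum_fermion]
    rcases p with p | p
    · simp only [smMatrix, fromBlocks_apply₁₁, fromBlocks_apply₂₁, Matrix.zero_apply, zero_smul,
        Finset.sum_const_zero, add_zero]
      rcases p with ⟨i⟩ | ⟨i, c⟩ | _ | _ | ⟨c⟩ | ⟨c⟩ <;>
        simp only [fermionMatrix, of_apply, zero_smul, Finset.sum_const_zero, add_zero, zero_add]
      · change TensorProduct.map X Y (isospinL i ⊗ₜ (e 0 * e 1 * e 2)) = _
        rw [TensorProduct.map_tmul, hL, hW, smul_sum_tmul_smul, hz, hLW]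
        rfl
      · change TensorProduct.map X Y (isospinL i ⊗ₜ ![e 0, e 1, e 2] c) = _
        rw [hcol, TensorProduct.map_tmul, hL, hC, smul_sum_tmul_smul_sum, hz, hLC, zpow_one]
        refine Finset.sum_congr rfl fun a _ => Finset.sum_congr rfl fun b _ => ?_
        rw [← hcol]
        rfl
      · change TensorProduct.map X Y ((e 0 * e 1) ⊗ₜ (e 0 * e 1 * e 2)) = _
        rw [TensorProduct.map_tmul, hU, hW, TensorProduct.smul_tmul_smul, hz, hUW, zpow_zero]
        rfl
      · change TensorProduct.map X Y (1 ⊗ₜ (e 0 * e 1 * e 2)) = _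
        rw [TensorProduct.map_tmul, h1, hW, TensorProduct.smul_tmul_smul, hz, h1W]
        rfl
      · change TensorProduct.map X Y ((e 0 * e 1) ⊗ₜ ![e 0, e 1, e 2] c) = _
        rw [hcol, TensorProduct.map_tmul, hU, hC, smul_tmul_smul_sum, hz, hUC, zpow_ofNat]
        refine Finset.sum_congr rfl fun b _ => ?_
        rw [← hcol]
        rfl
      · change TensorProduct.map X Y (1 ⊗ₜ ![e 0, e 1, e 2] c) = _
        rw [hcol, TensorProduct.map_tmul, h1, hC, smul_tmul_smul_sum, hz, h1C]
        refine Finset.sum_congr rfl fun b _ => ?_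
        rw [← hcol]
        rfl
    · simp only [smMatrix, fromBlocks_apply₁₂, fromBlocks_apply₂₂, Matrix.zero_apply, zero_smul,
        Finset.sum_const_zero, zero_add, hinr]
      rcases p with ⟨i⟩ | ⟨i, c⟩ | _ | _ | ⟨c⟩ | ⟨c⟩ <;>
        simp only [fermionMatrix, of_apply, map_zero, map_one, map_mul, zero_smul,
          Finset.sum_const_zero, add_zero, zero_add, conj_circle_zpow]
      · change TensorProduct.map X Y (isospinDual i ⊗ₜ 1) = _
        rw [TensorProduct.map_tmul, hD, h0, smul_sum_tmul_smul, hz, hL0]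
        rfl
      · change TensorProduct.map X Y (isospinDual i ⊗ₜ anticolor c) = _
        rw [TensorProduct.map_tmul, hD, hA, smul_sum_tmul_smul_sum, hz, hLA,
          ← conj_circle_zpow, zpow_one]
        rfl
      · change TensorProduct.map X Y (1 ⊗ₜ 1) = _
        rw [TensorProduct.map_tmul, h1, h0, TensorProduct.smul_tmul_smul, hz, h10, zpow_zero]
        rfl
      · change TensorProduct.map X Y ((e 0 * e 1) ⊗ₜ 1) = _
        rw [TensorProduct.map_tmul, hU, h0, TensorProduct.smul_tmul_smul, hz, hU0]
        rfl
      · change TensorProduct.map X Y (1 ⊗ₜ anticolor c) = _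
        rw [TensorProduct.map_tmul, h1, hA, smul_tmul_smul_sum, hz, h1A, ← conj_circle_zpow,
          zpow_ofNat]
        rfl
      · change TensorProduct.map X Y ((e 0 * e 1) ⊗ₜ anticolor c) = _
        rw [TensorProduct.map_tmul, hU, hA, smul_tmul_smul_sum, hz, hUA]
        rfl
  rw [eq_sum_single v]
  simp only [map_sum, map_smul, ← hcode]
  simp only [mapH, ofCode_single]

end GUT

namespace GUT

open Matrix Fock Fermion

/-! ### Block diagonal matrices and the faces over G_SM -/

section

variable {m n : ℕ} (A : Matrix (Fin m) (Fin m) ℂ) (B : Matrix (Fin n) (Fin n) ℂ)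

theorem blockDiag_castAdd_castAdd (i j : Fin m) :
    blockDiag A B (Fin.castAdd n i) (Fin.castAdd n j) = A i j := by simp [blockDiag]

theorem blockDiag_castAdd_natAdd (i : Fin m) (j : Fin n) :
    blockDiag A B (Fin.castAdd n i) (Fin.natAdd m j) = 0 := by simp [blockDiag]

theorem blockDiag_natAdd_castAdd (i : Fin n) (j : Fin m) :
    blockDiag A B (Fin.natAdd m i) (Fin.castAdd n j) = 0 := by simp [blockDiag]

theorem blockDiag_natAdd_natAdd (i j : Fin n) :
    blockDiag A B (Fin.natAdd m i) (Fin.natAdd m j) = B i j := by simp [blockDiag]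

theorem blockDiag_mulVec_append (v : Fin m → ℂ) (w : Fin n → ℂ) :
    blockDiag A B *ᵥ Fin.append v w = Fin.append (A *ᵥ v) (B *ᵥ w) := by
  ext i
  refine Fin.addCases (fun i => ?_) (fun i => ?_) i <;>
    simp [mulVec, dotProduct, Fin.sum_univ_add, blockDiag]

theorem mapMatrix_blockDiag_wedge (t : Fock m ⊗[ℂ] Fock n) :
    mapMatrix (blockDiag A B) (wedge m n t)
      = wedge m n (TensorProduct.map (mapMatrix A) (mapMatrix B) t) := by
  induction t using TensorProduct.induction_on with
  | zero => simp
  | add s t hs ht => simp only [map_add, hs, ht]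
  | tmul v w =>
    have hl : (blockDiag A B).mulVecLin ∘ₗ inclLeft m n = inclLeft m n ∘ₗ A.mulVecLin :=
      LinearMap.ext fun v => by
        simpa [inclLeft] using blockDiag_mulVec_append A B v 0
    have hr : (blockDiag A B).mulVecLin ∘ₗ inclRight m n = inclRight m n ∘ₗ B.mulVecLin :=
      LinearMap.ext fun w => by
        simpa [inclRight] using blockDiag_mulVec_append A B 0 w
    rw [TensorProduct.map_tmul, wedge_tmul, wedge_tmul]
    simp only [mapMatrix, AlgHom.toLinearMap_apply, map_mul]
    rw [← AlgHom.comp_apply, ← AlgHom.comp_apply, ExteriorAlgebra.map_comp_map,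
      ExteriorAlgebra.map_comp_map, hl, hr, ← ExteriorAlgebra.map_comp_map,
      ← ExteriorAlgebra.map_comp_map]
    rfl

theorem diracTensorRep_eq_map (p : Spin m × Spin n) (t : Fock m ⊗[ℂ] Fock n) :
    diracTensorRep m n p t
      = TensorProduct.map (cliffordAction m p.1) (cliffordAction n p.2) t := rfl

end

theorem anticolor4_castSucc (j : Fin 3) : anticolor4 j.castSucc = anticolor j := by
  fin_cases j <;> rfl

theorem color4_castSucc (j : Fin 3) : color4 j.castSucc = e j := by
  fin_cases j <;> rfl

theorem diracTensorRep_toPatiSalam (x : GSM) (v : SMSpace) :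
    diracTensorRep 2 3 (patiSalamEquiv (toPatiSalam x)) (mapH v) = mapH (smRep x v) := by
  obtain ⟨hL, hR⟩ := isospinEquiv_symm_spec ((toPatiSalam x).1, (toPatiSalam x).2.1)
  have hC := colorEquiv_symm_spec (toPatiSalam x).2.2
  have hA := actsBy_anticolor4 (colorEquiv.symm (toPatiSalam x).2.2).2 hC
  rw [diracTensorRep_eq_map]
  have d00 : (toPatiSalam x).2.1.1 0 0 = (x.1 : ℂ) ^ (3 : ℤ) :=
    (blockDiag_castAdd_castAdd _ _ 0 0).trans (by simp)
  have d10 : (toPatiSalam x).2.1.1 1 0 = 0 := blockDiag_natAdd_castAdd _ _ 0 0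
  have d01 : (toPatiSalam x).2.1.1 0 1 = 0 := blockDiag_castAdd_natAdd _ _ 0 0
  have d11 : (toPatiSalam x).2.1.1 1 1 = (x.1 : ℂ) ^ (-3 : ℤ) :=
    (blockDiag_natAdd_natAdd _ _ 0 0).trans (by simp)
  have c00 : ∀ i j : Fin 3, (toPatiSalam x).2.2.1 i.castSucc j.castSucc
      = (x.1 : ℂ) ^ (1 : ℤ) * x.2.2.1 i j := blockDiag_castAdd_castAdd _ _
  have c10 : ∀ j : Fin 3, (toPatiSalam x).2.2.1 3 j.castSucc = 0 :=
    blockDiag_natAdd_castAdd _ _ 0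
  have c01 : ∀ i : Fin 3, (toPatiSalam x).2.2.1 i.castSucc 3 = 0 := fun i =>
    blockDiag_castAdd_natAdd _ _ i 0
  have c11 : (toPatiSalam x).2.2.1 3 3 = (x.1 : ℂ) ^ (-3 : ℤ) :=
    (blockDiag_natAdd_natAdd _ _ 0 0).trans (by simp)
  -- The exponents are read off from diag(α³, α⁻³) on u ∧ d, 1 and diag(αh, α⁻³) on r, g, b, w; even
  -- color spinors carry the conjugates.
  refine map_mapH (kL := 0) (kU := 3) (k1 := -3) (kC := 1) (kW := -3) (kA := -1) (k0 := 3)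
    (fun j => ?_) ?_ ?_ (fun j => ?_) ?_ (fun j => ?_) ?_ rfl rfl rfl rfl rfl rfl rfl rfl rfl rfl
    rfl rfl v
  · rw [zpow_zero, one_smul]
    exact hL j
  · have := hR 0
    rw [Fin.sum_univ_two, d00, d10, zero_smul, add_zero] at this
    exact this
  · have := hR 1
    rw [Fin.sum_univ_two, d01, d11, zero_smul, zero_add] at this
    exact this
  · have := hC j.castSucc
    rw [Fin.sum_univ_castSucc] at this
    simp only [Fin.reduceLast, c00, c10, zero_smul, add_zero,
      color4_castSucc, mul_smul, ← Finset.smul_sum] at this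
    exact this
  · have := hC 3
    simp only [Fin.sum_univ_castSucc, Fin.reduceLast, c01, c11, zero_smul,
      Finset.sum_const_zero, zero_add] at this
    exact this
  · have := hA j.castSucc
    rw [Fin.sum_univ_castSucc] at this
    simp only [Fin.reduceLast, map_apply, c00, c10, zero_smul, add_zero,
      anticolor4_castSucc, map_zero, map_mul, conj_circle_zpow, mul_smul,
      ← Finset.smul_sum] at this
    exact this
  · have := hA 3
    simp only [Fin.sum_univ_castSucc, Fin.reduceLast, map_apply, c01, c11, zero_smul, map_zero,
      Finset.sum_const_zero, zero_add, conj_circle_zpow, neg_neg] at this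
    -- The fourth vector of `anticolor4` is -1; the sign appears on both sides and cancels.
    rw [show anticolor4 3 = -1 from rfl, map_neg, smul_neg, neg_inj] at this
    exact this

theorem mapMatrix_smul_e {n : ℕ} (z : ℂ) (A : SU n) (j : Fin n) :
    mapMatrix (z • A.1) (e j) = z • extRep n A (e j) := by
  rw [extRep_apply, e, mapMatrix, AlgHom.toLinearMap_apply, ExteriorAlgebra.map_apply_ι,
    ExteriorAlgebra.map_apply_ι, mulVecLin_apply, mulVecLin_apply, smul_mulVec, map_smul]

theorem mapMatrix_wedge_mul {n : ℕ} (A : Matrix (Fin n) (Fin n) ℂ) (x y : Fock n) :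
    mapMatrix A (x * y) = mapMatrix A x * mapMatrix A y :=
  map_mul (ExteriorAlgebra.map _) x y

/-- Conjugation on Λ² comes from Spin(6): the lift of A has the matrix diag(A, 1) on odd spinors,
hence its conjugate on even ones. -/
theorem extRep_anticolor (A : SU 3) (j : Fin 3) :
    extRep 3 A (anticolor j) = ∑ i, conj (A.1 i j) • anticolor i := by
  have h := actsBy_anticolor4 (suLift 3 A).2 (actsBy_suLift_color4 A
    (B := blockDiag A.1 (1 : Matrix (Fin 1) (Fin 1) ℂ)) (blockDiag_castAdd_castAdd _ _)
    (fun i => blockDiag_castAdd_natAdd _ _ i 0) (blockDiag_natAdd_castAdd _ _ 0)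
    ((blockDiag_natAdd_natAdd _ _ 0 0).trans (one_apply_eq 0))) j.castSucc
  have c00 : ∀ i j : Fin 3, blockDiag A.1 (1 : Matrix (Fin 1) (Fin 1) ℂ) i.castSucc j.castSucc
      = A.1 i j := blockDiag_castAdd_castAdd _ _
  have c10 : ∀ j : Fin 3, blockDiag A.1 (1 : Matrix (Fin 1) (Fin 1) ℂ) 3 j.castSucc = 0 :=
    blockDiag_natAdd_castAdd _ _ 0
  rw [← diracRep_apply, diracRep_suLift] at h
  simpa only [Fin.sum_univ_castSucc, Fin.reduceLast, map_apply, c00, c10, zero_smul, add_zero,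
    anticolor4_castSucc, map_zero] using h

theorem mapMatrix_smul_anticolor (z : ℂ) (A : SU 3) (j : Fin 3) :
    mapMatrix (z • A.1) (anticolor j) = z ^ 2 • extRep 3 A (anticolor j) := by
  fin_cases j <;>
  · simp only [anticolor, Fin.zero_eta, Fin.mk_one, Fin.reduceFinMk, cons_val, mapMatrix_wedge_mul,
      extRep_mul, mapMatrix_smul_e, smul_mul_smul_comm, sq]

theorem extRep_toSU5 (x : GSM) (v : SMSpace) :
    extRep 5 (toSU5 x) (mapF v) = mapF (smRep x v) := by
  rw [← mapG_mapH, ← mapG_mapH]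
  have h : extRep 5 (toSU5 x) (mapG (mapH v)) = mapG (TensorProduct.map
      (mapMatrix ((x.1 : ℂ) ^ (3 : ℤ) • x.2.1.1)) (mapMatrix ((x.1 : ℂ) ^ (-2 : ℤ) • x.2.2.1))
      (mapH v)) := mapMatrix_blockDiag_wedge _ _ _
  have hp : ∀ (k : ℤ) (l : ℕ), ((x.1 : ℂ) ^ k) ^ l = (x.1 : ℂ) ^ (k * l) := fun k l => by
    rw [← zpow_natCast, ← _root_.zpow_mul]
  rw [h]
  congr 1
  have h1 : ∀ {n : ℕ} (A : Matrix (Fin n) (Fin n) ℂ), mapMatrix A (1 : Fock n) = 1 :=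
    fun A => map_one (ExteriorAlgebra.map _)
  -- The exponents are 3 times the degree in Λℂ² and -2 times the degree in Λℂ³. They differ from
  -- the Pati–Salam ones by moving α³ from the color factor to the isospin factor.
  refine map_mapH (kL := 3) (kU := 6) (k1 := 0) (kC := -2) (kW := -6) (kA := -4) (k0 := 0)
    (fun j => ?_) ?_ ?_ (fun j => ?_) ?_ (fun j => ?_) ?_ rfl rfl rfl rfl rfl rfl rfl rfl rfl rfl
    rfl rfl v
  · have he : isospinL = e := by
      ext j : 1
      fin_cases j <;> rfl
    rw [he, mapMatrix_smul_e, extRep_e]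
  · rw [mapMatrix_wedge_mul, mapMatrix_smul_e, mapMatrix_smul_e, smul_mul_smul_comm, ← sq, hp,
      ← extRep_mul, extRep_two_top]
    rfl
  · rw [h1, zpow_zero, one_smul]
  · rw [mapMatrix_smul_e, extRep_e]
  · rw [mapMatrix_wedge_mul, mapMatrix_wedge_mul, mapMatrix_smul_e, mapMatrix_smul_e,
      mapMatrix_smul_e, smul_mul_smul_comm, smul_mul_smul_comm, ← sq, ← pow_succ, hp,
      ← extRep_mul, ← extRep_mul, extRep_three_top]
    rfl
  · rw [mapMatrix_smul_anticolor, extRep_anticolor, hp]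
    rfl
  · rw [h1, zpow_zero, one_smul]

end GUT

end

/-! ### The cube -/

theorem theorem7 :
    -- the Dirac spinor representation of `Spin(10)` is faithful
    Function.Injective (diracRep 5) ∧
    -- `g ∘ h = f`
    (∀ v : SMSpace, mapG (mapH v) = mapF v) ∧
    ∃ (ψ : SU 5 →ₜ* Spin10) (η : Spin4 × Spin6 →ₜ* Spin10)
      (α : (SU 2 × SU 2 × SU 4) ≃ₜ* (Spin4 × Spin6)),
      -- `ψ` lifts the inclusion `SU(5) ⊂ SO(10)`
      (∀ (A : SU 5) (v : Fin 5 → ℂ), spinCover (ψ A) v = A.1.mulVec v) ∧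
      -- `η` lifts the inclusion `SO(4) × SO(6) ⊂ SO(10)`
      (∀ (x : Spin4) (y : Spin6) (v : Fin 2 → ℂ) (w : Fin 3 → ℂ),
        spinCover (η (x, y)) (Fin.append v w : Fin (2 + 3) → ℂ)
          = Fin.append (spinCover x v) (spinCover y w)) ∧
      -- `α` is the isomorphism under which the spinors are the isospin and color representations
      (∀ (a b : SU 2) (c : SU 4),
        (∀ j, diracRep 2 (α (a, b, c)).1 (isospinL j) = ∑ i, a.1 i j • isospinL i) ∧
        (∀ j, diracRep 2 (α (a, b, c)).1 (isospinR j) = ∑ i, b.1 i j • isospinR i) ∧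
        (∀ j, diracRep 3 (α (a, b, c)).2 (color4 j) = ∑ i, c.1 i j • color4 i)) ∧
      -- the six faces of the cube commute, where `θ` is the composite of `toPatiSalam` and `α`
      ∃ θ : GSM →* Spin4 × Spin6, (∀ x, θ x = α (toPatiSalam x)) ∧
        -- top
        (∀ x, ψ (toSU5 x) = η (θ x)) ∧
        -- bottom
        (∀ T : U SMSpace, U.map (LinearIsometryEquiv.refl ℂ (Fock 5)) (U.map mapF T)
          = U.map mapG (U.map mapH T)) ∧
        -- back
        (∀ x, extRep 5 (toSU5 x) = U.map mapF (smRep x)) ∧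
        -- right
        (∀ A, diracRep 5 (ψ A) = U.map (LinearIsometryEquiv.refl ℂ (Fock 5)) (extRep 5 A)) ∧
        -- left
        (∀ x, diracTensorRep 2 3 (θ x) = U.map mapH (smRep x)) ∧
        -- front
        (∀ x, diracRep 5 (η x) = U.map mapG (diracTensorRep 2 3 x)) := by
  have back : ∀ x, extRep 5 (toSU5 x) = U.map mapF (smRep x) := fun x =>
    LinearIsometryEquiv.ext fun v => by
      obtain ⟨v, rfl⟩ := mapF.surjective v
      rw [extRep_toSU5]
      simp [U.map]
  have left : ∀ x, diracTensorRep 2 3 (patiSalamEquiv (toPatiSalam x)) = U.map mapH (smRep x) :=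
    fun x => LinearIsometryEquiv.ext fun v => by
      obtain ⟨v, rfl⟩ := mapH.surjective v
      rw [diracTensorRep_toPatiSalam]
      simp [U.map]
  have bottom : ∀ T : U SMSpace, U.map (LinearIsometryEquiv.refl ℂ (Fock 5)) (U.map mapF T)
      = U.map mapG (U.map mapH T) := fun T => LinearIsometryEquiv.ext fun v => by
    obtain ⟨v, rfl⟩ := mapF.surjective v
    change mapF (T (mapF.symm (mapF v))) = mapG (mapH (T (mapH.symm (mapG.symm (mapF v)))))
    rw [mapG_mapH, ← mapG_mapH v, mapG.symm_apply_apply, mapH.symm_apply_apply, mapG_mapH,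
      mapF.symm_apply_apply]
  have front : ∀ p, diracRep 5 (spinProd 2 3 p) = U.map mapG (diracTensorRep 2 3 p) :=
    diracRep_spinProd
  have right : ∀ A, diracRep 5 (suLift 5 A)
      = U.map (LinearIsometryEquiv.refl ℂ (Fock 5)) (extRep 5 A) := diracRep_suLift
  refine ⟨diracRep_injective 5, mapG_mapH, ⟨suLift 5, continuous_suLift 5⟩,
    ⟨spinProd 2 3, continuous_spinProd 2 3⟩, patiSalamEquiv, spinCover_suLift,
    spinCover_spinProd, fun a b c => ⟨(isospinEquiv_symm_spec (a, b)).1,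
      (isospinEquiv_symm_spec (a, b)).2, colorEquiv_symm_spec c⟩,
    (patiSalamEquiv : (SU 2 × SU 2 × SU 4) →* (Spin4 × Spin6)).comp toPatiSalam, fun _ => rfl,
    fun x => diracRep_injective 5 ?_, bottom, back, right, left, front⟩
  -- The top face: since Spin(10) acts faithfully, it is enough to compare operators on Λℂ⁵, and the
  -- other five faces carry one path to the other.
  refine (right _).trans ?_
  rw [back, bottom, ← left]
  exact (front _).symm
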